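/- **Notation.** Let $Z(\alpha)=e^{\alpha}$, $\mathrm{sh}(\alpha)=\sinh\alpha$, $\phi=\alpha+\beta-\gamma$, and $0^0=1$. All variables and parameters are complex. *Quad polynomials* in $(x_a,x_b,x_c,x_d;\alpha,\beta)$: - $Q3_{(\delta)}=\mathrm{sh}(\alpha)(x_ax_b+x_cx_d)-\mathrm{sh}(\beta)(x_ax_c+x_bx_d)-\mathrm{sh}(\alpha-\beta)(x_ax_d+x_bx_c)-\delta\,\mathrm{sh}(\alpha)\mathrm{sh}(\beta)\mathrm{sh}(\alpha-\beta)$ - $Q1_{(\delta)}=\alpha(x_a-x_c)(x_b-x_d)-\beta(x_a-x_b)(x_c-x_d)+\delta\alpha\beta(\alpha-\beta)$ - $Q2=Q1_{(0)}+\alpha\beta(\alpha-\beta)(x_a+x_b+x_c+x_d+\alpha\beta-\alpha^2-\beta^2)$ - $H3_{(\delta;\varepsilon)}=Z(\alpha)(x_ax_c+x_bx_d)-Z(\beta)(x_ax_b+x_cx_d)-\mathrm{sh}(\alpha-\beta)\bigl(\delta(2-\varepsilon)+\varepsilon Z(\alpha+\beta)x_ax_d\bigr)$ - $H2_{(\varepsilon)}=(x_a-x_d)(x_b-x_c)-(\alpha-\beta)(x_a+x_b+x_c+x_d)-(\alpha^2-\beta^2)+\tfrac{\varepsilon}{2}(\alpha-\beta)\bigl((2x_a+\alpha+\beta+1)(2x_d+\alpha+\beta+1)+(\alpha-\beta)^2-1\bigr)$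 - $H1_{(\varepsilon)}=(x_a-x_d)(x_b-x_c)+2(\alpha-\beta)-\varepsilon(\alpha-\beta)(2+x_a+x_d)$ For a quad polynomial $H$, put $\tilde H(x_a,x_b,x_c,x_d;\alpha,\beta)=H(x_b,x_a,x_d,x_c;\alpha,\beta)$ and $\overset{*}{H}(x_a,x_b,x_c,x_d;\alpha,\beta)=H(x_a,x_d,x_c,x_b;\beta-\alpha,\beta)$. *Face-centered quad polynomials* in $(x;x_a,x_b,x_c,x_d;\alpha,\beta,\gamma)$: $$\begin{aligned}C3_{(\delta_1;\delta_2;\delta_3)}=\;&x\Bigl[(x_ax_c-x_bx_d)Z(\beta)+(x_bx_c-x_ax_d)Z(\gamma-\beta)+\delta_1\bigl(Z(-\alpha)-2(\delta_3x_ax_b-\delta_2x_cx_d)Z(\alpha-\gamma)\bigr)\bigl(1-Z(2\gamma)\bigr)\Bigr]\\&+\bigl(x_ax_b+2\delta_2\mathrm{sh}(\beta)\mathrm{sh}(\beta-\gamma)\bigr)\bigl(x_d-x_cZ(\gamma)\bigr)+\bigl(x_dZ(\gamma)-x_c\bigr)x^2\\&+\delta_1Z(-\alpha)\bigl(1+2\delta_2x_cx_dZ(2\alpha-\gamma)\bigr)\Bigl(\bigl(Z(\beta)-2\delta_3Z(2\alpha-\beta)x^2\bigr)\bigl(x_bZ(\gamma)-x_a\bigr)\\&\qquad+\bigl(x_aZ(\gamma)-x_b\bigr)\bigl(Z(\gamma-\beta)-2\delta_3Z(\alpha+\phi)x^2\bigr)\Bigr),\end{aligned}$$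 $$\begin{aligned}C2_{(\delta_1;\delta_2;\delta_3)}=\;&x\Bigl[\bigl(x_a+x_b+2\delta_2(\beta-\gamma)\beta\bigr)(x_c-x_d)+(x_a-x_b)(2\beta-\gamma)(\gamma-2\alpha)^{\delta_3}\\&\quad+\delta_1\gamma\bigl(x_c+x_d+(2\alpha-\gamma)(\gamma-2\alpha)^{\delta_3}\bigr)(\gamma-2\alpha)^{\delta_2}+2\delta_2\gamma\bigl((\alpha-\gamma)\alpha-x_cx_d\bigr)+2\delta_3\gamma\bigl((\alpha-\beta)\phi+x_ax_b\bigr)\Bigr]\\&+(x^2-x_ax_b)\gamma(\gamma-2\alpha)^{\delta_3}-(x^2+x_ax_b)(x_c-x_d)\\&+\delta_1\beta(\beta-\gamma)\bigl(\gamma(\gamma-2\alpha)^{\delta_3}+x_c-x_d\bigr)\bigl(\beta(\gamma-\beta)+x_a+x_b\bigr)^{\delta_2}-2\delta_3\gamma(x_a+x_b)x^2\\&+\delta_1\bigl(\beta(x_a-x_b)-\gamma x_a\bigr)\bigl(x_c+x_d+(2\alpha-\gamma)(\gamma-2\alpha)^{\delta_3}+2\delta_3(\alpha(\alpha-\gamma)-x^2)\bigr)(\gamma-2\alpha)^{\delta_2}\\&+2\delta_2\Bigl(\beta\gamma(\beta-\gamma)(\alpha+x_c)(\alpha-\gamma+x_d)+\bigl(\gamma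 x_a-\beta(x_a-x_b)\bigr)\bigl(\alpha(\gamma-\alpha)+x_cx_d\bigr)\Bigr),\end{aligned}$$ $$\begin{aligned}C1_{(\delta)}=\;&x\Bigl[2\gamma\bigl(-\tfrac{x_c}{2}-\tfrac{x_d}{2}\bigr)^{\delta}-(x_a+x_b)(x_c-x_d)\Bigr]+2\bigl(\beta(x_a-x_b)-\gamma x_a\bigr)\bigl(-\tfrac{x_c}{2}-\tfrac{x_d}{2}\bigr)^{\delta}\\&+\bigl(x^2+x_ax_b+\delta\beta(\gamma-\beta)\bigr)(x_c-x_d).\end{aligned}$$ *Combinations* $(C,\overline C;H;Q,Q^*)$: one of the ten rows | $C$ | $\overline C$ | $H$ | $Q$ | $Q^*$ | |---|---|---|---|---| | $C3_{(1/2;1/2;0)}$ | $C3_{(1/2;0;1/2)}$ | $H3_{(1;1)}$ | $Q3_{(1)}$ | $Q3_{(0)}$ | | $C3_{(1/2;0;1/2)}$ | $C3_{(1/2;1/2;0)}$ | $\widetilde{H3}_{(1;1)}$ | $Q3_{(0)}$ | $Q3_{(1)}$ | | $C3_{(1;0;0)}$ | $C3_{(1;0;0)}$ | $H3_{(1;0)}$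 | $Q3_{(0)}$ | $Q3_{(0)}$ | | $C3_{(0;0;0)}$ | $C3_{(0;0;0)}$ | $H3_{(0;0)}$ | $Q3_{(0)}$ | $Q3_{(0)}$ | | $C2_{(1;1;0)}$ | $C2_{(1;0;1)}$ | $H2_{(1)}$ | $Q2$ | $Q1_{(1)}$ | | $C2_{(1;0;1)}$ | $C2_{(1;1;0)}$ | $\widetilde{H2}_{(1)}$ | $Q1_{(1)}$ | $Q2$ | | $C2_{(1;0;0)}$ | $C2_{(1;0;0)}$ | $H2_{(0)}$ | $Q1_{(1)}$ | $Q1_{(1)}$ | | $C1_{(1)}$ | $C2_{(0;0;0)}$ | $H1_{(1)}$ | $Q1_{(1)}$ | $Q1_{(0)}$ | | $C2_{(0;0;0)}$ | $C1_{(1)}$ | $\widetilde{H1}_{(1)}$ | $Q1_{(0)}$ | $Q1_{(1)}$ | | $C1_{(0)}$ | $C1_{(0)}$ | $H1_{(0)}$ | $Q1_{(0)}$ | $Q1_{(0)}$ | *Hex system.* $\mathbf C(x_a,\dots,x_f;\alpha,\beta,\gamma)$ denotes the six equations (centered at $x_a,\dots,x_f$ in turn) $$\begin{aligned}&\overline C(x_a;x_f,x_e,x_b,x_c;\gamma,\beta,\alpha)=0,\quad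 C(x_b;x_c,x_d,x_a,x_f;\gamma,\alpha,\beta)=0,\quad C(x_c;x_b,x_d,x_a,x_e;\gamma-\alpha,-\alpha,\beta-\alpha)=0,\\&C(x_d;x_c,x_b,x_e,x_f;\gamma,\beta,\alpha)=0,\quad \overline C(x_e;x_f,x_a,x_d,x_c;\gamma,\alpha,\beta)=0,\quad \overline C(x_f;x_e,x_a,x_d,x_b;\gamma-\alpha,-\alpha,\beta-\alpha)=0.\end{aligned}$$ Each of them omits the variable at the vertex opposite to its center. It is said to *determine* the variables at two neighbouring vertices if, the other four being given, the equation omitting either one of the two has exactly one solution for the other one, and all six equations hold for these two values. A quad equation determines a variable if, the other three being given, it has exactly one solution for it. *Elongated dodecahedron.* There are eighteen vertex variables $x_a,\dots,x_f,y_a,\dots,y_f,z_a,\dots,z_f$ and five edge parameters $\alpha,\beta,\gamma,\rho,\overline\rho$. The four hexagonal and eight quadrilateral faces carry the following equations, each listed with the variables it is to determine. *Arrangement 1*, initial values $x_a,x_b,x_c,x_f,z_a,z_b$: 1. $\mathbf C(x_a,x_b,x_c,x_d,x_e,x_f;\alpha,\beta,\gamma)$ for $x_d,x_e$; $\mathbf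 C(y_a,y_b,z_b,x_b,x_a,z_a;\rho,\overline\rho,\gamma)$ for $y_a,y_b$; $Q(z_b,z_c,x_b,x_c;\alpha,\overline\rho)=0$ for $z_c$; $Q^*(z_a,z_f,x_a,x_f;\beta,\rho)=0$ for $z_f$. 2. $Q(z_c,z_d,x_c,x_d;\beta,\overline\rho)=0$ for $z_d$; $Q^*(z_f,z_e,x_f,x_e;\alpha,\rho)=0$ for $z_e$; $Q(y_b,y_c,z_b,z_c;\alpha,\rho)=0$ for $y_c$; $Q^*(y_a,y_f,z_a,z_f;\beta,\overline\rho)=0$ for $y_f$. 3. $\mathbf C(y_a,y_b,y_c,y_d,y_e,y_f;\alpha,\beta,\gamma)$ for $y_d,y_e$; $\mathbf C(y_e,y_d,z_d,x_d,x_e,z_e;\rho,\overline\rho,\gamma)$ for $y_d,y_e$; $Q(y_c,y_d,z_c,z_d;\beta,\rho)=0$ for $y_d$; $Q^*(y_f,y_e,z_f,z_e;\alpha,\overline\rho)=0$ for $y_e$. *Arrangement 2*, initial values $x_a,x_b,x_c,x_d,z_b,z_c$: 1. $\mathbf C(x_a,x_b,x_c,x_d,x_e,x_f;\alpha,\beta,\gamma)$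 for $x_e,x_f$; $\mathbf C(y_c,z_c,x_c,x_b,z_b,y_b;\overline\rho,\alpha,\rho)$ for $y_b,y_c$; $Q(z_c,z_d,x_c,x_d;\beta,\overline\rho)=0$ for $z_d$; $H(z_b,z_a,x_b,x_a;\gamma,\rho)=0$ for $z_a$. 2. $\overset{*}{H}(z_e,x_e,z_d,x_d;\overline\rho,\gamma)=0$ for $z_e$; $\overset{*}{H}(x_f,x_a,z_f,z_a;\beta,\rho)=0$ for $z_f$; $\overset{*}{H}(y_c,y_d,z_c,z_d;\beta,\rho)=0$ for $y_d$; $\overset{*}{H}(z_b,y_b,z_a,y_a;\overline\rho,\gamma)=0$ for $y_a$. 3. $\mathbf C(y_d,y_e,y_f,y_a,y_b,y_c;\alpha,\beta,\gamma)$ for $y_e,y_f$; $\mathbf C(x_f,z_f,y_f,y_e,z_e,x_e;\overline\rho,\alpha,\rho)$ for $y_e,y_f$; $H(y_d,y_e,z_d,z_e;\gamma,\rho)=0$ for $y_e$; $Q(y_a,y_f,z_a,z_f;\beta,\overline\rho)=0$ for $y_f$. **Theorem (consistency-around-an-elongated-dodecahedron).** For each of the ten combinations and each of the two arrangements, the following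 holds for generic parameters and initial values, that is, outside the zero set of some nonzero polynomial in the six initial values and the five parameters (the five exponentials $e^{\alpha},e^{\beta},e^{\gamma},e^{\rho},e^{\overline\rho}$ for the four $C3$ combinations). The overdetermined system of $4\cdot 6+8=32$ equations in the twelve unknown variables has exactly one solution with the given initial values. Moreover, this solution is obtained by the three steps above: with the values found before, every hex system and every quad equation in the list determines the variables listed with it, and in step 3 the values of the last two variables obtained from the two hex systems and the two quad equations agree. -/

import Mathlib

namespace HexQuad

/-! ### The polynomials of the quad and face-centered quad equations -/

/-- A face-centered quad polynomial `A(x; x_a, x_b, x_c, x_d; α, β, γ)`; the equation is `A = 0`. -/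
abbrev FCQuad := (x xa xb xc xd α β γ : ℂ) → ℂ

/-- A quad polynomial `Q(x_a, x_b, x_c, x_d; α, β)`; the equation is `Q = 0`.  The square has the
edges `ab`, `cd` (parameter `α`) and `ac`, `bd` (parameter `β`). -/
abbrev Quad := (xa xb xc xd α β : ℂ) → ℂ

/-- `Z(α) = e ^ α`. -/
noncomputable def Z (α : ℂ) : ℂ := Complex.exp α

/-- `sh(α) = sinh α`. -/
noncomputable def sh (α : ℂ) : ℂ := Complex.sinh α

/-- The coefficient of `x` in `C3_(δ₁; δ₂; δ₃)`. -/
noncomputable def PC3 (δ₁ δ₂ δ₃ xa xb xc xd α β γ : ℂ) : ℂ :=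
  (xa * xc - xb * xd) * Z β + (xb * xc - xa * xd) * Z (γ - β)
    + δ₁ * (Z (-α) - 2 * (δ₃ * xa * xb - δ₂ * xc * xd) * Z (α - γ)) * (1 - Z (2 * γ))

/-- The type-C hyperbolic polynomial `C3_(δ₁; δ₂; δ₃)`. -/
noncomputable def C3 (δ₁ δ₂ δ₃ : ℂ) : FCQuad := fun x xa xb xc xd α β γ =>
  x * PC3 δ₁ δ₂ δ₃ xa xb xc xd α β γ
    + (xa * xb + 2 * δ₂ * sh β * sh (β - γ)) * (xd - xc * Z γ)
    + (xd * Z γ - xc) * x ^ 2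
    + δ₁ * Z (-α) * (1 + 2 * δ₂ * xc * xd * Z (2 * α - γ)) *
      ((Z β - 2 * δ₃ * Z (2 * α - β) * x ^ 2) * (xb * Z γ - xa)
        + (xa * Z γ - xb) * (Z (γ - β) - 2 * δ₃ * Z (α + (α + β - γ)) * x ^ 2))

/-- The coefficient of `x` in `C2_(δ₁; δ₂; δ₃)`. -/
noncomputable def PC2 (δ₁ δ₂ δ₃ : ℕ) (xa xb xc xd α β γ : ℂ) : ℂ :=
  (xa + xb + 2 * δ₂ * (β - γ) * β) * (xc - xd)
    + (xa - xb) * (2 * β - γ) * (γ - 2 * α) ^ δ₃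
    + δ₁ * γ * (xc + xd + (2 * α - γ) * (γ - 2 * α) ^ δ₃) * (γ - 2 * α) ^ δ₂
    + 2 * δ₂ * γ * ((α - γ) * α - xc * xd)
    + 2 * δ₃ * γ * ((α - β) * (α + β - γ) + xa * xb)

/-- The type-C rational (or, for `δ₁ = δ₂ = δ₃ = 0`, algebraic) polynomial `C2_(δ₁; δ₂; δ₃)`. -/
noncomputable def C2 (δ₁ δ₂ δ₃ : ℕ) : FCQuad := fun x xa xb xc xd α β γ =>
  x * PC2 δ₁ δ₂ δ₃ xa xb xc xd α β γ
    + (x ^ 2 - xa * xb) * γ * (γ - 2 * α) ^ δ₃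
    - (x ^ 2 + xa * xb) * (xc - xd)
    + δ₁ * β * (β - γ) * (γ * (γ - 2 * α) ^ δ₃ + (xc - xd)) * (β * (γ - β) + xa + xb) ^ δ₂
    - 2 * δ₃ * γ * (xa + xb) * x ^ 2
    + δ₁ * (β * (xa - xb) - γ * xa) *
      (xc + xd + (2 * α - γ) * (γ - 2 * α) ^ δ₃ + 2 * δ₃ * (α * (α - γ) - x ^ 2)) *
      (γ - 2 * α) ^ δ₂
    + 2 * δ₂ * (β * γ * (β - γ) * (α + xc) * (α - γ + xd)
      + (γ * xa - β * (xa - xb)) * (α * (γ - α) + xc * xd))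

/-- The coefficient of `x` in `C1_(δ)`. -/
noncomputable def PC1 (δ : ℕ) (xa xb xc xd γ : ℂ) : ℂ :=
  2 * γ * (-xc / 2 - xd / 2) ^ δ - (xa + xb) * (xc - xd)

/-- The type-C polynomial `C1_(δ)`; it does not depend on `α`. -/
noncomputable def C1 (δ : ℕ) : FCQuad := fun x xa xb xc xd _ β γ =>
  x * PC1 δ xa xb xc xd γ
    + 2 * (β * (xa - xb) - γ * xa) * (-xc / 2 - xd / 2) ^ δ
    + (x ^ 2 + xa * xb + δ * β * (γ - β)) * (xc - xd)

/-- The quad polynomial `Q3_(δ)`. -/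
noncomputable def Q3 (δ : ℂ) : Quad := fun xa xb xc xd α β =>
  sh α * (xa * xb + xc * xd) - sh β * (xa * xc + xb * xd)
    - sh (α - β) * (xa * xd + xb * xc) - δ * sh α * sh β * sh (α - β)

/-- The quad polynomial `Q1_(δ)`. -/
noncomputable def Q1 (δ : ℂ) : Quad := fun xa xb xc xd α β =>
  α * (xa - xc) * (xb - xd) - β * (xa - xb) * (xc - xd) + δ * α * β * (α - β)

/-- The quad polynomial `Q2`. -/
noncomputable def Q2 : Quad := fun xa xb xc xd α β =>
  Q1 0 xa xb xc xd α β
    + α * β * (α - β) * (xa + xb + xc + xd + α * β - α ^ 2 - β ^ 2)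

/-- The quad polynomial `H3_(δ; ε)`. -/
noncomputable def H3 (δ ε : ℂ) : Quad := fun xa xb xc xd α β =>
  Z α * (xa * xc + xb * xd) - Z β * (xa * xb + xc * xd)
    - sh (α - β) * (δ * (2 - ε) + ε * (Z (α + β) * xa * xd))

/-- The quad polynomial `H2_(ε)`. -/
noncomputable def H2 (ε : ℂ) : Quad := fun xa xb xc xd α β =>
  (xa - xd) * (xb - xc) - (α - β) * (xa + xb + xc + xd) - (α ^ 2 - β ^ 2)
    + ε / 2 * (α - β) *
      ((2 * xa + α + β + 1) * (2 * xd + α + β + 1) + (α - β) ^ 2 - 1)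

/-- The quad polynomial `H1_(ε)`. -/
noncomputable def H1 (ε : ℂ) : Quad := fun xa xb xc xd α β =>
  (xa - xd) * (xb - xc) + 2 * (α - β) - ε * (α - β) * (2 + xa + xd)

/-- The quad polynomial with `x_a ↔ x_b` and `x_c ↔ x_d` exchanged. -/
def Quad.swap (H : Quad) : Quad := fun xa xb xc xd α β => H xb xa xd xc α β

/-- The trapezoidal version of a type-H polynomial. -/
def Quad.trapezoidal (H : Quad) : Quad := fun xa xb xc xd α β => H xa xd xc xb (β - α) β

/-! ### The combinations of equations -/

/-- The ten combinations of type-C hex equations and quad equations, named by `C`. -/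
inductive Combination
  | C3_half_half_0
  | C3_half_0_half
  | C3_1_0_0
  | C3_0_0_0
  | C2_1_1_0
  | C2_1_0_1
  | C2_1_0_0
  | C1_1
  | C2_0_0_0
  | C1_0

namespace Combination

noncomputable def C : Combination → FCQuad
  | C3_half_half_0 => C3 (1 / 2) (1 / 2) 0
  | C3_half_0_half => C3 (1 / 2) 0 (1 / 2)
  | C3_1_0_0 => C3 1 0 0
  | C3_0_0_0 => C3 0 0 0
  | C2_1_1_0 => C2 1 1 0
  | C2_1_0_1 => C2 1 0 1
  | C2_1_0_0 => C2 1 0 0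
  | C1_1 => C1 1
  | C2_0_0_0 => C2 0 0 0
  | C1_0 => C1 0

noncomputable def Cbar : Combination → FCQuad
  | C3_half_half_0 => C3 (1 / 2) 0 (1 / 2)
  | C3_half_0_half => C3 (1 / 2) (1 / 2) 0
  | C3_1_0_0 => C3 1 0 0
  | C3_0_0_0 => C3 0 0 0
  | C2_1_1_0 => C2 1 0 1
  | C2_1_0_1 => C2 1 1 0
  | C2_1_0_0 => C2 1 0 0
  | C1_1 => C2 0 0 0
  | C2_0_0_0 => C1 1
  | C1_0 => C1 0

noncomputable def H : Combination → Quad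
  | C3_half_half_0 => H3 1 1
  | C3_half_0_half => (H3 1 1).swap
  | C3_1_0_0 => H3 1 0
  | C3_0_0_0 => H3 0 0
  | C2_1_1_0 => H2 1
  | C2_1_0_1 => (H2 1).swap
  | C2_1_0_0 => H2 0
  | C1_1 => H1 1
  | C2_0_0_0 => (H1 1).swap
  | C1_0 => H1 0

noncomputable def Q : Combination → Quad
  | C3_half_half_0 => Q3 1
  | C3_half_0_half => Q3 0
  | C3_1_0_0 => Q3 0
  | C3_0_0_0 => Q3 0
  | C2_1_1_0 => Q2
  | C2_1_0_1 => Q1 1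
  | C2_1_0_0 => Q1 1
  | C1_1 => Q1 1
  | C2_0_0_0 => Q1 0
  | C1_0 => Q1 0

noncomputable def Qstar : Combination → Quad
  | C3_half_half_0 => Q3 0
  | C3_half_0_half => Q3 1
  | C3_1_0_0 => Q3 0
  | C3_0_0_0 => Q3 0
  | C2_1_1_0 => Q1 1
  | C2_1_0_1 => Q2
  | C2_1_0_0 => Q1 1
  | C1_1 => Q1 0
  | C2_0_0_0 => Q1 1
  | C1_0 => Q1 0

/-- The trapezoidal version of `H`. -/
noncomputable def Hstar (F : Combination) : Quad := F.H.trapezoidal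

/-- The coordinate in which the coefficients of the equations are rational functions of the
parameters: `e ^ α` in the hyperbolic combinations and `α` itself in all the others. -/
noncomputable def coord : Combination → ℂ → ℂ
  | C3_half_half_0 => Complex.exp
  | C3_half_0_half => Complex.exp
  | C3_1_0_0 => Complex.exp
  | C3_0_0_0 => Complex.exp
  | C2_1_1_0 => id
  | C2_1_0_1 => id
  | C2_1_0_0 => id
  | C1_1 => id
  | C2_0_0_0 => id
  | C1_0 => id

/-- The system of type-C hex equations `𝐂(x_a, x_b, x_c, x_d, x_e, x_f; α, β, γ)`: the entries are
the left-hand sides of (C.a), …, (C.f), and the entry `j` is centered at the vertex `j` and does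
not involve the vertex `j + 3`.  Here `X = ![x_a, …, x_f]` goes around the hexagon, whose edges
`ab`, `de` carry `γ`, `bc`, `ef` carry `α`, and `cd`, `fa` carry `β`. -/
noncomputable def hexC (F : Combination) (X : Fin 6 → ℂ) (α β γ : ℂ) : Fin 6 → ℂ :=
  ![F.Cbar (X 0) (X 5) (X 4) (X 1) (X 2) γ β α,
    F.C (X 1) (X 2) (X 3) (X 0) (X 5) γ α β,
    F.C (X 2) (X 1) (X 3) (X 0) (X 4) (γ - α) (-α) (β - α),
    F.C (X 3) (X 2) (X 1) (X 4) (X 5) γ β α,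
    F.Cbar (X 4) (X 5) (X 0) (X 3) (X 2) γ α β,
    F.Cbar (X 5) (X 4) (X 0) (X 3) (X 1) (γ - α) (-α) (β - α)]

/-- All six hex equations hold. -/
def HexHolds (F : Combination) (X : Fin 6 → ℂ) (α β γ : ℂ) : Prop :=
  ∀ j, F.hexC X α β γ j = 0

/-- The hex system is used to solve uniquely for the variables at the neighbouring vertices
`u`, `u + 1` in terms of the other four, with the result `X u`, `X (u + 1)`: the equation
without the variable `u + 1` has the unique solution `X u` for the variable `u`, the equation
without the variable `u` has the unique solution `X (u + 1)` for the variable `u + 1`, and all six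
equations are satisfied on these solutions. -/
def HexDetermines (F : Combination) (X : Fin 6 → ℂ) (α β γ : ℂ) (u : Fin 6) : Prop :=
  (∀ s, F.hexC (Function.update X u s) α β γ (u + 4) = 0 ↔ s = X u) ∧
  (∀ s, F.hexC (Function.update X (u + 1) s) α β γ (u + 3) = 0 ↔ s = X (u + 1)) ∧
  F.HexHolds X α β γ

end Combination

/-- An equation `q(s) = 0` in one unknown has the unique solution `v`. -/
def Determines (q : ℂ → ℂ) (v : ℂ) : Prop := ∀ s, q s = 0 ↔ s = v

/-! ### The elongated dodecahedron -/

/-- Values at the eighteen vertices of the elongated dodecahedron. -/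
@[ext]
structure Labelling where
  (xa xb xc xd xe xf : ℂ)
  (ya yb yc yd ye yf : ℂ)
  (za zb zc zd ze zf : ℂ)

/-- The five edge parameters `α, β, γ, ρ, ρ̄` in this order, as a vector. -/
abbrev Params := Fin 5 → ℂ

namespace Fig1

/-- The initial values `x_a, x_b, x_c, x_f, z_a, z_b`. -/
def initial (v : Labelling) : Fin 6 → ℂ := ![v.xa, v.xb, v.xc, v.xf, v.za, v.zb]

/-- The 32 equations on the twelve faces: four hex systems and eight quad equations. -/
def Equations (F : Combination) (t : Params) (v : Labelling) : Prop :=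
  let α := t 0
  let β := t 1
  let γ := t 2
  let ρ := t 3
  let ρ' := t 4
  F.HexHolds ![v.xa, v.xb, v.xc, v.xd, v.xe, v.xf] α β γ ∧
  F.HexHolds ![v.ya, v.yb, v.zb, v.xb, v.xa, v.za] ρ ρ' γ ∧
  F.HexHolds ![v.ya, v.yb, v.yc, v.yd, v.ye, v.yf] α β γ ∧
  F.HexHolds ![v.ye, v.yd, v.zd, v.xd, v.xe, v.ze] ρ ρ' γ ∧
  F.Q v.zb v.zc v.xb v.xc α ρ' = 0 ∧
  F.Qstar v.za v.zf v.xa v.xf β ρ = 0 ∧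
  F.Q v.zc v.zd v.xc v.xd β ρ' = 0 ∧
  F.Qstar v.zf v.ze v.xf v.xe α ρ = 0 ∧
  F.Q v.yb v.yc v.zb v.zc α ρ = 0 ∧
  F.Qstar v.ya v.yf v.za v.zf β ρ' = 0 ∧
  F.Q v.yc v.yd v.zc v.zd β ρ = 0 ∧
  F.Qstar v.yf v.ye v.zf v.ze α ρ' = 0

/-- The three steps of the evolution from the initial values, each equation (or hex system)
determining the indicated variable(s) uniquely, with all the results in the third step agreeing. -/
def Steps (F : Combination) (t : Params) (v : Labelling) : Prop :=
  let α := t 0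
  let β := t 1
  let γ := t 2
  let ρ := t 3
  let ρ' := t 4
  -- step (i): `x_d, x_e`; `y_a, y_b`; `z_c`; `z_f`
  F.HexDetermines ![v.xa, v.xb, v.xc, v.xd, v.xe, v.xf] α β γ 3 ∧
  F.HexDetermines ![v.ya, v.yb, v.zb, v.xb, v.xa, v.za] ρ ρ' γ 0 ∧
  Determines (fun s => F.Q v.zb s v.xb v.xc α ρ') v.zc ∧
  Determines (fun s => F.Qstar v.za s v.xa v.xf β ρ) v.zf ∧
  -- step (ii): `z_d`; `z_e`; `y_c`; `y_f`
  Determines (fun s => F.Q v.zc s v.xc v.xd β ρ') v.zd ∧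
  Determines (fun s => F.Qstar v.zf s v.xf v.xe α ρ) v.ze ∧
  Determines (fun s => F.Q v.yb s v.zb v.zc α ρ) v.yc ∧
  Determines (fun s => F.Qstar v.ya s v.za v.zf β ρ') v.yf ∧
  -- step (iii): `y_d, y_e` from either hex system, `y_d` and `y_e` from the two quad equations
  F.HexDetermines ![v.ya, v.yb, v.yc, v.yd, v.ye, v.yf] α β γ 3 ∧
  F.HexDetermines ![v.ye, v.yd, v.zd, v.xd, v.xe, v.ze] ρ ρ' γ 0 ∧
  Determines (fun s => F.Q v.yc s v.zc v.zd β ρ) v.yd ∧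
  Determines (fun s => F.Qstar v.yf s v.zf v.ze α ρ') v.ye

end Fig1

namespace Fig2

/-- The initial values `x_a, x_b, x_c, x_d, z_b, z_c`. -/
def initial (v : Labelling) : Fin 6 → ℂ := ![v.xa, v.xb, v.xc, v.xd, v.zb, v.zc]

/-- The 32 equations on the twelve faces: four hex systems and eight quad equations. -/
def Equations (F : Combination) (t : Params) (v : Labelling) : Prop :=
  let α := t 0
  let β := t 1
  let γ := t 2
  let ρ := t 3
  let ρ' := t 4
  F.HexHolds ![v.xa, v.xb, v.xc, v.xd, v.xe, v.xf] α β γ ∧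
  F.HexHolds ![v.yc, v.zc, v.xc, v.xb, v.zb, v.yb] ρ' α ρ ∧
  F.HexHolds ![v.yd, v.ye, v.yf, v.ya, v.yb, v.yc] α β γ ∧
  F.HexHolds ![v.xf, v.zf, v.yf, v.ye, v.ze, v.xe] ρ' α ρ ∧
  F.Q v.zc v.zd v.xc v.xd β ρ' = 0 ∧
  F.H v.zb v.za v.xb v.xa γ ρ = 0 ∧
  F.Hstar v.ze v.xe v.zd v.xd ρ' γ = 0 ∧
  F.Hstar v.xf v.xa v.zf v.za β ρ = 0 ∧
  F.Hstar v.yc v.yd v.zc v.zd β ρ = 0 ∧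
  F.Hstar v.zb v.yb v.za v.ya ρ' γ = 0 ∧
  F.H v.yd v.ye v.zd v.ze γ ρ = 0 ∧
  F.Q v.ya v.yf v.za v.zf β ρ' = 0

/-- The three steps of the evolution from the initial values, each equation (or hex system)
determining the indicated variable(s) uniquely, with all the results in the third step agreeing. -/
def Steps (F : Combination) (t : Params) (v : Labelling) : Prop :=
  let α := t 0
  let β := t 1
  let γ := t 2
  let ρ := t 3
  let ρ' := t 4
  -- step (i): `x_e, x_f`; `y_b, y_c`; `z_d`; `z_a`
  F.HexDetermines ![v.xa, v.xb, v.xc, v.xd, v.xe, v.xf] α β γ 4 ∧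
  F.HexDetermines ![v.yc, v.zc, v.xc, v.xb, v.zb, v.yb] ρ' α ρ 5 ∧
  Determines (fun s => F.Q v.zc s v.xc v.xd β ρ') v.zd ∧
  Determines (fun s => F.H v.zb s v.xb v.xa γ ρ) v.za ∧
  -- step (ii): `z_e`; `z_f`; `y_d`; `y_a`
  Determines (fun s => F.Hstar s v.xe v.zd v.xd ρ' γ) v.ze ∧
  Determines (fun s => F.Hstar v.xf v.xa s v.za β ρ) v.zf ∧
  Determines (fun s => F.Hstar v.yc s v.zc v.zd β ρ) v.yd ∧
  Determines (fun s => F.Hstar v.zb v.yb v.za s ρ' γ) v.ya ∧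
  -- step (iii): `y_e, y_f` from either hex system, `y_e` and `y_f` from the two quad equations
  F.HexDetermines ![v.yd, v.ye, v.yf, v.ya, v.yb, v.yc] α β γ 1 ∧
  F.HexDetermines ![v.xf, v.zf, v.yf, v.ye, v.ze, v.xe] ρ' α ρ 2 ∧
  Determines (fun s => F.H v.yd s v.zd v.ze γ ρ) v.ye ∧
  Determines (fun s => F.Q v.ya s v.za v.zf β ρ') v.yf

end Fig2

/-! ### Consistency -/

/-- For given initial values `x₀`, the overdetermined system `Equations` has exactly one solution
with these initial values, and this solution is obtained by the evolution `Steps`. -/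
def Consistent (initial : Labelling → Fin 6 → ℂ) (Equations Steps : Labelling → Prop)
    (x₀ : Fin 6 → ℂ) : Prop :=
  ∃ v : Labelling, initial v = x₀ ∧ Equations v ∧ Steps v ∧
    ∀ w : Labelling, initial w = x₀ → Equations w → w = v

/-- `p` holds for generic initial values and parameters: outside the zero set of some nonzero
polynomial in the six initial values and the five parameter coordinates `c (t k)`. -/
def HoldsGenerically (c : ℂ → ℂ) (p : (Fin 6 → ℂ) → Params → Prop) : Prop :=
  ∃ P : MvPolynomial (Fin 6 ⊕ Fin 5) ℂ, P ≠ 0 ∧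
    ∀ (x₀ : Fin 6 → ℂ) (t : Params),
      MvPolynomial.eval (Sum.elim x₀ (fun k => c (t k))) P ≠ 0 → p x₀ t

/-- Consistency-around-an-elongated-dodecahedron for the first arrangement of equations. -/
def CAED1 (F : Combination) : Prop :=
  HoldsGenerically F.coord fun x₀ t =>
    Consistent Fig1.initial (Fig1.Equations F t) (Fig1.Steps F t) x₀

/-- Consistency-around-an-elongated-dodecahedron for the second arrangement of equations. -/
def CAED2 (F : Combination) : Prop :=
  HoldsGenerically F.coord fun x₀ t =>
    Consistent Fig2.initial (Fig2.Equations F t) (Fig2.Steps F t) x₀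

end HexQuad

/-! The elongated dodecahedron is drawn in a larger cubic lattice whose directions carry α, β, γ, ρ,
ρ̄ and whose squares carry quad equations. Vertices come in two types. Squares joining four vertices
of one type carry `Q` or `Qs`, squares with two parallel edges between vertices of the same type
carry the trapezoidal form `Fam.T` of `H`, and squares all of whose edges change type carry `H`
itself. A hexagon of the dodecahedron is the equatorial hexagon of a 3-cube with two opposite
vertices removed. Every face-centered polynomial is, up to an invertible factor, the resultant of
two face equations of that cube with respect to the removed vertex they share (`Fam.Good.C_of_Q`,
`Cb_of_Qs`, `C_of_T`, `Cb_of_T`). So a solution of the quad equations on the cube satisfies all six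
hex equations (`Combination.hexHolds_of_faces`).

Existence thus reduces to consistency of quad equations on 3-cubes. There are four kinds of
statement: `cube` (all vertices of one type), `parallel` (two layers of opposite type), and
`transport` and `translate` (a cube over a square that carries `H`). Each is an explicit
ideal-membership certificate, valid where certain edge polynomials and leading coefficients do not
vanish. From the six initial values some auxiliary lattice values are solved for. The remaining ones
follow face by face, and the cube statements supply the faces that were not used in the
construction, in particular the coinciding results of step 3.

Uniqueness needs no lattice. All equations are affine-linear in the variable they determine, so with
nonzero coefficients any solution is forced to agree with the constructed one, step after step.

For genericity, all lattice values are rational functions with integer coefficients in the initial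
values and parameter coordinates, and finitely many such functions must not vanish. It suffices to
exhibit one point over the field with 1009 elements at which everything is regular and nonzero. An
integer polynomial that does not vanish at a point modulo 1009 is nonzero, also over ℂ. The points
are listed at the end and checked by computation (`Fig1.exists_witness`, `Fig2.exists_witness`). -/

namespace HexQuad

/-! ### The equations as rational functions of the parameter coordinates -/

/-- The polynomials of a combination, as functions of the variables and of the coordinates of the
parameters, over a type `K` of numbers.  `sub` and `neg` describe the difference and the negative of
parameters in these coordinates, and `reg` vanishes at the degenerate parameters. -/
structure Fam (K : Type*) where
  C : K → K → K → K → K → K → K → K → K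
  Cb : K → K → K → K → K → K → K → K → K
  H : K → K → K → K → K → K → K
  Q : K → K → K → K → K → K → K
  Qs : K → K → K → K → K → K → K
  sub : K → K → K
  neg : K → K
  reg : K → K

namespace Fam

variable {K : Type*}

/-- The equation on a quadrilateral whose edges with parameter `a` join vertices of the same type:
`w`, `w'` of the first and `y`, `y'` of the second type. -/
def T (F : Fam K) (w w' y y' a g : K) : K := F.H w y' y w' (F.sub g a) g

/-- The family with the two types of vertices exchanged. -/
def swap (F : Fam K) : Fam K where
  C := F.Cb
  Cb := F.C
  H := fun xa xb xc xd a b => F.H xb xa xd xc a b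
  Q := F.Qs
  Qs := F.Q
  sub := F.sub
  neg := F.neg
  reg := F.reg

end Fam

section ops

-- No laws are assumed for these operations: the same expressions are read in ℂ, where they are the
-- equations, and in `Fp`, where they are evaluated on natural numbers.
variable {K : Type*} [Zero K] [One K] [Add K] [Sub K] [Mul K] [Neg K] [Inv K]

/-- The slope of a function which is affine-linear. -/
def slope1 (q : K → K) : K := q 1 - q 0

/-- The determinant of the coefficients of a function which is affine-linear in two variables. -/
def det2 (q : K → K → K) : K := q 0 0 * q 1 1 - q 0 1 * q 1 0

/-- The zero of a function which is affine-linear. -/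
def root1 (q : K → K) : K := -q 0 * (q 1 - q 0)⁻¹

namespace Alg

/-- The power with exponent `0` or `1`. -/
def pow01 (n : ℕ) (x : K) : K := match n with
  | 0 => 1
  | _ + 1 => x

/-- The number `0` or `1`. -/
def cst (n : ℕ) : K := match n with
  | 0 => 0
  | _ + 1 => 1

def two : K := 1 + 1

def sinh (a : K) : K := (a - a⁻¹) * two⁻¹

/-- The parameters enter through their exponentials, so that `b` stands for Z(β) and `g * b⁻¹` for
Z(γ - β). Squares are written as products because only the bare operations are available. -/
def C3 (δ₁ δ₂ δ₃ x xa xb xc xd a b g : K) : K :=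
  x * ((xa * xc - xb * xd) * b + (xb * xc - xa * xd) * (g * b⁻¹)
    + δ₁ * (a⁻¹ - two * (δ₃ * xa * xb - δ₂ * xc * xd) * (a * g⁻¹)) * (1 - g * g))
  + (xa * xb + two * δ₂ * sinh b * sinh (b * g⁻¹)) * (xd - xc * g)
  + (xd * g - xc) * (x * x)
  + δ₁ * a⁻¹ * (1 + two * δ₂ * xc * xd * (a * a * g⁻¹)) *
    ((b - two * δ₃ * (a * a * b⁻¹) * (x * x)) * (xb * g - xa)
      + (xa * g - xb) * (g * b⁻¹ - two * δ₃ * (a * (a * b * g⁻¹)) * (x * x)))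

def C2 (δ₁ δ₂ δ₃ : ℕ) (x xa xb xc xd a b g : K) : K :=
  x * ((xa + xb + two * cst δ₂ * (b - g) * b) * (xc - xd)
    + (xa - xb) * (two * b - g) * pow01 δ₃ (g - two * a)
    + cst δ₁ * g * (xc + xd + (two * a - g) * pow01 δ₃ (g - two * a)) * pow01 δ₂ (g - two * a)
    + two * cst δ₂ * g * ((a - g) * a - xc * xd)
    + two * cst δ₃ * g * ((a - b) * (a + b - g) + xa * xb))
  + (x * x - xa * xb) * g * pow01 δ₃ (g - two * a)
  - (x * x + xa * xb) * (xc - xd)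
  + cst δ₁ * b * (b - g) * (g * pow01 δ₃ (g - two * a) + (xc - xd))
    * pow01 δ₂ (b * (g - b) + xa + xb)
  - two * cst δ₃ * g * (xa + xb) * (x * x)
  + cst δ₁ * (b * (xa - xb) - g * xa) *
    (xc + xd + (two * a - g) * pow01 δ₃ (g - two * a) + two * cst δ₃ * (a * (a - g) - x * x)) *
    pow01 δ₂ (g - two * a)
  + two * cst δ₂ * (b * g * (b - g) * (a + xc) * (a - g + xd)
    + (g * xa - b * (xa - xb)) * (a * (g - a) + xc * xd))

def C1 (δ : ℕ) (x xa xb xc xd b g : K) : K :=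
  x * (two * g * pow01 δ ((-xc - xd) * two⁻¹) - (xa + xb) * (xc - xd))
  + two * (b * (xa - xb) - g * xa) * pow01 δ ((-xc - xd) * two⁻¹)
  + (x * x + xa * xb + cst δ * b * (g - b)) * (xc - xd)

def Q3 (δ xa xb xc xd a b : K) : K :=
  sinh a * (xa * xb + xc * xd) - sinh b * (xa * xc + xb * xd)
    - sinh (a * b⁻¹) * (xa * xd + xb * xc) - δ * sinh a * sinh b * sinh (a * b⁻¹)

def Q1 (δ xa xb xc xd a b : K) : K :=
  a * (xa - xc) * (xb - xd) - b * (xa - xb) * (xc - xd) + δ * a * b * (a - b)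

def Q2 (xa xb xc xd a b : K) : K :=
  Q1 0 xa xb xc xd a b + a * b * (a - b) * (xa + xb + xc + xd + a * b - a * a - b * b)

/-- `H3` with `d = δ (2 - ε)` and `e = ε`. -/
def H3 (d e xa xb xc xd a b : K) : K :=
  a * (xa * xc + xb * xd) - b * (xa * xb + xc * xd)
    - sinh (a * b⁻¹) * (d + e * (a * b * xa * xd))

def H2 (e xa xb xc xd a b : K) : K :=
  (xa - xd) * (xb - xc) - (a - b) * (xa + xb + xc + xd) - (a * a - b * b)
    + e * two⁻¹ * (a - b) *
      ((two * xa + a + b + 1) * (two * xd + a + b + 1) + (a - b) * (a - b) - 1)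

def H1 (e xa xb xc xd a b : K) : K :=
  (xa - xd) * (xb - xc) + two * (a - b) - e * (a - b) * (two + xa + xd)

/-- The hyperbolic families. -/
def hyp (δ₁ δ₂ d e δ δ' : K) : Fam K where
  C := C3 δ₁ δ₂ 0
  Cb := C3 δ₁ 0 δ₂
  H := H3 d e
  Q := Q3 δ
  Qs := Q3 δ'
  sub a b := a * b⁻¹
  neg a := a⁻¹
  reg a := a * (a * a - 1)

/-- The rational and algebraic families. -/
def rat (C Cb : K → K → K → K → K → K → K → K → K) (H Q Qs : K → K → K → K → K → K → K) :
    Fam K where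
  C := C
  Cb := Cb
  H := H
  Q := Q
  Qs := Qs
  sub a b := a - b
  neg a := -a
  reg a := a

end Alg

/-- The polynomials of a combination in the coordinates `Combination.coord` of the parameters. -/
def Combination.fam : Combination → Fam K
  | C3_half_half_0 => Alg.hyp Alg.two⁻¹ Alg.two⁻¹ 1 1 1 0
  | C3_half_0_half => (Alg.hyp Alg.two⁻¹ Alg.two⁻¹ 1 1 1 0).swap
  | C3_1_0_0 => Alg.hyp 1 0 Alg.two 0 0 0
  | C3_0_0_0 => Alg.hyp 0 0 0 0 0 0
  | C2_1_1_0 => Alg.rat (Alg.C2 1 1 0) (Alg.C2 1 0 1) (Alg.H2 1) Alg.Q2 (Alg.Q1 1)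
  | C2_1_0_1 => (Alg.rat (Alg.C2 1 1 0) (Alg.C2 1 0 1) (Alg.H2 1) Alg.Q2 (Alg.Q1 1)).swap
  | C2_1_0_0 => Alg.rat (Alg.C2 1 0 0) (Alg.C2 1 0 0) (Alg.H2 0) (Alg.Q1 1) (Alg.Q1 1)
  | C1_1 => Alg.rat (fun x xa xb xc xd _ b g => Alg.C1 1 x xa xb xc xd b g) (Alg.C2 0 0 0) (Alg.H1 1) (Alg.Q1 1) (Alg.Q1 0)
  | C2_0_0_0 => (Alg.rat (fun x xa xb xc xd _ b g => Alg.C1 1 x xa xb xc xd b g) (Alg.C2 0 0 0) (Alg.H1 1)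
      (Alg.Q1 1) (Alg.Q1 0)).swap
  | C1_0 => Alg.rat (fun x xa xb xc xd _ b g => Alg.C1 0 x xa xb xc xd b g)
      (fun x xa xb xc xd _ b g => Alg.C1 0 x xa xb xc xd b g) (Alg.H1 0) (Alg.Q1 0) (Alg.Q1 0)

end ops

/-! ### Comparison with the given equations -/

namespace Combination

variable (F : Combination)

attribute [local simp] Alg.pow01 Alg.cst Alg.two Alg.sinh Alg.hyp Alg.rat Fam.swap fam coord C Cbar H Q Qstar
  Quad.swap Z sh Complex.sinh Complex.exp_add Complex.exp_sub Complex.exp_neg Complex.exp_nat_mul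
  div_eq_mul_inv mul_inv

theorem exp_two_mul (a : ℂ) : Complex.exp (2 * a) = Complex.exp a * Complex.exp a := by
  rw [two_mul, Complex.exp_add]

attribute [local simp] exp_two_mul

theorem coord_sub (a b : ℂ) : F.coord (a - b) = (F.fam (K := ℂ)).sub (F.coord a) (F.coord b) := by
  cases F <;> simp

theorem coord_neg (a : ℂ) : F.coord (-a) = (F.fam (K := ℂ)).neg (F.coord a) := by
  cases F <;> simp

theorem Q_eq (x y z w a b : ℂ) :
    F.Q x y z w a b = F.fam.Q x y z w (F.coord a) (F.coord b) := by
  cases F <;> simp [Q3, Alg.Q3, Q1, Alg.Q1, Q2, Alg.Q2,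
    -mul_eq_mul_left_iff, -mul_eq_mul_right_iff] <;> ring

theorem Qstar_eq (x y z w a b : ℂ) :
    F.Qstar x y z w a b = F.fam.Qs x y z w (F.coord a) (F.coord b) := by
  cases F <;> simp [Q3, Alg.Q3, Q1, Alg.Q1, Q2, Alg.Q2,
    -mul_eq_mul_left_iff, -mul_eq_mul_right_iff] <;> ring

theorem H_eq (x y z w a b : ℂ) :
    F.H x y z w a b = F.fam.H x y z w (F.coord a) (F.coord b) := by
  cases F <;> simp [H3, Alg.H3, H1, Alg.H1, H2, Alg.H2,
    -mul_eq_mul_left_iff, -mul_eq_mul_right_iff] <;> ring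

theorem Hstar_eq (x y z w a b : ℂ) :
    F.Hstar x y z w a b = F.fam.T x y z w (F.coord a) (F.coord b) := by
  rw [Hstar, Quad.trapezoidal, H_eq, coord_sub, Fam.T]

theorem C_eq (x y z w u a b g : ℂ) :
    F.C x y z w u a b g = F.fam.C x y z w u (F.coord a) (F.coord b) (F.coord g) := by
  cases F <;> simp [C3, PC3, Alg.C3, C2, PC2, Alg.C2, C1, PC1, Alg.C1,
    -mul_eq_mul_left_iff, -mul_eq_mul_right_iff] <;> ring

theorem Cbar_eq (x y z w u a b g : ℂ) :
    F.Cbar x y z w u a b g = F.fam.Cb x y z w u (F.coord a) (F.coord b) (F.coord g) := by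
  cases F <;> simp [C3, PC3, Alg.C3, C2, PC2, Alg.C2, C1, PC1, Alg.C1,
    -mul_eq_mul_left_iff, -mul_eq_mul_right_iff] <;> ring

end Combination

end HexQuad

namespace HexQuad

/-! ### Genericity from a nondegenerate point over a finite field -/

/-- Natural numbers with the operations of the field with `1009` elements. -/
def Fp : Type := ℕ

namespace Fp

instance : DecidableEq Fp := inferInstanceAs (DecidableEq ℕ)
instance (n : ℕ) : OfNat Fp n := ⟨n⟩
instance : Zero Fp := ⟨(0 : ℕ)⟩
instance : One Fp := ⟨(1 : ℕ)⟩

-- Everything is arithmetic of natural numbers: 1008 represents -1, and by Fermat the power with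
-- exponent 1007 is the inverse of a nonzero element.
@[irreducible] protected def add (a b : Fp) : Fp := Nat.mod (Nat.add a b) 1009
@[irreducible] protected def mul (a b : Fp) : Fp := Nat.mod (Nat.mul a b) 1009
@[irreducible] protected def neg (a : Fp) : Fp := Nat.mod (Nat.mul 1008 a) 1009
@[irreducible] protected def sub (a b : Fp) : Fp := Nat.mod (Nat.add a (Nat.mul 1008 b)) 1009
@[irreducible] protected def inv (a : Fp) : Fp := Nat.mod (Nat.pow a 1007) 1009

instance : Add Fp := ⟨Fp.add⟩
instance : Mul Fp := ⟨Fp.mul⟩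
instance : Neg Fp := ⟨Fp.neg⟩
instance : Sub Fp := ⟨Fp.sub⟩
instance : Inv Fp := ⟨Fp.inv⟩

instance : Fact (Nat.Prime 1009) := ⟨by norm_num⟩

/-- The element of the field which is represented by a natural number. -/
def val (a : Fp) : ZMod 1009 := ((show ℕ from a : ℕ) : ZMod 1009)

theorem cast_1008 : ((1008 : ℕ) : ZMod 1009) = -1 := by decide

theorem val_zero : val 0 = 0 := Nat.cast_zero
theorem val_one : val 1 = 1 := Nat.cast_one
theorem val_mod (n : ℕ) : val (Nat.mod n 1009 : ℕ) = (n : ZMod 1009) := ZMod.natCast_mod n 1009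

theorem val_add (a b : Fp) : val (a + b) = val a + val b := by
  change val (Fp.add a b) = _
  rw [Fp.add]
  exact (val_mod _).trans (Nat.cast_add _ _)

theorem val_mul (a b : Fp) : val (a * b) = val a * val b := by
  change val (Fp.mul a b) = _
  rw [Fp.mul]
  exact (val_mod _).trans (Nat.cast_mul _ _)

theorem val_1008_mul (a : Fp) : ((Nat.mul 1008 a : ℕ) : ZMod 1009) = -val a :=
  (Nat.cast_mul _ _).trans (by rw [cast_1008, neg_one_mul]; rfl)

theorem val_neg (a : Fp) : val (-a) = -val a := by
  change val (Fp.neg a) = _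
  rw [Fp.neg]
  exact (val_mod _).trans (val_1008_mul a)

theorem val_sub (a b : Fp) : val (a - b) = val a - val b := by
  change val (Fp.sub a b) = _
  rw [Fp.sub, sub_eq_add_neg, ← val_1008_mul]
  exact (val_mod _).trans (Nat.cast_add _ _)

set_option exponentiation.threshold 1100 in
theorem val_inv (a : Fp) (ha : val a ≠ 0) : val a⁻¹ = (val a)⁻¹ := by
  refine eq_inv_of_mul_eq_one_left ?_
  -- Fermat: the 1 on the right is the power with exponent 1008, that is, one more factor than in
  -- `Fp.inv`.
  rw [← ZMod.pow_card_sub_one_eq_one ha]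
  change val (Fp.inv a) * _ = _
  rw [Fp.inv]
  exact (congr_arg (· * _) ((val_mod _).trans (Nat.cast_pow _ _))).trans (pow_succ _ _).symm

/-- The element is not zero in the field. -/
def Unit (a : Fp) : Prop := (show ℕ from a) % 1009 ≠ 0

instance (a : Fp) : Decidable a.Unit := inferInstanceAs (Decidable ((show ℕ from a) % 1009 ≠ 0))

theorem Unit.val_ne {a : Fp} (h : a.Unit) : val a ≠ 0 := by
  intro h0
  exact h (Nat.dvd_iff_mod_eq_zero.1 ((ZMod.natCast_eq_zero_iff _ _).1 h0))

end Fp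

open MvPolynomial

variable {σ : Type*}

/-- The function `f` is a rational function with integer coefficients which is regular at the point
`p` over the finite field, with the value `v`. -/
def RegAt (p : σ → ZMod 1009) (f : (σ → ℂ) → ℂ) (v : Fp) : Prop :=
  ∃ N D : MvPolynomial σ ℤ, aeval p D ≠ 0 ∧ aeval p N = v.val * aeval p D ∧
    ∀ z : σ → ℂ, aeval z D ≠ 0 → f z * aeval z D = aeval z N

/-- The property `S` holds outside the zero set of an integer polynomial which does not vanish
at `p`. -/
def Near (p : σ → ZMod 1009) (S : (σ → ℂ) → Prop) : Prop :=
  ∃ P : MvPolynomial σ ℤ, aeval p P ≠ 0 ∧ ∀ z : σ → ℂ, aeval z P ≠ 0 → S z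

theorem Near.and {p : σ → ZMod 1009} {S S' : (σ → ℂ) → Prop} (h : Near p S) (h' : Near p S') :
    Near p fun z => S z ∧ S' z := by
  obtain ⟨P, hP, h⟩ := h
  obtain ⟨P', hP', h'⟩ := h'
  refine ⟨P * P', by rw [map_mul]; exact mul_ne_zero hP hP', fun z hz => ?_⟩
  rw [map_mul] at hz
  exact ⟨h z (left_ne_zero_of_mul hz), h' z (right_ne_zero_of_mul hz)⟩

theorem Near.mono {p : σ → ZMod 1009} {S S' : (σ → ℂ) → Prop} (h : Near p S)
    (hS : ∀ z, S z → S' z) : Near p S' :=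
  let ⟨P, hP, h⟩ := h
  ⟨P, hP, fun z hz => hS z (h z hz)⟩

/-- A generic property holds outside the zero set of a nonzero complex polynomial. -/
theorem Near.exists_polynomial {p : σ → ZMod 1009} {S : (σ → ℂ) → Prop} (h : Near p S) :
    ∃ P : MvPolynomial σ ℂ, P ≠ 0 ∧ ∀ z, eval z P ≠ 0 → S z := by
  obtain ⟨P, hP, h⟩ := h
  -- The integers embed into ℂ, so if the complex polynomial were zero, then so would be `P`, and
  -- `P` would vanish at `p` as well.
  refine ⟨map (Int.castRingHom ℂ) P, fun h0 => hP ?_, fun z hz => h z ?_⟩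
  · have : P = 0 := map_injective _ (RingHom.injective_int _) (h0.trans (map_zero _).symm)
    rw [this, map_zero]
  · rw [eval_map] at hz
    rwa [aeval_def, algebraMap_int_eq]

namespace RegAt

variable {p : σ → ZMod 1009} {f g : (σ → ℂ) → ℂ} {v w : Fp}

theorem zero : RegAt p (fun _ => 0) 0 := ⟨0, 1, by simp, by simp [Fp.val_zero], by simp⟩

theorem one : RegAt p (fun _ => 1) 1 := ⟨1, 1, by simp, by simp [Fp.val_one], by simp⟩

theorem var (i : σ) (h : v.val = p i) : RegAt p (fun z => z i) v :=
  ⟨X i, 1, by simp, by simp [h], by simp⟩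

theorem add (hf : RegAt p f v) (hg : RegAt p g w) : RegAt p (fun z => f z + g z) (v + w) := by
  obtain ⟨N, D, hD, hN, h⟩ := hf
  obtain ⟨N', D', hD', hN', h'⟩ := hg
  refine ⟨N * D' + N' * D, D * D', by simpa using ⟨hD, hD'⟩, ?_, fun z hz => ?_⟩
  · simp only [map_add, map_mul, hN, hN', Fp.val_add]; ring
  · simp only [map_add, map_mul] at hz ⊢
    linear_combination aeval z D' * h z (left_ne_zero_of_mul hz)
      + aeval z D * h' z (right_ne_zero_of_mul hz)

theorem mul (hf : RegAt p f v) (hg : RegAt p g w) : RegAt p (fun z => f z * g z) (v * w) := by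
  obtain ⟨N, D, hD, hN, h⟩ := hf
  obtain ⟨N', D', hD', hN', h'⟩ := hg
  refine ⟨N * N', D * D', by simpa using ⟨hD, hD'⟩, ?_, fun z hz => ?_⟩
  · simp only [map_mul, hN, hN', Fp.val_mul]; ring
  · simp only [map_mul] at hz ⊢
    rw [← h z (left_ne_zero_of_mul hz), ← h' z (right_ne_zero_of_mul hz)]; ring

theorem neg (hf : RegAt p f v) : RegAt p (fun z => -f z) (-v) := by
  obtain ⟨N, D, hD, hN, h⟩ := hf
  refine ⟨-N, D, hD, ?_, fun z hz => ?_⟩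
  · simp only [map_neg, hN, Fp.val_neg]; ring
  · rw [map_neg, ← h z hz]; ring

theorem sub (hf : RegAt p f v) (hg : RegAt p g w) : RegAt p (fun z => f z - g z) (v - w) := by
  obtain ⟨N, D, hD, hN, h⟩ := hf
  obtain ⟨N', D', hD', hN', h'⟩ := hg
  refine ⟨N * D' - N' * D, D * D', by simpa using ⟨hD, hD'⟩, ?_, fun z hz => ?_⟩
  · simp only [map_sub, map_mul, hN, hN', Fp.val_sub]; ring
  · simp only [map_sub, map_mul] at hz ⊢
    linear_combination aeval z D' * h z (left_ne_zero_of_mul hz)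
      - aeval z D * h' z (right_ne_zero_of_mul hz)

theorem inv (hf : RegAt p f v) (hv : v.val ≠ 0) : RegAt p (fun z => (f z)⁻¹) v⁻¹ := by
  obtain ⟨N, D, hD, hN, h⟩ := hf
  -- The inverse of N / D is written as D² / (N D) rather than D / N: the denominator must also
  -- guarantee D ≠ 0, without which nothing is known about `f z`.
  refine ⟨D * D, N * D, ?_, ?_, fun z hz => ?_⟩
  · rw [map_mul, hN]; exact mul_ne_zero (mul_ne_zero hv hD) hD
  · simp only [map_mul, hN, Fp.val_inv v hv]; field_simp
  · rw [map_mul] at hz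
    have hD := right_ne_zero_of_mul hz
    have hN := left_ne_zero_of_mul hz
    have e := h z hD
    have hf : f z ≠ 0 := by rintro h0; rw [h0, zero_mul] at e; exact hN e.symm
    rw [map_mul, map_mul, ← e]; field_simp

theorem congr_val (hf : RegAt p f v) (h : w.val = v.val) : RegAt p f w := by
  obtain ⟨N, D, hD, hN, h'⟩ := hf
  exact ⟨N, D, hD, h ▸ hN, h'⟩

theorem near_ne_zero (hf : RegAt p f v) (hv : v.Unit) : Near p fun z => f z ≠ 0 := by
  obtain ⟨N, D, hD, hN, h⟩ := hf
  refine ⟨N * D, ?_, fun z hz h0 => ?_⟩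
  · rw [map_mul, hN]; exact mul_ne_zero (mul_ne_zero hv.val_ne hD) hD
  · rw [map_mul] at hz
    refine left_ne_zero_of_mul hz ?_
    rw [← h z (right_ne_zero_of_mul hz), h0, zero_mul]

theorem slope1 {q : (σ → ℂ) → ℂ → ℂ} {q' : Fp → Fp}
    (hq : ∀ {f v}, RegAt p f v → RegAt p (fun z => q z (f z)) (q' v)) :
    RegAt p (fun z => slope1 (q z)) (slope1 q') :=
  (hq one).sub (hq zero)

theorem det2 {q : (σ → ℂ) → ℂ → ℂ → ℂ} {q' : Fp → Fp → Fp}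
    (hq : ∀ {f v g w}, RegAt p f v → RegAt p g w → RegAt p (fun z => q z (f z) (g z)) (q' v w)) :
    RegAt p (fun z => det2 (q z)) (det2 q') :=
  ((hq zero zero).mul (hq one one)).sub ((hq zero one).mul (hq one zero))

/-- A root of an equation whose coefficients are regular at `p`. -/
theorem root1 {q : (σ → ℂ) → ℂ → ℂ} {q' : Fp → Fp}
    (hq : ∀ {f v}, RegAt p f v → RegAt p (fun z => q z (f z)) (q' v))
    (hs : (HexQuad.slope1 q').Unit) (hv : w * HexQuad.slope1 q' + q' 0 = 0) :
    RegAt p (fun z => root1 (q z)) w := by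
  have hs' := hs.val_ne
  -- The value `w` is supplied in advance, so it is only verified as a root and no quotient has to
  -- be computed in `Fp`.
  refine ((hq zero).neg.mul ((slope1 hq).inv hs')).congr_val ?_
  rw [Fp.val_mul, Fp.val_neg, Fp.val_inv _ hs', eq_mul_inv_iff_mul_eq₀ hs', eq_neg_iff_add_eq_zero]
  have := congr_arg Fp.val hv
  rwa [Fp.val_add, Fp.val_mul, Fp.val_zero] at this

end RegAt

/-- The functions of a family over `ℂ` are regular, with the values over the finite field.
`U` is the class of the coordinates of parameters. -/
structure Fam.Regular (F : Fam ℂ) (F' : Fam Fp) (p : σ → ZMod 1009) : Prop where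
  Q {f₁ f₂ f₃ f₄ a b v₁ v₂ v₃ v₄ v w} : RegAt p f₁ v₁ → RegAt p f₂ v₂ → RegAt p f₃ v₃ →
    RegAt p f₄ v₄ → RegAt p a v → v.val ≠ 0 → RegAt p b w → w.val ≠ 0 →
    RegAt p (fun z => F.Q (f₁ z) (f₂ z) (f₃ z) (f₄ z) (a z) (b z)) (F'.Q v₁ v₂ v₃ v₄ v w)
  Qs {f₁ f₂ f₃ f₄ a b v₁ v₂ v₃ v₄ v w} : RegAt p f₁ v₁ → RegAt p f₂ v₂ → RegAt p f₃ v₃ →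
    RegAt p f₄ v₄ → RegAt p a v → v.val ≠ 0 → RegAt p b w → w.val ≠ 0 →
    RegAt p (fun z => F.Qs (f₁ z) (f₂ z) (f₃ z) (f₄ z) (a z) (b z)) (F'.Qs v₁ v₂ v₃ v₄ v w)
  H {f₁ f₂ f₃ f₄ a b v₁ v₂ v₃ v₄ v w} : RegAt p f₁ v₁ → RegAt p f₂ v₂ → RegAt p f₃ v₃ →
    RegAt p f₄ v₄ → RegAt p a v → v.val ≠ 0 → RegAt p b w → w.val ≠ 0 →
    RegAt p (fun z => F.H (f₁ z) (f₂ z) (f₃ z) (f₄ z) (a z) (b z)) (F'.H v₁ v₂ v₃ v₄ v w)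
  C {f f₁ f₂ f₃ f₄ a b c u v₁ v₂ v₃ v₄ v w x} : RegAt p f u → RegAt p f₁ v₁ → RegAt p f₂ v₂ →
    RegAt p f₃ v₃ → RegAt p f₄ v₄ → RegAt p a v → v.val ≠ 0 → RegAt p b w → w.val ≠ 0 →
    RegAt p c x → x.val ≠ 0 →
    RegAt p (fun z => F.C (f z) (f₁ z) (f₂ z) (f₃ z) (f₄ z) (a z) (b z) (c z))
      (F'.C u v₁ v₂ v₃ v₄ v w x)
  Cb {f f₁ f₂ f₃ f₄ a b c u v₁ v₂ v₃ v₄ v w x} : RegAt p f u → RegAt p f₁ v₁ → RegAt p f₂ v₂ →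
    RegAt p f₃ v₃ → RegAt p f₄ v₄ → RegAt p a v → v.val ≠ 0 → RegAt p b w → w.val ≠ 0 →
    RegAt p c x → x.val ≠ 0 →
    RegAt p (fun z => F.Cb (f z) (f₁ z) (f₂ z) (f₃ z) (f₄ z) (a z) (b z) (c z))
      (F'.Cb u v₁ v₂ v₃ v₄ v w x)
  sub {a b v w} : RegAt p a v → v.val ≠ 0 → RegAt p b w → w.val ≠ 0 →
    RegAt p (fun z => F.sub (a z) (b z)) (F'.sub v w)
  neg {a v} : RegAt p a v → v.val ≠ 0 → RegAt p (fun z => F.neg (a z)) (F'.neg v)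
  reg {a v} : RegAt p a v → RegAt p (fun z => F.reg (a z)) (F'.reg v)

theorem Fam.Regular.swap {F : Fam ℂ} {F' : Fam Fp} {p : σ → ZMod 1009} (h : F.Regular F' p) :
    F.swap.Regular F'.swap p where
  Q := h.Qs
  Qs := h.Q
  H h₁ h₂ h₃ h₄ := h.H h₂ h₁ h₄ h₃
  C := h.Cb
  Cb := h.C
  sub := h.sub
  neg := h.neg
  reg := h.reg

/-- The halves in the equations have a reduction because the characteristic is odd. -/
theorem Fp.val_two : (Alg.two : Fp).val ≠ 0 := by decide +kernel

namespace RegAt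

variable {p : σ → ZMod 1009}

theorem two : RegAt p (fun _ => Alg.two) Alg.two := one.add one

theorem half : RegAt p (fun _ => Alg.two⁻¹) Alg.two⁻¹ := two.inv Fp.val_two

theorem cst (n : ℕ) : RegAt p (fun _ => Alg.cst n) (Alg.cst n) := by
  cases n
  exacts [zero, one]

theorem pow01 (n : ℕ) {f v} (h : RegAt p f v) :
    RegAt p (fun z => Alg.pow01 n (f z)) (Alg.pow01 n v) := by
  cases n
  exacts [one, h]

theorem sinh {f v} (h : RegAt p f v) (hv : v.val ≠ 0) :
    RegAt p (fun z => Alg.sinh (f z)) (Alg.sinh v) :=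
  (h.sub (h.inv hv)).mul half

end RegAt

theorem Fp.val_mul_inv_ne {a b : Fp} (ha : a.val ≠ 0) (hb : b.val ≠ 0) : (a * b⁻¹).val ≠ 0 := by
  rw [val_mul, val_inv b hb]
  exact mul_ne_zero ha (inv_ne_zero hb)

-- In exponential coordinates `sinh` and the difference of parameters involve inverses. This is why
-- regularity of a family is demanded only at parameter coordinates with nonzero value.
open RegAt in
theorem Alg.regular_hyp (p : σ → ZMod 1009) {c₁ c₂ c₃ c₄ c₅ c₆ : ℂ} {d₁ d₂ d₃ d₄ d₅ d₆ : Fp}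
    (h₁ : RegAt p (fun _ => c₁) d₁) (h₂ : RegAt p (fun _ => c₂) d₂)
    (h₃ : RegAt p (fun _ => c₃) d₃) (h₄ : RegAt p (fun _ => c₄) d₄)
    (h₅ : RegAt p (fun _ => c₅) d₅) (h₆ : RegAt p (fun _ => c₆) d₆) :
    (Alg.hyp c₁ c₂ c₃ c₄ c₅ c₆).Regular (Alg.hyp d₁ d₂ d₃ d₄ d₅ d₆) p where
  Q _ _ _ _ _ _ _ _ := by
    dsimp only [hyp, Q3]
    with_reducible repeat' first
      | assumption | apply RegAt.sinh | apply RegAt.sub | apply RegAt.add | apply RegAt.mul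
      | apply RegAt.inv | exact Fp.val_mul_inv_ne ‹_› ‹_›
  Qs _ _ _ _ _ _ _ _ := by
    dsimp only [hyp, Q3]
    with_reducible repeat' first
      | assumption | apply RegAt.sinh | apply RegAt.sub | apply RegAt.add | apply RegAt.mul
      | apply RegAt.inv | exact Fp.val_mul_inv_ne ‹_› ‹_›
  H _ _ _ _ _ _ _ _ := by
    dsimp only [hyp, H3]
    with_reducible repeat' first
      | assumption | apply RegAt.sinh | apply RegAt.sub | apply RegAt.add | apply RegAt.mul
      | apply RegAt.inv | exact Fp.val_mul_inv_ne ‹_› ‹_›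
  C _ _ _ _ _ _ _ _ _ _ _ := by
    dsimp only [hyp, C3]
    with_reducible repeat' first
      | assumption | exact RegAt.zero | exact RegAt.one | exact RegAt.two | apply RegAt.sinh | apply RegAt.sub
      | apply RegAt.add | apply RegAt.mul | apply RegAt.inv | exact Fp.val_mul_inv_ne ‹_› ‹_›
  Cb _ _ _ _ _ _ _ _ _ _ _ := by
    dsimp only [hyp, C3]
    with_reducible repeat' first
      | assumption | exact RegAt.zero | exact RegAt.one | exact RegAt.two | apply RegAt.sinh | apply RegAt.sub
      | apply RegAt.add | apply RegAt.mul | apply RegAt.inv | exact Fp.val_mul_inv_ne ‹_› ‹_›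
  sub ha _ hb hb' := ha.mul (hb.inv hb')
  neg ha ha' := ha.inv ha'
  reg ha := ha.mul ((ha.mul ha).sub one)

namespace RegAt

variable {p : σ → ZMod 1009} {f f₁ f₂ f₃ f₄ a b c : (σ → ℂ) → ℂ} {u v₁ v₂ v₃ v₄ v w x : Fp}

theorem C2 (δ₁ δ₂ δ₃ : ℕ) (_ : RegAt p f u) (_ : RegAt p f₁ v₁) (_ : RegAt p f₂ v₂)
    (_ : RegAt p f₃ v₃) (_ : RegAt p f₄ v₄) (_ : RegAt p a v) (_ : RegAt p b w)
    (_ : RegAt p c x) :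
    RegAt p (fun z => Alg.C2 δ₁ δ₂ δ₃ (f z) (f₁ z) (f₂ z) (f₃ z) (f₄ z) (a z) (b z) (c z))
      (Alg.C2 δ₁ δ₂ δ₃ u v₁ v₂ v₃ v₄ v w x) := by
  dsimp only [Alg.C2]
  with_reducible repeat' first
    | assumption | exact cst _ | exact RegAt.two | apply pow01 | apply RegAt.sub
    | apply RegAt.add | apply RegAt.mul

theorem C1 (δ : ℕ) (_ : RegAt p f u) (_ : RegAt p f₁ v₁) (_ : RegAt p f₂ v₂)
    (_ : RegAt p f₃ v₃) (_ : RegAt p f₄ v₄) (_ : RegAt p b w) (_ : RegAt p c x) :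
    RegAt p (fun z => Alg.C1 δ (f z) (f₁ z) (f₂ z) (f₃ z) (f₄ z) (b z) (c z))
      (Alg.C1 δ u v₁ v₂ v₃ v₄ w x) := by
  dsimp only [Alg.C1]
  with_reducible repeat' first
    | assumption | exact cst _ | exact RegAt.two | exact half | apply pow01 | apply RegAt.sub
    | apply RegAt.add | apply RegAt.mul | apply RegAt.neg

theorem Q1 {δ : ℂ} {δ' : Fp} (_ : RegAt p (fun _ => δ) δ') (_ : RegAt p f₁ v₁) (_ : RegAt p f₂ v₂)
    (_ : RegAt p f₃ v₃) (_ : RegAt p f₄ v₄) (_ : RegAt p a v) (_ : RegAt p b w) :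
    RegAt p (fun z => Alg.Q1 δ (f₁ z) (f₂ z) (f₃ z) (f₄ z) (a z) (b z))
      (Alg.Q1 δ' v₁ v₂ v₃ v₄ v w) := by
  dsimp only [Alg.Q1]
  with_reducible repeat' first
    | assumption | apply RegAt.sub | apply RegAt.add | apply RegAt.mul

theorem Q2 (_ : RegAt p f₁ v₁) (_ : RegAt p f₂ v₂) (_ : RegAt p f₃ v₃) (_ : RegAt p f₄ v₄)
    (_ : RegAt p a v) (_ : RegAt p b w) :
    RegAt p (fun z => Alg.Q2 (f₁ z) (f₂ z) (f₃ z) (f₄ z) (a z) (b z))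
      (Alg.Q2 v₁ v₂ v₃ v₄ v w) := by
  dsimp only [Alg.Q2, Alg.Q1]
  with_reducible repeat' first
    | assumption | exact zero | apply RegAt.sub | apply RegAt.add | apply RegAt.mul

theorem H2 {δ : ℂ} {δ' : Fp} (_ : RegAt p (fun _ => δ) δ') (_ : RegAt p f₁ v₁) (_ : RegAt p f₂ v₂)
    (_ : RegAt p f₃ v₃) (_ : RegAt p f₄ v₄) (_ : RegAt p a v) (_ : RegAt p b w) :
    RegAt p (fun z => Alg.H2 δ (f₁ z) (f₂ z) (f₃ z) (f₄ z) (a z) (b z))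
      (Alg.H2 δ' v₁ v₂ v₃ v₄ v w) := by
  dsimp only [Alg.H2]
  with_reducible repeat' first
    | assumption | exact one | exact RegAt.two | exact half | apply RegAt.sub | apply RegAt.add
    | apply RegAt.mul

theorem H1 {δ : ℂ} {δ' : Fp} (_ : RegAt p (fun _ => δ) δ') (_ : RegAt p f₁ v₁) (_ : RegAt p f₂ v₂)
    (_ : RegAt p f₃ v₃) (_ : RegAt p f₄ v₄) (_ : RegAt p a v) (_ : RegAt p b w) :
    RegAt p (fun z => Alg.H1 δ (f₁ z) (f₂ z) (f₃ z) (f₄ z) (a z) (b z))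
      (Alg.H1 δ' v₁ v₂ v₃ v₄ v w) := by
  dsimp only [Alg.H1]
  with_reducible repeat' first
    | assumption | exact RegAt.two | apply RegAt.sub | apply RegAt.add | apply RegAt.mul

end RegAt

open RegAt in
theorem Combination.regular_fam (F : Combination) (p : σ → ZMod 1009) :
    (F.fam (K := ℂ)).Regular F.fam p := by
  have h₁ := Alg.regular_hyp p half half one one one zero
  have h₂ : (Alg.rat (Alg.C2 1 1 0) (Alg.C2 1 0 1) (Alg.H2 1) Alg.Q2 (Alg.Q1 1) : Fam ℂ).Regular
      (Alg.rat (Alg.C2 1 1 0) (Alg.C2 1 0 1) (Alg.H2 1) Alg.Q2 (Alg.Q1 1)) p :=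
    { Q := fun h₁ h₂ h₃ h₄ ha _ hb _ => RegAt.Q2 h₁ h₂ h₃ h₄ ha hb
      Qs := fun h₁ h₂ h₃ h₄ ha _ hb _ => RegAt.Q1 one h₁ h₂ h₃ h₄ ha hb
      H := fun h₁ h₂ h₃ h₄ ha _ hb _ => RegAt.H2 one h₁ h₂ h₃ h₄ ha hb
      C := fun h h₁ h₂ h₃ h₄ ha _ hb _ hc _ => RegAt.C2 _ _ _ h h₁ h₂ h₃ h₄ ha hb hc
      Cb := fun h h₁ h₂ h₃ h₄ ha _ hb _ hc _ => RegAt.C2 _ _ _ h h₁ h₂ h₃ h₄ ha hb hc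
      sub := fun ha _ hb _ => ha.sub hb
      neg := fun ha _ => ha.neg
      reg := fun ha => ha }
  have h₃ : (Alg.rat (fun x xa xb xc xd _ b g => Alg.C1 1 x xa xb xc xd b g) (Alg.C2 0 0 0)
      (Alg.H1 1) (Alg.Q1 1) (Alg.Q1 0) : Fam ℂ).Regular
      (Alg.rat (fun x xa xb xc xd _ b g => Alg.C1 1 x xa xb xc xd b g) (Alg.C2 0 0 0)
      (Alg.H1 1) (Alg.Q1 1) (Alg.Q1 0)) p :=
    { Q := fun h₁ h₂ h₃ h₄ ha _ hb _ => RegAt.Q1 one h₁ h₂ h₃ h₄ ha hb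
      Qs := fun h₁ h₂ h₃ h₄ ha _ hb _ => RegAt.Q1 zero h₁ h₂ h₃ h₄ ha hb
      H := fun h₁ h₂ h₃ h₄ ha _ hb _ => RegAt.H1 one h₁ h₂ h₃ h₄ ha hb
      C := fun h h₁ h₂ h₃ h₄ _ _ hb _ hc _ => RegAt.C1 _ h h₁ h₂ h₃ h₄ hb hc
      Cb := fun h h₁ h₂ h₃ h₄ ha _ hb _ hc _ => RegAt.C2 _ _ _ h h₁ h₂ h₃ h₄ ha hb hc
      sub := fun ha _ hb _ => ha.sub hb
      neg := fun ha _ => ha.neg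
      reg := fun ha => ha }
  cases F with
  | C3_half_half_0 => exact h₁
  | C3_half_0_half => exact h₁.swap
  | C3_1_0_0 => exact Alg.regular_hyp p one zero two zero zero zero
  | C3_0_0_0 => exact Alg.regular_hyp p zero zero zero zero zero zero
  | C2_1_1_0 => exact h₂
  | C2_1_0_1 => exact h₂.swap
  | C2_1_0_0 => exact
    { Q := fun h₁ h₂ h₃ h₄ ha _ hb _ => RegAt.Q1 one h₁ h₂ h₃ h₄ ha hb
      Qs := fun h₁ h₂ h₃ h₄ ha _ hb _ => RegAt.Q1 one h₁ h₂ h₃ h₄ ha hb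
      H := fun h₁ h₂ h₃ h₄ ha _ hb _ => RegAt.H2 zero h₁ h₂ h₃ h₄ ha hb
      C := fun h h₁ h₂ h₃ h₄ ha _ hb _ hc _ => RegAt.C2 _ _ _ h h₁ h₂ h₃ h₄ ha hb hc
      Cb := fun h h₁ h₂ h₃ h₄ ha _ hb _ hc _ => RegAt.C2 _ _ _ h h₁ h₂ h₃ h₄ ha hb hc
      sub := fun ha _ hb _ => ha.sub hb
      neg := fun ha _ => ha.neg
      reg := fun ha => ha }
  | C1_1 => exact h₃
  | C2_0_0_0 => exact h₃.swap
  | C1_0 => exact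
    { Q := fun h₁ h₂ h₃ h₄ ha _ hb _ => RegAt.Q1 zero h₁ h₂ h₃ h₄ ha hb
      Qs := fun h₁ h₂ h₃ h₄ ha _ hb _ => RegAt.Q1 zero h₁ h₂ h₃ h₄ ha hb
      H := fun h₁ h₂ h₃ h₄ ha _ hb _ => RegAt.H1 zero h₁ h₂ h₃ h₄ ha hb
      C := fun h h₁ h₂ h₃ h₄ _ _ hb _ hc _ => RegAt.C1 _ h h₁ h₂ h₃ h₄ hb hc
      Cb := fun h h₁ h₂ h₃ h₄ _ _ hb _ hc _ => RegAt.C1 _ h h₁ h₂ h₃ h₄ hb hc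
      sub := fun ha _ hb _ => ha.sub hb
      neg := fun ha _ => ha.neg
      reg := fun ha => ha }

end HexQuad

/-! ### Polynomial certificates for cube consistency of `Q1`, `Q2` and `Q3`. -/

namespace HexQuad
namespace Alg

/-- `Q3`, cleared of denominators. -/
noncomputable def Q3h (d xa xb xc xd a b : ℂ) : ℂ :=
  4 * a * b * (b * (a ^ 2 - 1) * (xa * xb + xc * xd) - a * (b ^ 2 - 1) * (xa * xc + xb * xd)
    - (a ^ 2 - b ^ 2) * (xa * xd + xb * xc)) - d * (a ^ 2 - 1) * (b ^ 2 - 1) * (a ^ 2 - b ^ 2)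

/-- The trapezoidal version of `H3`, cleared of denominators. -/
noncomputable def T3h (d e w w' y y' a g : ℂ) : ℂ :=
  2 * a * g * (w * y + w' * y') - 2 * a ^ 2 * g * (w * y' + w' * y)
    - (1 - a ^ 2) * (a * d + e * g ^ 2 * w * w')

/-- `H3`, cleared of denominators. -/
noncomputable def H3h (d e xa xb xc xd a b : ℂ) : ℂ :=
  2 * a * b * (a * (xa * xc + xb * xd) - b * (xa * xb + xc * xd))
    - (a ^ 2 - b ^ 2) * (d + e * a * b * xa * xd)

noncomputable def T2 (e w w' y y' a g : ℂ) : ℂ := H2 e w y' y w' (g - a) g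

noncomputable def T1 (e w w' y y' a g : ℂ) : ℂ := H1 e w y' y w' (g - a) g

/-- Eliminating `x13` between the wanted face and `h13` leaves a relation between `x`, `x1`, `x3`,
`x12`, `X`. Eliminating `x23` between `h23` and `h` leaves one between `x`, `x2`, `x3`, `x12`, `X`.
Modulo `h12` the two relations are proportional, the factors being polynomials attached to the edges
`x x2` and `x x1`. The wanted face therefore holds as soon as the first edge polynomial and the
coefficient of `x13` in `h13` are nonzero. The other certificates below have the same shape. -/
theorem cube_Q1 (d : ℂ) {a b r x x1 x2 x12 x3 x13 x23 X : ℂ}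
    (h12 : Q1 d x x1 x2 x12 a b = 0) (h13 : Q1 d x x1 x3 x13 a r = 0)
    (h23 : Q1 d x x2 x3 x23 b r = 0) (h : Q1 d x2 x12 x23 X a r = 0)
    (hd : det2 (fun s t => Q1 d x x2 s t b a) ≠ 0)
    (hs : slope1 (fun s => Q1 d x x1 x3 s a r) ≠ 0) :
    Q1 d x1 x12 x13 X b r = 0 := by
  -- The edge polynomial (x - x2)² - b² d, times `a`. The determinant of the face equation in its
  -- two other vertices is a multiple of it.
  have hg : a * x^2 - 2 * a * x * x2 + a * x2^2 - a * b^2 * d ≠ 0 := fun h0 => hd (by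
    simp only [det2, Q1]
    linear_combination (a - b) * h0)
  refine (mul_eq_zero.1 ?_).resolve_left (mul_ne_zero hg hs)
  simp only [slope1, Q1] at *
  -- The cofactor of `h13` is `hg`'s polynomial times the coefficient of `x13` in the goal. Those of
  -- `h` and `h23` form the resultant in `x23`, multiplied by the polynomial of the edge `x x1`. The
  -- long last cofactor, of `h12`, is what remains to compare the two relations.
  linear_combination
      (a * x^2 - 2 * a * x * x2 + a * x2^2 - a * b^2 * d) * (- b * x12 + b * X - r * x1 + r *
      x12) * h13 + (b * x^2 - 2 * b * x * x1 + b * x1^2 - a^2 * b * d) * (- b * x + b * x3 + r *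
      x - r * x2) * h + (- b * x^2 + 2 * b * x * x1 - b * x1^2 + a^2 * b * d) * (- a * x12 + a *
      X - r * x2 + r * x12) * h23 + (- a^2 * b * r * x * d + a^2 * b * r * x3 * d + a^2 * r^2 *
      x * d - a^2 * r^2 * x2 * d - a * b^2 * r * x * d + a * b^2 * r * x3 * d + 2 * a * b * r^2
      * x * d - a * b * r^2 * x1 * d - a * b * r^2 * x2 * d - a * b * r^2 * x3 * d + a * b * r^2
      * X * d - a * r^3 * x * d + a * r^3 * x2 * d + a * r * x^2 * x1 - a * r * x^2 * X - a * r
      * x * x1 * x2 - a * r * x * x1 * x3 + a * r * x * x2 * X + a * r * x * x3 * X + a * r * x1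
      * x2 * x3 - a * r * x2 * x3 * X + b^2 * r^2 * x * d - b^2 * r^2 * x1 * d - b * r^3 * x * d
      + b * r^3 * x1 * d + b * r * x^2 * x2 - b * r * x^2 * X - b * r * x * x1 * x2 + b * r * x
      * x1 * X - b * r * x * x2 * x3 + b * r * x * x3 * X + b * r * x1 * x2 * x3 - b * r * x1 *
      x3 * X - r^2 * x^2 * x3 + r^2 * x^2 * X + r^2 * x * x1 * x3 - r^2 * x * x1 * X + r^2 * x *
      x2 * x3 - r^2 * x * x2 * X - r^2 * x1 * x2 * x3 + r^2 * x1 * x2 * X) * h12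

/-- The elimination of `cube_Q1`, with the edge polynomial (x - x2)² - 2 b² (x + x2) + b⁴ (times
`a`). -/
theorem cube_Q2 {a b r x x1 x2 x12 x3 x13 x23 X : ℂ}
    (h12 : Q2 x x1 x2 x12 a b = 0) (h13 : Q2 x x1 x3 x13 a r = 0)
    (h23 : Q2 x x2 x3 x23 b r = 0) (h : Q2 x2 x12 x23 X a r = 0)
    (hd : det2 (fun s t => Q2 x x2 s t b a) ≠ 0)
    (hs : slope1 (fun s => Q2 x x1 x3 s a r) ≠ 0) :
    Q2 x1 x12 x13 X b r = 0 := by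
  have hg : a * x^2 - 2 * a * x * x2 + a * x2^2 - 2 * a * b^2 * x - 2 * a * b^2 * x2 + a * b^4 ≠ 0 := fun h0 => hd (by
    simp only [det2, Q2, Q1]
    linear_combination (a - b) * h0)
  refine (mul_eq_zero.1 ?_).resolve_left (mul_ne_zero hg hs)
  simp only [slope1, Q2, Q1] at *
  linear_combination
      (a * x^2 - 2 * a * x * x2 + a * x2^2 - 2 * a * b^2 * x - 2 * a * b^2 * x2 + a * b^4) * (-
      b * x12 + b * X - r * x1 + r * x12 + b^2 * r - b * r^2) * h13 + (b * x^2 - 2 * b * x * x1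
      + b * x1^2 - 2 * a^2 * b * x - 2 * a^2 * b * x1 + a^4 * b) * (- b * x + b * x3 + r * x - r
      * x2 + b^2 * r - b * r^2) * h + (- b * x^2 + 2 * b * x * x1 - b * x1^2 + 2 * a^2 * b * x +
      2 * a^2 * b * x1 - a^4 * b) * (- a * x12 + a * X - r * x2 + r * x12 + a^2 * r - a * r^2) *
      h23 + (- a^4 * b^2 * r^2 + a^4 * b * r^3 + a^4 * b * r * x - a^4 * b * r * x3 - a^4 * r^2
      * x + a^4 * r^2 * x2 - 2 * a^3 * b^3 * r^2 + 4 * a^3 * b^2 * r^3 + 2 * a^3 * b^2 * r * x -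
      2 * a^3 * b^2 * r * x3 - 2 * a^3 * b * r^4 - 4 * a^3 * b * r^2 * x + 2 * a^3 * b * r^2 *
      x2 + 2 * a^3 * b * r^2 * x3 + 2 * a^3 * r^3 * x - 2 * a^3 * r^3 * x2 - a^2 * b^4 * r^2 + 4
      * a^2 * b^3 * r^3 + 2 * a^2 * b^3 * r * x - 2 * a^2 * b^3 * r * x3 - 4 * a^2 * b^2 * r^4 -
      6 * a^2 * b^2 * r^2 * x + a^2 * b^2 * r^2 * x1 + a^2 * b^2 * r^2 * x2 + 3 * a^2 * b^2 *
      r^2 * x3 + a^2 * b^2 * r^2 * X + a^2 * b * r^5 + 6 * a^2 * b * r^3 * x - a^2 * b * r^3 *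
      x1 - 3 * a^2 * b * r^3 * x2 - a^2 * b * r^3 * x3 - a^2 * b * r^3 * X - a^2 * b * r * x^2 -
      a^2 * b * r * x * x1 - a^2 * b * r * x * x2 + a^2 * b * r * x * x3 - a^2 * b * r * x * X +
      a^2 * b * r * x1 * x3 + a^2 * b * r * x2 * x3 + a^2 * b * r * x3 * X - 2 * a^2 * r^4 * x +
      2 * a^2 * r^4 * x2 + a^2 * r^2 * x^2 + a^2 * r^2 * x * x1 - a^2 * r^2 * x * x2 + a^2 * r^2
      * x * x3 + a^2 * r^2 * x * X - a^2 * r^2 * x1 * x2 - a^2 * r^2 * x2 * x3 - a^2 * r^2 * x2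
      * X + a * b^4 * r^3 + a * b^4 * r * x - a * b^4 * r * x3 - 2 * a * b^3 * r^4 - 4 * a * b^3
      * r^2 * x + 2 * a * b^3 * r^2 * x1 + 2 * a * b^3 * r^2 * x3 + a * b^2 * r^5 + 6 * a * b^2
      * r^3 * x - 3 * a * b^2 * r^3 * x1 - a * b^2 * r^3 * x2 - a * b^2 * r^3 * x3 - a * b^2 *
      r^3 * X - a * b^2 * r * x^2 - a * b^2 * r * x * x1 - a * b^2 * r * x * x2 + a * b^2 * r *
      x * x3 - a * b^2 * r * x * X + a * b^2 * r * x1 * x3 + a * b^2 * r * x2 * x3 + a * b^2 * r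
      * x3 * X - 4 * a * b * r^4 * x + 2 * a * b * r^4 * x1 + 2 * a * b * r^4 * x2 + 2 * a * b *
      r^2 * x^2 + 4 * a * b * r^2 * x * X - 2 * a * b * r^2 * x1 * x2 - 2 * a * b * r^2 * x1 *
      x3 - 2 * a * b * r^2 * x2 * x3 + a * r^5 * x - a * r^5 * x2 - a * r^3 * x^2 - a * r^3 * x
      * x1 + a * r^3 * x * x2 - a * r^3 * x * x3 - a * r^3 * x * X + a * r^3 * x1 * x2 + a * r^3
      * x2 * x3 + a * r^3 * x2 * X + a * r * x^2 * x1 - a * r * x^2 * X - a * r * x * x1 * x2 -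
      a * r * x * x1 * x3 + a * r * x * x2 * X + a * r * x * x3 * X + a * r * x1 * x2 * x3 - a *
      r * x2 * x3 * X - b^4 * r^2 * x + b^4 * r^2 * x1 + 2 * b^3 * r^3 * x - 2 * b^3 * r^3 * x1
      - 2 * b^2 * r^4 * x + 2 * b^2 * r^4 * x1 + b^2 * r^2 * x^2 - b^2 * r^2 * x * x1 + b^2 *
      r^2 * x * x2 + b^2 * r^2 * x * x3 + b^2 * r^2 * x * X - b^2 * r^2 * x1 * x2 - b^2 * r^2 *
      x1 * x3 - b^2 * r^2 * x1 * X + b * r^5 * x - b * r^5 * x1 - b * r^3 * x^2 + b * r^3 * x *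
      x1 - b * r^3 * x * x2 - b * r^3 * x * x3 - b * r^3 * x * X + b * r^3 * x1 * x2 + b * r^3 *
      x1 * x3 + b * r^3 * x1 * X + b * r * x^2 * x2 - b * r * x^2 * X - b * r * x * x1 * x2 + b
      * r * x * x1 * X - b * r * x * x2 * x3 + b * r * x * x3 * X + b * r * x1 * x2 * x3 - b * r
      * x1 * x3 * X - r^2 * x^2 * x3 + r^2 * x^2 * X + r^2 * x * x1 * x3 - r^2 * x * x1 * X +
      r^2 * x * x2 * x3 - r^2 * x * x2 * X - r^2 * x1 * x2 * x3 + r^2 * x1 * x2 * X) * h12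

/-- The elimination of `cube_Q1` again. The edge polynomial is 4 b² (x² + x2²) - 4 b (b² + 1) x x2 +
d (b² - 1)², which occurs with the factor a (a² - 1). -/
theorem cube_Q3h (d : ℂ) {a b r x x1 x2 x12 x3 x13 x23 X : ℂ}
    (h12 : Q3h d x x1 x2 x12 a b = 0) (h13 : Q3h d x x1 x3 x13 a r = 0)
    (h23 : Q3h d x x2 x3 x23 b r = 0) (h : Q3h d x2 x12 x23 X a r = 0)
    (hd : det2 (fun s t => Q3h d x x2 s t b a) ≠ 0)
    (hs : slope1 (fun s => Q3h d x x1 x3 s a r) ≠ 0) :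
    Q3h d x1 x12 x13 X b r = 0 := by
  have hg : 4 * a^3 * b^2 * x^2 + 4 * a^3 * b^2 * x2^2 - 4 * a^3 * b^3 * x * x2 - 4 * a^3 * b * x * x2 + a^3 * b^4 * d - 2 * a^3 * b^2 * d + a^3 * d - 4 * a * b^2 * x^2 - 4 * a * b^2 * x2^2 + 4 * a * b^3 * x * x2 + 4 * a * b * x * x2 - a * b^4 * d + 2 * a * b^2 * d - a * d ≠ 0 := fun h0 => hd (by
    simp only [det2, Q3h]
    linear_combination (4 * a^3 * b - 4 * a * b^3) * h0)
  refine (mul_eq_zero.1 ?_).resolve_left (mul_ne_zero hg hs)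
  simp only [slope1, Q3h] at *
  linear_combination
      (4 * a^3 * b^2 * x^2 + 4 * a^3 * b^2 * x2^2 - 4 * a^3 * b^3 * x * x2 - 4 * a^3 * b * x *
      x2 + a^3 * b^4 * d - 2 * a^3 * b^2 * d + a^3 * d - 4 * a * b^2 * x^2 - 4 * a * b^2 * x2^2
      + 4 * a * b^3 * x * x2 + 4 * a * b * x * x2 - a * b^4 * d + 2 * a * b^2 * d - a * d) * (4
      * b^3 * r^2 * X - 4 * b * r^2 * X - 4 * b^2 * r^3 * x1 + 4 * b^2 * r * x1 - 4 * b^3 * r *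
      x12 + 4 * b * r^3 * x12) * h13 + (4 * a^2 * b^3 * x^2 + 4 * a^2 * b^3 * x1^2 - 4 * a^3 *
      b^3 * x * x1 - 4 * a * b^3 * x * x1 + a^4 * b^3 * d - 2 * a^2 * b^3 * d + b^3 * d - 4 *
      a^2 * b * x^2 - 4 * a^2 * b * x1^2 + 4 * a^3 * b * x * x1 + 4 * a * b * x * x1 - a^4 * b *
      d + 2 * a^2 * b * d - b * d) * (4 * b^3 * r^2 * x3 - 4 * b * r^2 * x3 - 4 * b^2 * r^3 * x2
      + 4 * b^2 * r * x2 - 4 * b^3 * r * x + 4 * b * r^3 * x) * h + (- 4 * a^2 * b^3 * x^2 - 4 *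
      a^2 * b^3 * x1^2 + 4 * a^3 * b^3 * x * x1 + 4 * a * b^3 * x * x1 - a^4 * b^3 * d + 2 * a^2
      * b^3 * d - b^3 * d + 4 * a^2 * b * x^2 + 4 * a^2 * b * x1^2 - 4 * a^3 * b * x * x1 - 4 *
      a * b * x * x1 + a^4 * b * d - 2 * a^2 * b * d + b * d) * (4 * a^3 * r^2 * X - 4 * a * r^2
      * X - 4 * a^2 * r^3 * x2 + 4 * a^2 * r * x2 - 4 * a^3 * r * x12 + 4 * a * r^3 * x12) * h23
      + (- 4 * a^4 * b^4 * r^4 * x3 * d + 4 * a^4 * b^4 * r^3 * x * d + 4 * a^4 * b^4 * r^2 * x3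
      * d - 4 * a^4 * b^4 * r * x * d + 4 * a^4 * b^3 * r^5 * x2 * d - 8 * a^4 * b^3 * r^3 * x2
      * d + 4 * a^4 * b^3 * r * x2 * d - 4 * a^4 * b^2 * r^5 * x * d + 4 * a^4 * b^2 * r^4 * x3
      * d + 4 * a^4 * b^2 * r^3 * x * d - 4 * a^4 * b^2 * r^2 * x3 * d + 4 * a^3 * b^4 * r^5 *
      x1 * d - 8 * a^3 * b^4 * r^3 * x1 * d + 4 * a^3 * b^4 * r * x1 * d - 4 * a^3 * b^3 * r^6 *
      X * d - 16 * a^3 * b^3 * r^5 * x * x1 * x2 + 16 * a^3 * b^3 * r^5 * x * x3 * X - 16 * a^3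
      * b^3 * r^4 * x^2 * X + 16 * a^3 * b^3 * r^4 * x1 * x2 * x3 + 8 * a^3 * b^3 * r^4 * X * d
      + 16 * a^3 * b^3 * r^3 * x * x1 * x2 - 16 * a^3 * b^3 * r^3 * x * x3 * X + 16 * a^3 * b^3
      * r^2 * x^2 * X - 16 * a^3 * b^3 * r^2 * x1 * x2 * x3 - 4 * a^3 * b^3 * r^2 * X * d + 16 *
      a^3 * b^2 * r^5 * x^2 * x1 - 4 * a^3 * b^2 * r^5 * x1 * d - 16 * a^3 * b^2 * r^5 * x2 * x3
      * X - 16 * a^3 * b^2 * r^4 * x * x1 * x3 + 16 * a^3 * b^2 * r^4 * x * x2 * X - 16 * a^3 *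
      b^2 * r^3 * x^2 * x1 + 8 * a^3 * b^2 * r^3 * x1 * d + 16 * a^3 * b^2 * r^3 * x2 * x3 * X +
      16 * a^3 * b^2 * r^2 * x * x1 * x3 - 16 * a^3 * b^2 * r^2 * x * x2 * X - 4 * a^3 * b^2 * r
      * x1 * d + 4 * a^3 * b * r^6 * X * d - 8 * a^3 * b * r^4 * X * d + 4 * a^3 * b * r^2 * X *
      d - 4 * a^2 * b^4 * r^5 * x * d + 4 * a^2 * b^4 * r^4 * x3 * d + 4 * a^2 * b^4 * r^3 * x *
      d - 4 * a^2 * b^4 * r^2 * x3 * d + 16 * a^2 * b^3 * r^5 * x^2 * x2 - 16 * a^2 * b^3 * r^5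
      * x1 * x3 * X - 4 * a^2 * b^3 * r^5 * x2 * d + 16 * a^2 * b^3 * r^4 * x * x1 * X - 16 *
      a^2 * b^3 * r^4 * x * x2 * x3 - 16 * a^2 * b^3 * r^3 * x^2 * x2 + 16 * a^2 * b^3 * r^3 *
      x1 * x3 * X + 8 * a^2 * b^3 * r^3 * x2 * d - 16 * a^2 * b^3 * r^2 * x * x1 * X + 16 * a^2
      * b^3 * r^2 * x * x2 * x3 - 4 * a^2 * b^3 * r * x2 * d + 4 * a^2 * b^2 * r^7 * x * d - 16
      * a^2 * b^2 * r^6 * x^2 * x3 + 16 * a^2 * b^2 * r^6 * x1 * x2 * X + 4 * a^2 * b^2 * r^6 *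
      x3 * d - 4 * a^2 * b^2 * r^5 * x * d + 32 * a^2 * b^2 * r^4 * x^2 * x3 - 32 * a^2 * b^2 *
      r^4 * x1 * x2 * X - 8 * a^2 * b^2 * r^4 * x3 * d - 4 * a^2 * b^2 * r^3 * x * d - 16 * a^2
      * b^2 * r^2 * x^2 * x3 + 16 * a^2 * b^2 * r^2 * x1 * x2 * X + 4 * a^2 * b^2 * r^2 * x3 * d
      + 4 * a^2 * b^2 * r * x * d - 4 * a^2 * b * r^7 * x2 * d - 16 * a^2 * b * r^6 * x * x1 * X
      + 16 * a^2 * b * r^6 * x * x2 * x3 - 16 * a^2 * b * r^5 * x^2 * x2 + 16 * a^2 * b * r^5 *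
      x1 * x3 * X + 8 * a^2 * b * r^5 * x2 * d + 16 * a^2 * b * r^4 * x * x1 * X - 16 * a^2 * b
      * r^4 * x * x2 * x3 + 16 * a^2 * b * r^3 * x^2 * x2 - 16 * a^2 * b * r^3 * x1 * x3 * X - 4
      * a^2 * b * r^3 * x2 * d - 4 * a^2 * r^6 * x3 * d + 4 * a^2 * r^5 * x * d + 4 * a^2 * r^4
      * x3 * d - 4 * a^2 * r^3 * x * d + 4 * a * b^3 * r^6 * X * d - 8 * a * b^3 * r^4 * X * d +
      4 * a * b^3 * r^2 * X * d - 4 * a * b^2 * r^7 * x1 * d + 16 * a * b^2 * r^6 * x * x1 * x3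
      - 16 * a * b^2 * r^6 * x * x2 * X - 16 * a * b^2 * r^5 * x^2 * x1 + 8 * a * b^2 * r^5 * x1
      * d + 16 * a * b^2 * r^5 * x2 * x3 * X - 16 * a * b^2 * r^4 * x * x1 * x3 + 16 * a * b^2 *
      r^4 * x * x2 * X + 16 * a * b^2 * r^3 * x^2 * x1 - 4 * a * b^2 * r^3 * x1 * d - 16 * a *
      b^2 * r^3 * x2 * x3 * X + 16 * a * b * r^6 * x^2 * X - 16 * a * b * r^6 * x1 * x2 * x3 - 4
      * a * b * r^6 * X * d + 16 * a * b * r^5 * x * x1 * x2 - 16 * a * b * r^5 * x * x3 * X -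
      16 * a * b * r^4 * x^2 * X + 16 * a * b * r^4 * x1 * x2 * x3 + 8 * a * b * r^4 * X * d -
      16 * a * b * r^3 * x * x1 * x2 + 16 * a * b * r^3 * x * x3 * X - 4 * a * b * r^2 * X * d +
      4 * a * r^7 * x1 * d - 8 * a * r^5 * x1 * d + 4 * a * r^3 * x1 * d - 4 * b^2 * r^6 * x3 *
      d + 4 * b^2 * r^5 * x * d + 4 * b^2 * r^4 * x3 * d - 4 * b^2 * r^3 * x * d + 4 * b * r^7 *
      x2 * d - 8 * b * r^5 * x2 * d + 4 * b * r^3 * x2 * d - 4 * r^7 * x * d + 4 * r^6 * x3 * d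
      + 4 * r^5 * x * d - 4 * r^4 * x3 * d) * h12
end Alg
end HexQuad

/-! ### Polynomial certificates for cubes with vertices of both types. -/

namespace HexQuad
namespace Alg

/-- The cube has a `Qs`-face and an opposite `Q`-face joined by four trapezoidal faces. Here `w12`
is eliminated between the goal and `hQs`, and `y1` between `hQ` and `h01`; the results are compared
modulo `h02`. The constant `d * e` in the `Q`-face serves the `H3` cases with `e = 1`, where it is
`d`, and with `e = 0`, where it vanishes. -/
theorem parallel_H3 (d e : ℂ) {a b g w w1 w2 w12 y y1 y2 y12 : ℂ} (hb1 : b ^ 2 - 1 ≠ 0)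
    (hQs : Q3h 0 w w1 w2 w12 a b = 0) (hQ : Q3h (d * e) y y1 y2 y12 a b = 0)
    (h01 : T3h d e w w1 y y1 a g = 0) (h02 : T3h d e w w2 y y2 b g = 0)
    (hd : det2 (fun s t => T3h d e w s y t a g) ≠ 0)
    (hs : slope1 (fun s => Q3h 0 w w1 w2 s a b) ≠ 0) :
    T3h d e w2 w12 y2 y12 a g = 0 := by
  have hg : 2 * g * w * y - d - g^2 * e * w^2 ≠ 0 := fun h0 => hd (by
    simp only [det2, T3h]
    linear_combination (- 2 * a^4 * g + 2 * a^2 * g) * h0)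
  have hf : b^2 - 1 ≠ 0 := by simpa [sub_eq_add_neg] using hb1
  refine (mul_eq_zero.1 ?_).resolve_left (mul_ne_zero (mul_ne_zero hf hg) hs)
  simp only [slope1, T3h, Q3h] at *
  linear_combination
      (2 * b^2 * g * w * y - b^2 * d - b^2 * g^2 * e * w^2 - 2 * g * w * y + d + g^2 * e * w^2)
      * (2 * a * g * y12 - 2 * a^2 * g * y2 - g^2 * e * w2 + a^2 * g^2 * e * w2) * hQs + (2 * b
      * g * w^2 + 2 * b * g * w2^2 - 2 * b^2 * g * w * w2 - 2 * g * w * w2) * (2 * a * g * w1 -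
      2 * a^2 * g * w) * hQ + (- 2 * b * g * w^2 - 2 * b * g * w2^2 + 2 * b^2 * g * w * w2 + 2 *
      g * w * w2) * (4 * a^3 * b^2 * y - 4 * a * b^2 * y - 4 * a^2 * b^3 * y12 + 4 * a^2 * b *
      y12 - 4 * a^3 * b * y2 + 4 * a * b^3 * y2) * h01 + (- 4 * a^6 * b * d * w2 + 4 * a^6 * d *
      w + 4 * a^5 * b^2 * g^2 * e * w^2 * w1 - 8 * a^5 * b^2 * g * w * w1 * y + 8 * a^5 * b^2 *
      g * w * w2 * y12 + 4 * a^5 * b^2 * d * w1 - 4 * a^5 * b * g^2 * e * w * w1 * w2 - 8 * a^5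
      * b * g * w^2 * y12 + 8 * a^5 * b * g * w1 * w2 * y - 4 * a^5 * d * w1 - 4 * a^4 * b^3 *
      g^2 * e * w^2 * w2 + 8 * a^4 * b^2 * g * w^2 * y - 8 * a^4 * b^2 * g * w1 * w2 * y12 - 4 *
      a^4 * b^2 * d * w + 4 * a^4 * b * g^2 * e * w^2 * w2 + 8 * a^4 * b * g * w * w1 * y12 - 8
      * a^4 * b * g * w * w2 * y + 8 * a^4 * b * d * w2 - 4 * a^4 * d * w + 4 * a^3 * b^3 * g^2
      * e * w * w1 * w2 - 8 * a^3 * b^2 * g^2 * e * w^2 * w1 + 8 * a^3 * b^2 * g * w * w1 * y -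
      8 * a^3 * b^2 * g * w * w2 * y12 - 4 * a^3 * b^2 * d * w1 + 4 * a^3 * b * g^2 * e * w * w1
      * w2 + 8 * a^3 * b * g * w^2 * y12 - 8 * a^3 * b * g * w1 * w2 * y + 4 * a^3 * d * w1 + 4
      * a^2 * b^3 * g^2 * e * w^2 * w2 - 8 * a^2 * b^2 * g * w^2 * y + 8 * a^2 * b^2 * g * w1 *
      w2 * y12 + 4 * a^2 * b^2 * d * w - 4 * a^2 * b * g^2 * e * w^2 * w2 - 8 * a^2 * b * g * w
      * w1 * y12 + 8 * a^2 * b * g * w * w2 * y - 4 * a^2 * b * d * w2 - 4 * a * b^3 * g^2 * e *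
      w * w1 * w2 + 4 * a * b^2 * g^2 * e * w^2 * w1) * h02

/-- The cube stands over a square with an `H`-equation: `w10` and `w01` are the neighbours of `y00`
in the directions `g` and `r`, `y11` is opposite to `y00`, and an underscore marks a shift in the
direction `a`. The fourth side face follows from the base and three sides by eliminating `y11_`
between the goal and `hT2`, and `y00_` between `hT1` and `hT4`, modulo `hH`. -/
theorem transport_H3 (d e : ℂ) {a g r w10 w10_ w01 w01_ y00 y00_ y11 y11_ : ℂ} (hr : r ≠ 0)
    (hH : H3h d e w01 y11 y00 w10 g r = 0) (hT1 : T3h d e w10 w10_ y00 y00_ a g = 0)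
    (hT2 : T3h d e w10 w10_ y11 y11_ a r = 0) (hT4 : T3h d e w01 w01_ y00 y00_ a r = 0)
    (hd : det2 (fun s t => T3h d e w10 s y00 t a g) ≠ 0)
    (hs : slope1 (fun s => T3h d e w10 w10_ y11 s a r) ≠ 0) :
    T3h d e w01 w01_ y11 y11_ a g = 0 := by
  have hg : 2 * g * w10 * y00 - d - g^2 * e * w10^2 ≠ 0 := fun h0 => hd (by
    simp only [det2, T3h]
    linear_combination (- 2 * a^4 * g + 2 * a^2 * g) * h0)
  refine (mul_eq_zero.1 ?_).resolve_left (mul_ne_zero (mul_ne_zero hr hg) hs)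
  simp only [slope1, T3h, H3h] at *
  linear_combination
      (2 * g * r * w10 * y00 - r * d - g^2 * r * e * w10^2) * (2 * a * g * w01_ - 2 * a^2 * g *
      w01) * hT2 + (2 * g * r * w10 * y11 - g * d - g * r^2 * e * w10^2) * (2 * a * g * w10_ - 2
      * a^2 * g * w10) * hT4 + (- 2 * g * r * w10 * y11 + g * d + g * r^2 * e * w10^2) * (2 * a
      * r * w01_ - 2 * a^2 * r * w01) * hT1 + (2 * a^5 * d * w10 - 2 * a^4 * g * r * e * w10^2 *
      w01_ - 2 * a^4 * d * w10_ + 2 * a^3 * g * r * e * w10 * w10_ * w01_ - 2 * a^3 * d * w10 +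
      2 * a^2 * g * r * e * w10^2 * w01_ + 2 * a^2 * d * w10_ - 2 * a * g * r * e * w10 * w10_ *
      w01_) * hH

/-- On the same cube, the `H`-equation passes from the base to the opposite face: `w10_` is
eliminated between the goal and `hT1`, and `y11` between `hT3` and `hH`, modulo `hT4`. The
certificate carries an extra factor a (1 - a²), hence the conditions on `a`. -/
theorem translate_H3 (d e : ℂ) {a g r w10 w10_ w01 w01_ y00 y00_ y11 y11_ : ℂ} (ha : a ≠ 0) (ha1 : a ^ 2 - 1 ≠ 0)
    (hH : H3h d e w01 y11 y00 w10 g r = 0) (hT1 : T3h d e w10 w10_ y00 y00_ a g = 0)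
    (hT3 : T3h d e w01 w01_ y11 y11_ a g = 0) (hT4 : T3h d e w01 w01_ y00 y00_ a r = 0)
    (hd : det2 (fun s t => H3h d e w01 t y00 s g r) ≠ 0)
    (hs : slope1 (fun s => T3h d e w10 s y00 y00_ a g) ≠ 0) :
    H3h d e w01_ y11_ y00_ w10_ g r = 0 := by
  have hg : 4 * r * w01 * y00 - 2 * d - 2 * r^2 * e * w01^2 ≠ 0 := fun h0 => hd (by
    simp only [det2, H3h]
    linear_combination (g^4 * r - g^2 * r^3) * h0)
  have hf : - a^3 + a ≠ 0 := by
    have e : - a^3 + a = -1 * a * (a ^ 2 - 1) := by ring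
    rw [e]
    exact mul_ne_zero (mul_ne_zero (by norm_num) ha) ha1
  refine (mul_eq_zero.1 ?_).resolve_left (mul_ne_zero (mul_ne_zero hf hg) hs)
  simp only [slope1, T3h, H3h] at *
  linear_combination
      (4 * a * r * w01 * y00 - 2 * a * d - 2 * a * r^2 * e * w01^2 - 4 * a^3 * r * w01 * y00 + 2
      * a^3 * d + 2 * a^3 * r^2 * e * w01^2) * (2 * g^2 * r * y11_ - 2 * g * r^2 * y00_ - g^3 *
      r * e * w01_ + g * r^3 * e * w01_) * hT1 + (- 4 * a^2 * r * y00^2 - 4 * a^2 * r * y00_^2 +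
      4 * a^3 * r * y00 * y00_ + 4 * a * r * y00 * y00_ - a^4 * r * d * e + 2 * a^2 * r * d * e
      - r * d * e) * (2 * g^2 * r * w10 - 2 * g * r^2 * w01) * hT3 + (4 * a^2 * r * y00^2 + 4 *
      a^2 * r * y00_^2 - 4 * a^3 * r * y00 * y00_ - 4 * a * r * y00 * y00_ + a^4 * r * d * e - 2
      * a^2 * r * d * e + r * d * e) * (2 * a * g * w01 - 2 * a^2 * g * w01_) * hH + (2 * a^4 *
      g^2 * r^2 * d * e * w10 - 2 * a^4 * g * r^3 * d * e * w01 - 4 * a^3 * g^3 * r^2 * e * w10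
      * w01 * y11_ + 4 * a^3 * g^2 * r^3 * e * w10 * w01 * y00_ - 8 * a^3 * g^2 * r^2 * w10 *
      y00 * y00_ + 8 * a^3 * g^2 * r^2 * w01 * y00 * y11_ - 4 * a^3 * g^2 * r * d * y11_ + 4 *
      a^3 * g * r^2 * d * y00_ + 4 * a^2 * g^4 * r * e * w10 * w01 * y00 - 2 * a^2 * g^4 * d * e
      * w10 + 2 * a^2 * g^3 * r * d * e * w01 + 8 * a^2 * g^3 * r * w10 * y00_ * y11_ - 8 * a^2
      * g^3 * r * w01 * y00^2 + 4 * a^2 * g^3 * d * y00 - 4 * a^2 * g^2 * r^3 * e * w10 * w01 *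
      y00 - 2 * a^2 * g^2 * r^2 * d * e * w10 + 8 * a^2 * g^2 * r^2 * w10 * y00^2 - 8 * a^2 *
      g^2 * r^2 * w01 * y00_ * y11_ + 2 * a^2 * g * r^3 * d * e * w01 - 4 * a^2 * g * r^2 * d *
      y00 - 4 * a * g^4 * r * e * w10 * w01 * y00_ + 4 * a * g^3 * r^2 * e * w10 * w01 * y11_ -
      8 * a * g^3 * r * w10 * y00 * y11_ + 8 * a * g^3 * r * w01 * y00 * y00_ - 4 * a * g^3 * d
      * y00_ + 4 * a * g^2 * r * d * y11_ + 2 * g^4 * d * e * w10 - 2 * g^3 * r * d * e * w01) *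
      hT4

theorem parallel_H2one {a b g w w1 w2 w12 y y1 y2 y12 : ℂ} (hb : b ≠ 0)
    (hQs : Q1 1 w w1 w2 w12 a b = 0) (hQ : Q2 y y1 y2 y12 a b = 0)
    (h01 : T2 1 w w1 y y1 a g = 0) (h02 : T2 1 w w2 y y2 b g = 0)
    (hd : det2 (fun s t => T2 1 w s y t a g) ≠ 0)
    (hs : slope1 (fun s => Q1 1 w w1 w2 s a b) ≠ 0) :
    T2 1 w2 w12 y2 y12 a g = 0 := by
  have hg : - y + 2 * g * w + g^2 + w^2 ≠ 0 := fun h0 => hd (by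
    simp only [det2, T2, H2, two]
    linear_combination (2 * a) * h0)
  have hf : b ≠ 0 := by simpa using hb
  refine (mul_eq_zero.1 ?_).resolve_left (mul_ne_zero (mul_ne_zero hf hg) hs)
  simp only [slope1, T2, Q1, Q2, H2, two] at *
  linear_combination
      (- b * y + 2 * b * g * w + b * g^2 + b * w^2) * (- y12 + y2 - 2 * a * w2 - 2 * a * g +
      a^2) * hQs + (- 1/2 * w^2 + w * w2 - 1/2 * w2^2 + 1/2 * b^2) * (w - w1 + a) * hQ + (1/2 *
      w^2 - w * w2 + 1/2 * w2^2 - 1/2 * b^2) * (a * y - a * y2 + b * y2 - b * y12 + a^2 * b - a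
      * b^2) * h01 + (1/2 * a^4 * b - 1/2 * a^4 * w + 1/2 * a^4 * w2 - a^3 * b^2 - a^3 * b * g +
      1/2 * a^3 * b * w - 1/2 * a^3 * b * w1 - a^3 * b * w2 + a^3 * g * w - a^3 * g * w2 + 1/2 *
      a^3 * w^2 + 1/2 * a^3 * w * w1 - 1/2 * a^3 * w * w2 - 1/2 * a^3 * w1 * w2 + 1/2 * a^2 *
      b^3 + a^2 * b^2 * g - 1/2 * a^2 * b^2 * w + a^2 * b^2 * w1 + 1/2 * a^2 * b^2 * w2 - 2 *
      a^2 * b * g * w + a^2 * b * g * w1 + a^2 * b * g * w2 - a^2 * b * w^2 + a^2 * b * w1 * w2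
      + 1/2 * a^2 * b * y - 1/2 * a^2 * b * y12 - a^2 * g^2 * w + a^2 * g^2 * w2 - a^2 * g * w^2
      - a^2 * g * w * w1 + a^2 * g * w * w2 + a^2 * g * w1 * w2 - a^2 * w^2 * w1 + a^2 * w * w1
      * w2 + 1/2 * a^2 * w * y + 1/2 * a^2 * w * y12 - 1/2 * a^2 * w2 * y - 1/2 * a^2 * w2 * y12
      + 1/2 * a * b^3 * w - 1/2 * a * b^3 * w1 + a * b^2 * g * w - a * b^2 * g * w1 + 1/2 * a *
      b^2 * w^2 - 1/2 * a * b^2 * w * w1 + 1/2 * a * b^2 * w * w2 - 1/2 * a * b^2 * w1 * w2 + a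
      * b * g^2 * w - a * b * g^2 * w1 + a * b * g * w^2 - a * b * g * w * w1 + a * b * g * w *
      w2 - a * b * g * w1 * w2 + a * b * w^2 * w2 - a * b * w * w1 * w2 - 1/2 * a * b * w * y -
      1/2 * a * b * w * y12 + 1/2 * a * b * w1 * y + 1/2 * a * b * w1 * y12 - 1/2 * a * w^2 * y
      + 1/2 * a * w^2 * y12 + 1/2 * a * w * w1 * y - 1/2 * a * w * w1 * y12 + 1/2 * a * w * w2 *
      y - 1/2 * a * w * w2 * y12 - 1/2 * a * w1 * w2 * y + 1/2 * a * w1 * w2 * y12) * h02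

theorem transport_H2one {a g r w10 w10_ w01 w01_ y00 y00_ y11 y11_ : ℂ} 
    (hH : H2 1 w01 y11 y00 w10 g r = 0) (hT1 : T2 1 w10 w10_ y00 y00_ a g = 0)
    (hT2 : T2 1 w10 w10_ y11 y11_ a r = 0) (hT4 : T2 1 w01 w01_ y00 y00_ a r = 0)
    (hd : det2 (fun s t => T2 1 w10 s y00 t a g) ≠ 0)
    (hs : slope1 (fun s => T2 1 w10 w10_ y11 s a r) ≠ 0) :
    T2 1 w01 w01_ y11 y11_ a g = 0 := by
  have hg : - y00 + 2 * g * w10 + g^2 + w10^2 ≠ 0 := fun h0 => hd (by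
    simp only [det2, T2, H2, two]
    linear_combination (2 * a) * h0)
  refine (mul_eq_zero.1 ?_).resolve_left (mul_ne_zero hg hs)
  simp only [slope1, T2, H2, two] at *
  linear_combination
      (- y00 + 2 * g * w10 + g^2 + w10^2) * (w01 - w01_ + a) * hT2 + (- y11 + 2 * r * w10 + r^2
      + w10^2) * (w10 - w10_ + a) * hT4 + (y11 - 2 * r * w10 - r^2 - w10^2) * (w01 - w01_ + a) *
      hT1 + (2 * a^3 - 2 * a^2 * g - 2 * a^2 * r - 2 * a^2 * w10_ - 2 * a^2 * w01_ - 2 * a * g *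
      w10 + 2 * a * g * w10_ - 2 * a * r * w10 + 2 * a * r * w10_ - 2 * a * w10^2 + 2 * a * w10
      * w10_ - 2 * a * w10 * w01_ + 2 * a * w10_ * w01_) * hH

theorem translate_H2one {a g r w10 w10_ w01 w01_ y00 y00_ y11 y11_ : ℂ} (ha : a ≠ 0)
    (hH : H2 1 w01 y11 y00 w10 g r = 0) (hT1 : T2 1 w10 w10_ y00 y00_ a g = 0)
    (hT3 : T2 1 w01 w01_ y11 y11_ a g = 0) (hT4 : T2 1 w01 w01_ y00 y00_ a r = 0)
    (hd : det2 (fun s t => H2 1 w01 t y00 s g r) ≠ 0)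
    (hs : slope1 (fun s => T2 1 w10 s y00 y00_ a g) ≠ 0) :
    H2 1 w01_ y11_ y00_ w10_ g r = 0 := by
  have hg : - 2 * r^2 - 4 * r * w01 - 2 * w01^2 + 2 * y00 ≠ 0 := fun h0 => hd (by
    simp only [det2, H2, two]
    linear_combination (g - r) * h0)
  have hf : a ≠ 0 := by simpa using ha
  refine (mul_eq_zero.1 ?_).resolve_left (mul_ne_zero (mul_ne_zero hf hg) hs)
  simp only [slope1, T2, H2, two] at *
  linear_combination
      (- 2 * a * r^2 - 4 * a * r * w01 - 2 * a * w01^2 + 2 * a * y00) * (- y11_ + y00_ + 2 * g *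
      w01_ - 2 * r * w01_ + g^2 - r^2) * hT1 + (- 2 * a^2 * y00_ - 2 * a^2 * y00 + a^4 + y00_^2
      - 2 * y00 * y00_ + y00^2) * (w01 - w10 - g + r) * hT3 + (2 * a^2 * y00_ + 2 * a^2 * y00 -
      a^4 - y00_^2 + 2 * y00 * y00_ - y00^2) * (- w01 + w01_ + a) * hH + (a^4 * g - a^4 * r +
      a^4 * w10 - a^4 * w01 - 2 * a^3 * g^2 + 4 * a^3 * g * r - 2 * a^3 * g * w10 + 2 * a^3 * g
      * w01 - 2 * a^3 * r^2 + 2 * a^3 * r * w10 - 2 * a^3 * r * w01 + a^2 * g^3 - 5 * a^2 * g^2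
      * r + a^2 * g^2 * w10 - 3 * a^2 * g^2 * w01 + 5 * a^2 * g * r^2 - 4 * a^2 * g * r * w10 +
      4 * a^2 * g * r * w01 - 2 * a^2 * g * w10 * w01 - a^2 * g * y00_ - a^2 * g * y11_ - a^2 *
      r^3 + 3 * a^2 * r^2 * w10 - a^2 * r^2 * w01 + 2 * a^2 * r * w10 * w01 + a^2 * r * y00_ +
      a^2 * r * y11_ - 2 * a^2 * w10 * y00 - a^2 * w10 * y00_ - a^2 * w10 * y11_ + 2 * a^2 * w01
      * y00 + a^2 * w01 * y00_ + a^2 * w01 * y11_ + 2 * a * g^3 * r + 2 * a * g^3 * w01 - 4 * a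
      * g^2 * r^2 + 2 * a * g^2 * r * w10 - 4 * a * g^2 * r * w01 + 2 * a * g^2 * w10 * w01 + 2
      * a * g^2 * y00_ + 2 * a * g * r^3 - 4 * a * g * r^2 * w10 + 2 * a * g * r^2 * w01 - 4 * a
      * g * r * w10 * w01 - 2 * a * g * r * y00_ - 2 * a * g * r * y11_ + 2 * a * g * w10 * y00
      + 2 * a * g * w10 * y00_ - 2 * a * g * w01 * y00 - 2 * a * g * w01 * y11_ + 2 * a * r^3 *
      w10 + 2 * a * r^2 * w10 * w01 + 2 * a * r^2 * y00_ - 2 * a * r * w10 * y00 - 2 * a * r *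
      w10 * y11_ + 2 * a * r * w01 * y00 + 2 * a * r * w01 * y00_ + 2 * a * w10 * w01 * y00_ - 2
      * a * w10 * w01 * y11_ - 2 * a * y00 * y00_ + 2 * a * y00 * y11_ + g^3 * y00 - g^3 * y00_
      - g^2 * r * y00 + g^2 * r * y00_ + g^2 * w10 * y00 - g^2 * w10 * y00_ + g^2 * w01 * y00 -
      g^2 * w01 * y00_ + g * r^2 * y00 - g * r^2 * y00_ + 2 * g * w10 * w01 * y00 - 2 * g * w10
      * w01 * y00_ - g * y00^2 + g * y00 * y00_ - g * y00 * y11_ + g * y00_ * y11_ - r^3 * y00 +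
      r^3 * y00_ - r^2 * w10 * y00 + r^2 * w10 * y00_ - r^2 * w01 * y00 + r^2 * w01 * y00_ - 2 *
      r * w10 * w01 * y00 + 2 * r * w10 * w01 * y00_ + r * y00^2 - r * y00 * y00_ + r * y00 *
      y11_ - r * y00_ * y11_ + w10 * y00^2 - w10 * y00 * y00_ - w10 * y00 * y11_ + w10 * y00_ *
      y11_ - w01 * y00^2 + w01 * y00 * y00_ + w01 * y00 * y11_ - w01 * y00_ * y11_) * hT4

theorem parallel_H2zero {a b g w w1 w2 w12 y y1 y2 y12 : ℂ} (hb : b ≠ 0)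
    (hQs : Q1 1 w w1 w2 w12 a b = 0) (hQ : Q1 1 y y1 y2 y12 a b = 0)
    (h01 : T2 0 w w1 y y1 a g = 0) (h02 : T2 0 w w2 y y2 b g = 0)
    (hd : det2 (fun s t => T2 0 w s y t a g) ≠ 0)
    (hs : slope1 (fun s => Q1 1 w w1 w2 s a b) ≠ 0) :
    T2 0 w2 w12 y2 y12 a g = 0 := by
  have hg : w + y + g ≠ 0 := fun h0 => hd (by
    simp only [det2, T2, H2, two]
    linear_combination (- 2 * a) * h0)
  have hf : b ≠ 0 := by simpa using hb
  refine (mul_eq_zero.1 ?_).resolve_left (mul_ne_zero (mul_ne_zero hf hg) hs)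
  simp only [slope1, T2, Q1, H2, two] at *
  linear_combination
      (b * w + b * y + b * g) * (- y12 + y2 + a) * hQs + (1/2 * w^2 - w * w2 + 1/2 * w2^2 - 1/2
      * b^2) * (w - w1 + a) * hQ + (- 1/2 * w^2 + w * w2 - 1/2 * w2^2 + 1/2 * b^2) * (a * y - a
      * y2 + b * y2 - b * y12) * h01 + (- 1/2 * a^3 * b + 1/2 * a^3 * w - 1/2 * a^3 * w2 + 1/2 *
      a^2 * b^2 - a^2 * b * w + 1/2 * a^2 * b * w1 + 1/2 * a^2 * b * w2 - 1/2 * a^2 * b * y +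
      1/2 * a^2 * b * y12 - a^2 * g * w + a^2 * g * w2 - 1/2 * a^2 * w^2 - 1/2 * a^2 * w * w1 +
      1/2 * a^2 * w * w2 - 1/2 * a^2 * w * y - 1/2 * a^2 * w * y12 + 1/2 * a^2 * w1 * w2 + 1/2 *
      a^2 * w2 * y + 1/2 * a^2 * w2 * y12 + 1/2 * a * b^2 * w - 1/2 * a * b^2 * w1 + a * b * g *
      w - a * b * g * w1 + 1/2 * a * b * w^2 - 1/2 * a * b * w * w1 + 1/2 * a * b * w * w2 + 1/2
      * a * b * w * y + 1/2 * a * b * w * y12 - 1/2 * a * b * w1 * w2 - 1/2 * a * b * w1 * y -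
      1/2 * a * b * w1 * y12 + 1/2 * a * w^2 * y - 1/2 * a * w^2 * y12 - 1/2 * a * w * w1 * y +
      1/2 * a * w * w1 * y12 - 1/2 * a * w * w2 * y + 1/2 * a * w * w2 * y12 + 1/2 * a * w1 * w2
      * y - 1/2 * a * w1 * w2 * y12) * h02

theorem transport_H2zero {a g r w10 w10_ w01 w01_ y00 y00_ y11 y11_ : ℂ} 
    (hH : H2 0 w01 y11 y00 w10 g r = 0) (hT1 : T2 0 w10 w10_ y00 y00_ a g = 0)
    (hT2 : T2 0 w10 w10_ y11 y11_ a r = 0) (hT4 : T2 0 w01 w01_ y00 y00_ a r = 0)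
    (hd : det2 (fun s t => T2 0 w10 s y00 t a g) ≠ 0)
    (hs : slope1 (fun s => T2 0 w10 w10_ y11 s a r) ≠ 0) :
    T2 0 w01 w01_ y11 y11_ a g = 0 := by
  have hg : w10 + y00 + g ≠ 0 := fun h0 => hd (by
    simp only [det2, T2, H2, two]
    linear_combination (- 2 * a) * h0)
  refine (mul_eq_zero.1 ?_).resolve_left (mul_ne_zero hg hs)
  simp only [slope1, T2, H2, two] at *
  linear_combination
      (w10 + y00 + g) * (w01 - w01_ + a) * hT2 + (w10 + y11 + r) * (w10 - w10_ + a) * hT4 + (-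
      w10 - y11 - r) * (w01 - w01_ + a) * hT1 + (- 2 * a^2 - 2 * a * w10 + 2 * a * w10_) * hH

theorem translate_H2zero {a g r w10 w10_ w01 w01_ y00 y00_ y11 y11_ : ℂ} (ha : a ≠ 0)
    (hH : H2 0 w01 y11 y00 w10 g r = 0) (hT1 : T2 0 w10 w10_ y00 y00_ a g = 0)
    (hT3 : T2 0 w01 w01_ y11 y11_ a g = 0) (hT4 : T2 0 w01 w01_ y00 y00_ a r = 0)
    (hd : det2 (fun s t => H2 0 w01 t y00 s g r) ≠ 0)
    (hs : slope1 (fun s => T2 0 w10 s y00 y00_ a g) ≠ 0) :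
    H2 0 w01_ y11_ y00_ w10_ g r = 0 := by
  have hg : 2 * r + 2 * w01 + 2 * y00 ≠ 0 := fun h0 => hd (by
    simp only [det2, H2, two]
    linear_combination (g - r) * h0)
  have hf : a ≠ 0 := by simpa using ha
  refine (mul_eq_zero.1 ?_).resolve_left (mul_ne_zero (mul_ne_zero hf hg) hs)
  simp only [slope1, T2, H2, two] at *
  linear_combination
      (2 * a * r + 2 * a * w01 + 2 * a * y00) * (- y11_ + y00_ - g + r) * hT1 + (y00_^2 - 2 *
      y00 * y00_ + y00^2 - a^2) * (w01 - w10 - g + r) * hT3 + (- y00_^2 + 2 * y00 * y00_ - y00^2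
      + a^2) * (- w01 + w01_ + a) * hH + (- a^2 * g + a^2 * r - a^2 * w10 + a^2 * w01 + a * g^2
      - 2 * a * g * r + a * g * w10 - a * g * w01 - a * g * y00_ + a * g * y11_ + a * r^2 - a *
      r * w10 + a * r * w01 - a * r * y00_ + a * r * y11_ - a * w10 * y00_ + a * w10 * y11_ - a
      * w01 * y00_ + a * w01 * y11_ - 2 * a * y00 * y00_ + 2 * a * y00 * y11_ - g^2 * y00 + g^2
      * y00_ - g * w10 * y00 + g * w10 * y00_ - g * w01 * y00 + g * w01 * y00_ - g * y00^2 + g *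
      y00 * y00_ - g * y00 * y11_ + g * y00_ * y11_ + r^2 * y00 - r^2 * y00_ + r * w10 * y00 - r
      * w10 * y00_ + r * w01 * y00 - r * w01 * y00_ + r * y00^2 - r * y00 * y00_ + r * y00 *
      y11_ - r * y00_ * y11_ + w10 * y00^2 - w10 * y00 * y00_ - w10 * y00 * y11_ + w10 * y00_ *
      y11_ - w01 * y00^2 + w01 * y00 * y00_ + w01 * y00 * y11_ - w01 * y00_ * y11_) * hT4

/-- The parameter `e` treats the cases `H1` with ε = 0 and ε = 1 together; the constant of the
`Q`-face is quadratic in `e`, as the certificate requires. -/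
theorem parallel_H1 (e : ℂ) {a b g w w1 w2 w12 y y1 y2 y12 : ℂ} (hb : b ≠ 0)
    (hQs : Q1 0 w w1 w2 w12 a b = 0) (hQ : Q1 (e * e) y y1 y2 y12 a b = 0)
    (h01 : T1 e w w1 y y1 a g = 0) (h02 : T1 e w w2 y y2 b g = 0)
    (hd : det2 (fun s t => T1 e w s y t a g) ≠ 0)
    (hs : slope1 (fun s => Q1 0 w w1 w2 s a b) ≠ 0) :
    T1 e w2 w12 y2 y12 a g = 0 := by
  have hg : 1 - e * w - e ≠ 0 := fun h0 => hd (by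
    simp only [det2, T1, H1, two]
    linear_combination (2 * a) * h0)
  have hf : 2 * b ≠ 0 := by simpa using hb
  refine (mul_eq_zero.1 ?_).resolve_left (mul_ne_zero (mul_ne_zero hf hg) hs)
  simp only [slope1, T1, Q1, H1, two] at *
  linear_combination
      (2 * b - 2 * b * e * w - 2 * b * e) * (- y12 + y2 + a * e) * hQs + (- w^2 + 2 * w * w2 -
      w2^2) * (w - w1) * hQ + (w^2 - 2 * w * w2 + w2^2) * (a * y - a * y2 + b * y2 - b * y12) *
      h01 + (a^2 * e * w^2 + a^2 * e * w * w1 - a^2 * e * w * w2 + 2 * a^2 * e * w - a^2 * e *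
      w1 * w2 - 2 * a^2 * e * w2 - 2 * a^2 * w + 2 * a^2 * w2 - a * b * e * w^2 + a * b * e * w
      * w1 - a * b * e * w * w2 - 2 * a * b * e * w + a * b * e * w1 * w2 + 2 * a * b * e * w1 +
      2 * a * b * w - 2 * a * b * w1 - a * w^2 * y + a * w^2 * y12 + a * w * w1 * y - a * w * w1
      * y12 + a * w * w2 * y - a * w * w2 * y12 - a * w1 * w2 * y + a * w1 * w2 * y12) * h02

theorem transport_H1 (e : ℂ) {a g r w10 w10_ w01 w01_ y00 y00_ y11 y11_ : ℂ} 
    (_hH : H1 e w01 y11 y00 w10 g r = 0) (hT1 : T1 e w10 w10_ y00 y00_ a g = 0)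
    (hT2 : T1 e w10 w10_ y11 y11_ a r = 0) (hT4 : T1 e w01 w01_ y00 y00_ a r = 0)
    (hd : det2 (fun s t => T1 e w10 s y00 t a g) ≠ 0)
    (hs : slope1 (fun s => T1 e w10 w10_ y11 s a r) ≠ 0) :
    T1 e w01 w01_ y11 y11_ a g = 0 := by
  have hg : 1 - e * w10 - e ≠ 0 := fun h0 => hd (by
    simp only [det2, T1, H1, two]
    linear_combination (2 * a) * h0)
  refine (mul_eq_zero.1 ?_).resolve_left (mul_ne_zero hg hs)
  simp only [slope1, T1, H1, two] at *
  linear_combination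
      (1 - e * w10 - e) * (w01 - w01_) * hT2 + (1 - e * w10 - e) * (w10 - w10_) * hT4 + (- 1 + e
      * w10 + e) * (w01 - w01_) * hT1

theorem translate_H1 (e : ℂ) {a g r w10 w10_ w01 w01_ y00 y00_ y11 y11_ : ℂ} (ha : a ≠ 0)
    (hH : H1 e w01 y11 y00 w10 g r = 0) (hT1 : T1 e w10 w10_ y00 y00_ a g = 0)
    (hT3 : T1 e w01 w01_ y11 y11_ a g = 0) (hT4 : T1 e w01 w01_ y00 y00_ a r = 0)
    (hd : det2 (fun s t => H1 e w01 t y00 s g r) ≠ 0)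
    (hs : slope1 (fun s => T1 e w10 s y00 y00_ a g) ≠ 0) :
    H1 e w01_ y11_ y00_ w10_ g r = 0 := by
  have hg : 2 * e * w01 + 2 * e - 2 ≠ 0 := fun h0 => hd (by
    simp only [det2, H1, two]
    linear_combination (g - r) * h0)
  have hf : a ≠ 0 := by simpa using ha
  refine (mul_eq_zero.1 ?_).resolve_left (mul_ne_zero (mul_ne_zero hf hg) hs)
  simp only [slope1, T1, H1, two] at *
  linear_combination
      (2 * a * e * w01 + 2 * a * e - 2 * a) * (- y11_ + y00_ - g * e + r * e) * hT1 + (- a^2 *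
      e^2 + y00_^2 - 2 * y00 * y00_ + y00^2) * (w01 - w10) * hT3 + (a^2 * e^2 - y00_^2 + 2 * y00
      * y00_ - y00^2) * (- w01 + w01_) * hH + (- a^2 * e^2 * w10 + a^2 * e^2 * w01 + a * g * e^2
      * w10 - a * g * e^2 * w01 - a * r * e^2 * w10 + a * r * e^2 * w01 - a * e * w10 * y00_ + a
      * e * w10 * y11_ - a * e * w01 * y00_ + a * e * w01 * y11_ - 2 * a * e * y00_ + 2 * a * e
      * y11_ + 2 * a * y00_ - 2 * a * y11_ - g * e * w10 * y00 + g * e * w10 * y00_ - g * e *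
      w01 * y00 + g * e * w01 * y00_ - 2 * g * e * y00 + 2 * g * e * y00_ + 2 * g * y00 - 2 * g
      * y00_ + r * e * w10 * y00 - r * e * w10 * y00_ + r * e * w01 * y00 - r * e * w01 * y00_ +
      2 * r * e * y00 - 2 * r * e * y00_ - 2 * r * y00 + 2 * r * y00_ + w10 * y00^2 - w10 * y00
      * y00_ - w10 * y00 * y11_ + w10 * y00_ * y11_ - w01 * y00^2 + w01 * y00 * y00_ + w01 * y00
      * y11_ - w01 * y00_ * y11_) * hT4
end Alg
end HexQuad

namespace HexQuad

/-! ### Families of consistent equations -/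

/-- The function is affine-linear. -/
def IsAffine (q : ℂ → ℂ) : Prop := ∀ s, q s = q 0 + s * slope1 q

theorem IsAffine.eq_zero_iff {q : ℂ → ℂ} (h : IsAffine q) (hs : slope1 q ≠ 0) {v : ℂ}
    (hv : q v = 0) (s : ℂ) : q s = 0 ↔ s = v := by
  refine ⟨fun e => ?_, fun e => e ▸ hv⟩
  rw [h] at e hv
  exact mul_right_cancel₀ hs (by linear_combination e - hv)

theorem IsAffine.root1 {q : ℂ → ℂ} (h : IsAffine q) (hs : slope1 q ≠ 0) : q (root1 q) = 0 := by
  rw [h, HexQuad.root1]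
  change q 0 + -q 0 * (slope1 q)⁻¹ * slope1 q = 0
  field_simp
  ring

/-- The equations of a family are consistent on the cubes with two types of vertices. -/
structure Fam.Good (F : Fam ℂ) : Prop where
  Q_swap x x₁ x₂ x₁₂ a b : F.Q x x₂ x₁ x₁₂ b a = -F.Q x x₁ x₂ x₁₂ a b
  Q_refl x x₁ x₂ x₁₂ a b : F.Q x₁ x x₁₂ x₂ a b = F.Q x x₁ x₂ x₁₂ a b
  Qs_swap x x₁ x₂ x₁₂ a b : F.Qs x x₂ x₁ x₁₂ b a = -F.Qs x x₁ x₂ x₁₂ a b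
  Qs_refl x x₁ x₂ x₁₂ a b : F.Qs x₁ x x₁₂ x₂ a b = F.Qs x x₁ x₂ x₁₂ a b
  H_symm x y z w a b : F.H w z y x a b = F.H x y z w a b
  aff_Q x y z a b : IsAffine fun s => F.Q x y z s a b
  aff_Qs x y z a b : IsAffine fun s => F.Qs x y z s a b
  aff_H₁ y z w a b : IsAffine fun s => F.H s y z w a b
  aff_H₂ x z w a b : IsAffine fun s => F.H x s z w a b
  aff_C₂ x xa xc xd a b g : IsAffine fun s => F.C x xa s xc xd a b g
  aff_C₃ x xa xb xd a b g : IsAffine fun s => F.C x xa xb s xd a b g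
  aff_C₄ x xa xb xc a b g : IsAffine fun s => F.C x xa xb xc s a b g
  aff_Cb₂ x xa xc xd a b g : IsAffine fun s => F.Cb x xa s xc xd a b g
  aff_Cb₃ x xa xb xd a b g : IsAffine fun s => F.Cb x xa xb s xd a b g
  aff_Cb₄ x xa xb xc a b g : IsAffine fun s => F.Cb x xa xb xc s a b g
  cube_Q {a b r x x₁ x₂ x₁₂ x₃ x₁₃ x₂₃ x₁₂₃} (ha : F.reg a ≠ 0) (hb : F.reg b ≠ 0)
    (hr : F.reg r ≠ 0)
    (h₁₂ : F.Q x x₁ x₂ x₁₂ a b = 0) (h₁₃ : F.Q x x₁ x₃ x₁₃ a r = 0)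
    (h₂₃ : F.Q x x₂ x₃ x₂₃ b r = 0) (h : F.Q x₂ x₁₂ x₂₃ x₁₂₃ a r = 0)
    (hd : det2 (fun s t => F.Q x x₂ s t b a) ≠ 0)
    (hs : slope1 (fun s => F.Q x x₁ x₃ s a r) ≠ 0) : F.Q x₁ x₁₂ x₁₃ x₁₂₃ b r = 0
  cube_Qs {a b r x x₁ x₂ x₁₂ x₃ x₁₃ x₂₃ x₁₂₃} (ha : F.reg a ≠ 0) (hb : F.reg b ≠ 0)
    (hr : F.reg r ≠ 0)
    (h₁₂ : F.Qs x x₁ x₂ x₁₂ a b = 0) (h₁₃ : F.Qs x x₁ x₃ x₁₃ a r = 0)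
    (h₂₃ : F.Qs x x₂ x₃ x₂₃ b r = 0) (h : F.Qs x₂ x₁₂ x₂₃ x₁₂₃ a r = 0)
    (hd : det2 (fun s t => F.Qs x x₂ s t b a) ≠ 0)
    (hs : slope1 (fun s => F.Qs x x₁ x₃ s a r) ≠ 0) : F.Qs x₁ x₁₂ x₁₃ x₁₂₃ b r = 0
  parallel {a b g w w₁ w₂ w₁₂ y y₁ y₂ y₁₂} (ha : F.reg a ≠ 0) (hb : F.reg b ≠ 0)
    (hg : F.reg g ≠ 0)
    (hQs : F.Qs w w₁ w₂ w₁₂ a b = 0) (hQ : F.Q y y₁ y₂ y₁₂ a b = 0)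
    (h₁ : F.T w w₁ y y₁ a g = 0) (h₂ : F.T w w₂ y y₂ b g = 0)
    (hd : det2 (fun s t => F.T w s y t a g) ≠ 0)
    (hs : slope1 (fun s => F.Qs w w₁ w₂ s a b) ≠ 0)
    (hs' : slope1 (fun s => F.Q y y₁ y₂ s a b) ≠ 0) :
    F.T w₂ w₁₂ y₂ y₁₂ a g = 0
  transport {a g r w₁₀ w₁₀' w₀₁ w₀₁' y₀₀ y₀₀' y₁₁ y₁₁'} (ha : F.reg a ≠ 0) (hg : F.reg g ≠ 0)
    (hr : F.reg r ≠ 0)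
    (hH : F.H w₀₁ y₁₁ y₀₀ w₁₀ g r = 0) (h₁ : F.T w₁₀ w₁₀' y₀₀ y₀₀' a g = 0)
    (h₂ : F.T w₁₀ w₁₀' y₁₁ y₁₁' a r = 0) (h₄ : F.T w₀₁ w₀₁' y₀₀ y₀₀' a r = 0)
    (hd : det2 (fun s t => F.T w₁₀ s y₀₀ t a g) ≠ 0)
    (hs : slope1 (fun s => F.T w₁₀ w₁₀' y₁₁ s a r) ≠ 0)
    (hs' : slope1 (fun s => F.T w₀₁ s y₀₀ y₀₀' a r) ≠ 0) :
    F.T w₀₁ w₀₁' y₁₁ y₁₁' a g = 0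
  translate {a g r w₁₀ w₁₀' w₀₁ w₀₁' y₀₀ y₀₀' y₁₁ y₁₁'} (ha : F.reg a ≠ 0) (hg : F.reg g ≠ 0)
    (hr : F.reg r ≠ 0)
    (hH : F.H w₀₁ y₁₁ y₀₀ w₁₀ g r = 0) (h₁ : F.T w₁₀ w₁₀' y₀₀ y₀₀' a g = 0)
    (h₂ : F.T w₁₀ w₁₀' y₁₁ y₁₁' a r = 0) (h₃ : F.T w₀₁ w₀₁' y₁₁ y₁₁' a g = 0)
    (h₄ : F.T w₀₁ w₀₁' y₀₀ y₀₀' a r = 0)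
    (hd : det2 (fun s t => F.H w₀₁ t y₀₀ s g r) ≠ 0)
    (hd' : det2 (fun s t => F.H t y₁₁ s w₁₀ g r) ≠ 0)
    (hs : slope1 (fun s => F.T w₁₀ s y₀₀ y₀₀' a g) ≠ 0)
    (hs' : slope1 (fun s => F.T w₁₀ w₁₀' y₀₀ s a g) ≠ 0) :
    F.H w₀₁' y₁₁' y₀₀' w₁₀' g r = 0
  C_of_Q {α β γ a b c d f n} (ha : F.reg α ≠ 0) (hb : F.reg β ≠ 0) (hg : F.reg γ ≠ 0)
    (hQ : F.Q b c n d α β = 0) (hT : F.T a f b n β γ = 0) : F.C b c d a f γ α β = 0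
  Cb_of_Qs {α β γ a b c e f n} (ha : F.reg α ≠ 0) (hb : F.reg β ≠ 0) (hg : F.reg γ ≠ 0)
    (hQ : F.Qs a n f e α β = 0) (hT : F.T a n b c α γ = 0) : F.Cb a f e b c γ β α = 0
  C_of_T {α β γ a b c d e n} (ha : F.reg α ≠ 0) (hb : F.reg β ≠ 0) (hg : F.reg γ ≠ 0)
    (h : F.T a n b c α γ = 0) (h' : F.T n e c d β γ = 0) :
    F.C c b d a e (F.sub γ α) (F.neg α) (F.sub β α) = 0
  Cb_of_T {α β γ a b d e f n} (ha : F.reg α ≠ 0) (hb : F.reg β ≠ 0) (hg : F.reg γ ≠ 0)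
    (h : F.T a f b n β γ = 0) (h' : F.T f e n d α γ = 0) :
    F.Cb f e a d b (F.sub γ α) (F.neg α) (F.sub β α) = 0

theorem det2_comm (q : ℂ → ℂ → ℂ) : det2 (fun s t => q t s) = det2 q := by
  simp only [det2]; ring

theorem slope1_neg (q : ℂ → ℂ) : slope1 (fun s => -q s) = -slope1 q := by
  simp only [slope1]; ring

namespace Fam.Good

variable {F : Fam ℂ} (hF : F.Good)

include hF in
theorem T_symm (w w' y y' a g : ℂ) : F.T w' w y' y a g = F.T w w' y y' a g := hF.H_symm ..

include hF in
theorem T_swap (w w' y y' a g : ℂ) : F.swap.T w w' y y' a g = F.T y y' w w' a g := by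
  exact hF.H_symm ..

include hF in
/-- The properties are symmetric in the two types of vertices. -/
theorem swap : F.swap.Good where
  Q_swap := hF.Qs_swap
  Q_refl := hF.Qs_refl
  Qs_swap := hF.Q_swap
  Qs_refl := hF.Q_refl
  H_symm _ _ _ _ := hF.H_symm _ _ _ _
  aff_Q := hF.aff_Qs
  aff_Qs := hF.aff_Q
  aff_H₁ y z w := hF.aff_H₂ y w z
  aff_H₂ x z w := hF.aff_H₁ x w z
  aff_C₂ := hF.aff_Cb₂
  aff_C₃ := hF.aff_Cb₃
  aff_C₄ := hF.aff_Cb₄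
  aff_Cb₂ := hF.aff_C₂
  aff_Cb₃ := hF.aff_C₃
  aff_Cb₄ := hF.aff_C₄
  cube_Q := hF.cube_Qs
  cube_Qs := hF.cube_Q
  parallel ha hb hg hQs hQ h₁ h₂ hd hs hs' := by
    simp only [hF.T_swap] at *
    rw [← det2_comm] at hd
    exact hF.parallel ha hb hg hQ hQs h₁ h₂ hd hs' hs
  transport ha hg hr hH h₁ h₂ h₄ hd hs hs' := by
    simp only [hF.T_swap] at *
    rw [← det2_comm] at hd
    -- Exchanging the types exchanges the ends of both `g`-edges of the base square, `y₀₀` with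
    -- `w₁₀` and `y₁₁` with `w₀₁`. This interchanges the two side faces over its `r`-edges, that is,
    -- `h₂` and `h₄`.
    refine hF.transport ha hg hr (?_ : F.H _ _ _ _ _ _ = 0) h₁ h₄ h₂ hd hs' hs
    exact hH
  translate ha hg hr hH h₁ h₂ h₃ h₄ hd hd' hs hs' := by
    simp only [hF.T_swap] at *
    refine hF.translate ha hg hr (?_ : F.H _ _ _ _ _ _ = 0) h₁ h₄ h₃ h₂ ?_ ?_ hs' hs
    · exact hH
    · exact hd'
    · exact hd
  C_of_Q ha hb hg hQ hT := by
    rw [hF.T_swap] at hT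
    refine hF.Cb_of_Qs hb ha hg ?_ hT
    rw [hF.Qs_swap]
    exact neg_eq_zero.2 hQ
  Cb_of_Qs ha hb hg hQ hT := by
    rw [hF.T_swap] at hT
    refine hF.C_of_Q hb ha hg ?_ hT
    rw [hF.Q_swap]
    exact neg_eq_zero.2 hQ
  C_of_T ha hb hg h h' := by
    rw [hF.T_swap, ← hF.T_symm] at h h'
    exact hF.Cb_of_T ha hb hg h' h
  Cb_of_T ha hb hg h h' := by
    rw [hF.T_swap, ← hF.T_symm] at h h'
    exact hF.C_of_T ha hb hg h' h

end Fam.Good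

end HexQuad

/-! ### Hyperbolic families: from the cleared polynomials back to the original ones. -/

namespace HexQuad
namespace Alg

theorem det2_mul (k : ℂ) (q : ℂ → ℂ → ℂ) : det2 (fun s t => k * q s t) = k ^ 2 * det2 q := by
  simp only [det2]; ring

theorem slope1_mul (k : ℂ) (q : ℂ → ℂ) : slope1 (fun s => k * q s) = k * slope1 q := by
  simp only [slope1]; ring

/-- Clearing denominators multiplies the equation by a factor that depends only on the parameters.
Zeros, and nonvanishing of `det2` and `slope1`, are therefore the same for both forms. -/
theorem Q3_eq {a b : ℂ} (ha : a ≠ 0) (hb : b ≠ 0) (d x y z w : ℂ) :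
    Q3 d x y z w a b = (8 * a ^ 2 * b ^ 2)⁻¹ * Q3h d x y z w a b := by
  simp only [Q3, Q3h, sinh, two]; field_simp; ring

theorem T3_eq {a g : ℂ} (ha : a ≠ 0) (hg : g ≠ 0) (d e x y z w : ℂ) :
    H3 d e x w z y (g * a⁻¹) g = (2 * a ^ 2)⁻¹ * T3h d e x y z w a g := by
  simp only [H3, T3h, sinh, two]; field_simp; ring

theorem H3_eq {a b : ℂ} (ha : a ≠ 0) (hb : b ≠ 0) (d e x y z w : ℂ) :
    H3 d e x y z w a b = (2 * a * b)⁻¹ * H3h d e x y z w a b := by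
  simp only [H3, H3h, sinh, two]; field_simp; ring

section

variable {a b g : ℂ} (ha : a ≠ 0) (hb : b ≠ 0) (hg : g ≠ 0) (d e x y z w : ℂ)

include ha hb in
theorem Q3_eq_zero : Q3 d x y z w a b = 0 ↔ Q3h d x y z w a b = 0 := by
  rw [Q3_eq ha hb]; simp [ha, hb]

include ha hg in
theorem T3_eq_zero : H3 d e x w z y (g * a⁻¹) g = 0 ↔ T3h d e x y z w a g = 0 := by
  rw [T3_eq ha hg]; simp [ha]

include ha hb in
theorem H3_eq_zero : H3 d e x y z w a b = 0 ↔ H3h d e x y z w a b = 0 := by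
  rw [H3_eq ha hb]; simp [ha, hb]

include ha hb in
theorem det2_Q3 : det2 (fun s t => Q3 d x y s t a b) ≠ 0 ↔
    det2 (fun s t => Q3h d x y s t a b) ≠ 0 := by
  simp only [Q3_eq ha hb]; rw [det2_mul]; simp [ha, hb]

include ha hb in
theorem slope1_Q3 : slope1 (fun s => Q3 d x y z s a b) ≠ 0 ↔
    slope1 (fun s => Q3h d x y z s a b) ≠ 0 := by
  simp only [Q3_eq ha hb]; rw [slope1_mul]; simp [ha, hb]

include ha hg in
theorem det2_T3 : det2 (fun s t => H3 d e x t z s (g * a⁻¹) g) ≠ 0 ↔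
    det2 (fun s t => T3h d e x s z t a g) ≠ 0 := by
  simp only [T3_eq ha hg]; rw [det2_mul]; simp [ha]

include ha hg in
theorem slope1_T3₂ : slope1 (fun s => H3 d e x w z s (g * a⁻¹) g) ≠ 0 ↔
    slope1 (fun s => T3h d e x s z w a g) ≠ 0 := by
  simp only [T3_eq ha hg]; rw [slope1_mul]; simp [ha]

include ha hg in
theorem slope1_T3₄ : slope1 (fun s => H3 d e x s z y (g * a⁻¹) g) ≠ 0 ↔
    slope1 (fun s => T3h d e x y z s a g) ≠ 0 := by
  simp only [T3_eq ha hg]; rw [slope1_mul]; simp [ha]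

include ha hb in
theorem det2_H3 : det2 (fun s t => H3 d e x t z s a b) ≠ 0 ↔
    det2 (fun s t => H3h d e x t z s a b) ≠ 0 := by
  simp only [H3_eq ha hb]; rw [det2_mul]; simp [ha, hb]

end

theorem isAffine_C3₂ (d₁ d₂ d₃ x xa xc xd a b g : ℂ) :
    IsAffine fun s => C3 d₁ d₂ d₃ x xa s xc xd a b g := by
  intro s; simp only [slope1, C3]; ring

theorem isAffine_C3₃ (d₁ d₂ d₃ x xa xc xd a b g : ℂ) :
    IsAffine fun s => C3 d₁ d₂ d₃ x xa xc s xd a b g := by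
  intro s; simp only [slope1, C3]; ring

theorem isAffine_C3₄ (d₁ d₂ d₃ x xa xc xd a b g : ℂ) :
    IsAffine fun s => C3 d₁ d₂ d₃ x xa xc xd s a b g := by
  intro s; simp only [slope1, C3]; ring

theorem isAffine_Q3 (d x y z a b : ℂ) : IsAffine fun s => Q3 d x y z s a b := by
  intro s; simp only [slope1, Q3]; ring

theorem isAffine_H3₁ (d e x y z a b : ℂ) : IsAffine fun s => H3 d e s x y z a b := by
  intro s; simp only [slope1, H3]; ring

theorem isAffine_H3₂ (d e x y z a b : ℂ) : IsAffine fun s => H3 d e x s y z a b := by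
  intro s; simp only [slope1, H3]; ring

theorem sinh_inv (a : ℂ) : sinh a⁻¹ = -sinh a := by
  simp only [sinh, inv_inv]; ring

theorem reg_hyp_ne {a : ℂ} (h : a * (a * a - 1) ≠ 0) : a ≠ 0 ∧ a ^ 2 - 1 ≠ 0 := by
  refine ⟨left_ne_zero_of_mul h, ?_⟩
  have := right_ne_zero_of_mul h
  rwa [pow_two]

/-- Everything except the four elimination hypotheses is uniform in the constants; only those
compare `C3` with the quad equations and fix the relation between δ₁, δ₂ and `d`, `e`. -/
theorem good_hyp {δ₁ δ₂ d e : ℂ}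
    (h₁ : ∀ {α β γ a b c d' f n : ℂ}, α ≠ 0 → β ≠ 0 → β ^ 2 - 1 ≠ 0 → γ ≠ 0 →
      Q3 (d * e) b c n d' α β = 0 → H3 d e a n b f (γ * β⁻¹) γ = 0 →
      C3 δ₁ δ₂ 0 b c d' a f γ α β = 0)
    (h₂ : ∀ {α β γ a b c e' f n : ℂ}, α ≠ 0 → β ≠ 0 → α ^ 2 - 1 ≠ 0 → γ ≠ 0 →
      Q3 0 a n f e' α β = 0 → H3 d e a c b n (γ * α⁻¹) γ = 0 →
      C3 δ₁ 0 δ₂ a f e' b c γ β α = 0)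
    (h₃ : ∀ {α β γ a b c d' e' n : ℂ}, α ≠ 0 → β ≠ 0 → γ ≠ 0 →
      H3 d e a c b n (γ * α⁻¹) γ = 0 → H3 d e n d' c e' (γ * β⁻¹) γ = 0 →
      C3 δ₁ δ₂ 0 c b d' a e' (γ * α⁻¹) α⁻¹ (β * α⁻¹) = 0)
    (h₄ : ∀ {α β γ a b d' e' f n : ℂ}, α ≠ 0 → β ≠ 0 → γ ≠ 0 →
      H3 d e a n b f (γ * β⁻¹) γ = 0 → H3 d e f d' n e' (γ * α⁻¹) γ = 0 →
      C3 δ₁ 0 δ₂ f e' a d' b (γ * α⁻¹) α⁻¹ (β * α⁻¹) = 0) :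
    (hyp δ₁ δ₂ d e (d * e) 0).Good where
  Q_swap x y z w a b := by
    simp only [hyp, Q3, show b * a⁻¹ = (a * b⁻¹)⁻¹ by simp, sinh_inv]; ring
  Q_refl x y z w a b := by simp only [hyp, Q3]; ring
  Qs_swap x y z w a b := by
    simp only [hyp, Q3, show b * a⁻¹ = (a * b⁻¹)⁻¹ by simp, sinh_inv]; ring
  Qs_refl x y z w a b := by simp only [hyp, Q3]; ring
  H_symm x y z w a b := by simp only [hyp, H3]; ring
  aff_Q := isAffine_Q3 _
  aff_Qs := isAffine_Q3 _
  aff_H₁ := isAffine_H3₁ _ _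
  aff_H₂ := isAffine_H3₂ _ _
  aff_C₂ := isAffine_C3₂ _ _ _
  aff_C₃ := isAffine_C3₃ _ _ _
  aff_C₄ := isAffine_C3₄ _ _ _
  aff_Cb₂ := isAffine_C3₂ _ _ _
  aff_Cb₃ := isAffine_C3₃ _ _ _
  aff_Cb₄ := isAffine_C3₄ _ _ _
  cube_Q ha hb hr h₁₂ h₁₃ h₂₃ h hd hs := by
    have ha := (reg_hyp_ne ha).1
    have hb := (reg_hyp_ne hb).1
    have hr := (reg_hyp_ne hr).1
    exact (Q3_eq_zero hb hr ..).2 (cube_Q3h _ ((Q3_eq_zero ha hb ..).1 h₁₂)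
      ((Q3_eq_zero ha hr ..).1 h₁₃) ((Q3_eq_zero hb hr ..).1 h₂₃) ((Q3_eq_zero ha hr ..).1 h)
      ((det2_Q3 hb ha ..).1 hd) ((slope1_Q3 ha hr ..).1 hs))
  cube_Qs ha hb hr h₁₂ h₁₃ h₂₃ h hd hs := by
    have ha := (reg_hyp_ne ha).1
    have hb := (reg_hyp_ne hb).1
    have hr := (reg_hyp_ne hr).1
    exact (Q3_eq_zero hb hr ..).2 (cube_Q3h _ ((Q3_eq_zero ha hb ..).1 h₁₂)
      ((Q3_eq_zero ha hr ..).1 h₁₃) ((Q3_eq_zero hb hr ..).1 h₂₃) ((Q3_eq_zero ha hr ..).1 h)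
      ((det2_Q3 hb ha ..).1 hd) ((slope1_Q3 ha hr ..).1 hs))
  parallel ha hb hg hQs hQ h₁ h₂ hd hs _ := by
    have ha := (reg_hyp_ne ha).1
    have hb1 := (reg_hyp_ne hb).2
    have hb := (reg_hyp_ne hb).1
    have hg := (reg_hyp_ne hg).1
    exact (T3_eq_zero ha hg ..).2 (parallel_H3 _ _ hb1 ((Q3_eq_zero ha hb ..).1 hQs)
      ((Q3_eq_zero ha hb ..).1 hQ) ((T3_eq_zero ha hg ..).1 h₁) ((T3_eq_zero hb hg ..).1 h₂)
      ((det2_T3 ha hg ..).1 hd) ((slope1_Q3 ha hb ..).1 hs))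
  transport ha hg hr hH h₁ h₂ h₄ hd hs _ := by
    have ha := (reg_hyp_ne ha).1
    have hg := (reg_hyp_ne hg).1
    have hr := (reg_hyp_ne hr).1
    exact (T3_eq_zero ha hg ..).2 (transport_H3 _ _ hr ((H3_eq_zero hg hr ..).1 hH)
      ((T3_eq_zero ha hg ..).1 h₁) ((T3_eq_zero ha hr ..).1 h₂) ((T3_eq_zero ha hr ..).1 h₄)
      ((det2_T3 ha hg ..).1 hd) ((slope1_T3₄ ha hr ..).1 hs))
  translate ha hg hr hH h₁ h₂ h₃ h₄ hd _ hs _ := by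
    have ha1 := (reg_hyp_ne ha).2
    have ha := (reg_hyp_ne ha).1
    have hg := (reg_hyp_ne hg).1
    have hr := (reg_hyp_ne hr).1
    exact (H3_eq_zero hg hr ..).2 (translate_H3 _ _ ha ha1 ((H3_eq_zero hg hr ..).1 hH)
      ((T3_eq_zero ha hg ..).1 h₁) ((T3_eq_zero ha hg ..).1 h₃) ((T3_eq_zero ha hr ..).1 h₄)
      ((det2_H3 hg hr ..).1 hd) ((slope1_T3₂ ha hg ..).1 hs))
  C_of_Q ha hb hg hQ hT :=
    h₁ (reg_hyp_ne ha).1 (reg_hyp_ne hb).1 (reg_hyp_ne hb).2 (reg_hyp_ne hg).1 hQ hT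
  Cb_of_Qs ha hb hg hQ hT :=
    h₂ (reg_hyp_ne ha).1 (reg_hyp_ne hb).1 (reg_hyp_ne ha).2 (reg_hyp_ne hg).1 hQ hT
  C_of_T ha hb hg h h' := h₃ (reg_hyp_ne ha).1 (reg_hyp_ne hb).1 (reg_hyp_ne hg).1 h h'
  Cb_of_T ha hb hg h h' := h₄ (reg_hyp_ne ha).1 (reg_hyp_ne hb).1 (reg_hyp_ne hg).1 h h'

end Alg
end HexQuad

/-! ### Face-centered polynomials as resultants of quad equations, for each family. -/

namespace HexQuad
namespace Alg

theorem good_hyp_half : (hyp (two⁻¹ : ℂ) two⁻¹ 1 1 1 0).Good := by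
  have h := @good_hyp two⁻¹ two⁻¹ 1 1 ?_ ?_ ?_ ?_
  · rwa [mul_one] at h
  · intro α β γ a b c d f n hα hβ hb hγ h h'
    -- Both face equations are affine in the value `n` at the removed vertex. Multiplying each by
    -- the coefficient of `n` in the other and subtracting eliminates `n`, and the resultant is `C3`
    -- up to the displayed factor of the parameters.
    linear_combination (norm := (simp only [slope1, C3, H3, Q3, sinh, two]; field_simp; ring))
      2 * β ^ 2 * γ⁻¹ * (β ^ 2 - 1)⁻¹ *
        (slope1 (fun n => Q3 (1 * 1) b c n d α β) * h'
          - slope1 (fun n => H3 1 1 a n b f (γ * β⁻¹) γ) * h)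
  · intro α β γ a b c e f n hα hβ ha hγ h h'
    linear_combination (norm := (simp only [slope1, C3, H3, Q3, sinh, two]; field_simp; ring))
      - 2 * α ^ 2 * γ⁻¹ * (α ^ 2 - 1)⁻¹ *
        (slope1 (fun n => Q3 0 a n f e α β) * h'
          - slope1 (fun n => H3 1 1 a c b n (γ * α⁻¹) γ) * h)
  · intro α β γ a b c d e n hα hβ hγ h h'
    linear_combination (norm := (simp only [slope1, C3, H3, sinh, two]; field_simp; ring))
      - β * (γ ^ 2)⁻¹ * (slope1 (fun n => H3 1 1 a c b n (γ * α⁻¹) γ) * h'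
          - slope1 (fun n => H3 1 1 n d c e (γ * β⁻¹) γ) * h)
  · intro α β γ a b d e f n hα hβ hγ h h'
    linear_combination (norm := (simp only [slope1, C3, H3, sinh, two]; field_simp; ring))
      β * (γ ^ 2)⁻¹ * (slope1 (fun n => H3 1 1 a n b f (γ * β⁻¹) γ) * h'
          - slope1 (fun n => H3 1 1 f d n e (γ * α⁻¹) γ) * h)

/-- With ε = 0 the constant of `H3` is d = 2δ, while δ₁ = δ. The values d = 2 and d = 0 give the
combinations of `C3_(1;0;0)` and `C3_(0;0;0)`. -/
theorem good_hyp_zero (d : ℂ) : (hyp (d / 2) 0 d 0 0 0).Good := by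
  have h := @good_hyp (d / 2) 0 d 0 ?_ ?_ ?_ ?_
  · rwa [mul_zero] at h
  · intro α β γ a b c k f n hα hβ hb hγ h h'
    linear_combination (norm := (simp only [slope1, C3, H3, Q3, sinh, two]; field_simp; ring))
      2 * β ^ 2 * γ⁻¹ * (β ^ 2 - 1)⁻¹ *
        (slope1 (fun n => Q3 (d * 0) b c n k α β) * h'
          - slope1 (fun n => H3 d 0 a n b f (γ * β⁻¹) γ) * h)
  · intro α β γ a b c e f n hα hβ ha hγ h h'
    linear_combination (norm := (simp only [slope1, C3, H3, Q3, sinh, two]; field_simp; ring))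
      - 2 * α ^ 2 * γ⁻¹ * (α ^ 2 - 1)⁻¹ *
        (slope1 (fun n => Q3 0 a n f e α β) * h'
          - slope1 (fun n => H3 d 0 a c b n (γ * α⁻¹) γ) * h)
  · intro α β γ a b c k e n hα hβ hγ h h'
    linear_combination (norm := (simp only [slope1, C3, H3, sinh, two]; field_simp; ring))
      - β * (γ ^ 2)⁻¹ * (slope1 (fun n => H3 d 0 a c b n (γ * α⁻¹) γ) * h'
          - slope1 (fun n => H3 d 0 n k c e (γ * β⁻¹) γ) * h)
  · intro α β γ a b k e f n hα hβ hγ h h'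
    linear_combination (norm := (simp only [slope1, C3, H3, sinh, two]; field_simp; ring))
      β * (γ ^ 2)⁻¹ * (slope1 (fun n => H3 d 0 a n b f (γ * β⁻¹) γ) * h'
          - slope1 (fun n => H3 d 0 f k n e (γ * α⁻¹) γ) * h)

theorem good_C2_110 : (rat (C2 1 1 0) (C2 1 0 1) (H2 1) Q2 (Q1 1) : Fam ℂ).Good where
  Q_swap _ _ _ _ _ _ := by simp only [rat, Q2, Q1]; ring
  Q_refl _ _ _ _ _ _ := by simp only [rat, Q2, Q1]; ring
  Qs_swap _ _ _ _ _ _ := by simp only [rat, Q1]; ring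
  Qs_refl _ _ _ _ _ _ := by simp only [rat, Q1]; ring
  H_symm _ _ _ _ _ _ := by simp only [rat, H2, two]; ring
  aff_Q _ _ _ _ _ _ := by simp only [rat, slope1, Q2, Q1]; ring
  aff_Qs _ _ _ _ _ _ := by simp only [rat, slope1, Q1]; ring
  aff_H₁ _ _ _ _ _ _ := by simp only [rat, slope1, H2, two]; ring
  aff_H₂ _ _ _ _ _ _ := by simp only [rat, slope1, H2, two]; ring
  aff_C₂ _ _ _ _ _ _ _ _ := by simp only [rat, slope1, C2, pow01, cst, two]; ring
  aff_C₃ _ _ _ _ _ _ _ _ := by simp only [rat, slope1, C2, pow01, cst, two]; ring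
  aff_C₄ _ _ _ _ _ _ _ _ := by simp only [rat, slope1, C2, pow01, cst, two]; ring
  aff_Cb₂ _ _ _ _ _ _ _ _ := by simp only [rat, slope1, C2, pow01, cst, two]; ring
  aff_Cb₃ _ _ _ _ _ _ _ _ := by simp only [rat, slope1, C2, pow01, cst, two]; ring
  aff_Cb₄ _ _ _ _ _ _ _ _ := by simp only [rat, slope1, C2, pow01, cst, two]; ring
  cube_Q _ _ _ h₁₂ h₁₃ h₂₃ h hd hs := cube_Q2 h₁₂ h₁₃ h₂₃ h hd hs
  cube_Qs _ _ _ h₁₂ h₁₃ h₂₃ h hd hs := cube_Q1 1 h₁₂ h₁₃ h₂₃ h hd hs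
  parallel _ hb _ hQs hQ h₁ h₂ hd hs _ := parallel_H2one hb hQs hQ h₁ h₂ hd hs
  transport _ _ _ hH h₁ h₂ h₄ hd hs _ := transport_H2one hH h₁ h₂ h₄ hd hs
  translate ha _ _ hH h₁ h₂ h₃ h₄ hd _ hs _ := translate_H2one ha hH h₁ h₃ h₄ hd hs
  -- The resultant of the two faces in `n` is -β times the face-centered polynomial, so β has to be
  -- divided out.
  C_of_Q {α β γ a b c d f n} _ hβ _ h h' := by
    replace hβ : β ≠ 0 := hβ
    linear_combination (norm := (simp only [rat, Fam.T, slope1, C2, H2, two, Q2, Q1, pow01, cst]; field_simp; ring))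
      -β⁻¹ * (slope1 (fun n => Q2 b c n d α β) * h' - slope1 (fun n => H2 1 a n b f (γ - β) γ) * h)
  Cb_of_Qs {α β γ a b c e f n} hα _ _ h h' := by
    replace hα : α ≠ 0 := hα
    linear_combination (norm := (simp only [rat, Fam.T, slope1, C2, H2, two, Q1, pow01, cst]; field_simp; ring))
      α⁻¹ * (slope1 (fun n => Q1 1 a n f e α β) * h' - slope1 (fun n => H2 1 a c b n (γ - α) γ) * h)
  -- For two trapezoidal faces the resultant equals the face-centered polynomial up to sign, without
  -- a factor depending on the parameters.
  C_of_T {α β γ a b c d e n} _ _ _ h h' := by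
    linear_combination (norm := (simp only [rat, Fam.T, slope1, C2, H2, two, pow01, cst]; ring))
      -1 * (slope1 (fun n => H2 1 a c b n (γ - α) γ) * h' - slope1 (fun n => H2 1 n d c e (γ - β) γ) * h)
  Cb_of_T {α β γ a b d e f n} _ _ _ h h' := by
    linear_combination (norm := (simp only [rat, Fam.T, slope1, C2, H2, two, pow01, cst]; ring))
      1 * (slope1 (fun n => H2 1 a n b f (γ - β) γ) * h' - slope1 (fun n => H2 1 f d n e (γ - α) γ) * h)

theorem good_C2_100 : (rat (C2 1 0 0) (C2 1 0 0) (H2 0) (Q1 1) (Q1 1) : Fam ℂ).Good where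
  Q_swap _ _ _ _ _ _ := by simp only [rat, Q1]; ring
  Q_refl _ _ _ _ _ _ := by simp only [rat, Q1]; ring
  Qs_swap _ _ _ _ _ _ := by simp only [rat, Q1]; ring
  Qs_refl _ _ _ _ _ _ := by simp only [rat, Q1]; ring
  H_symm _ _ _ _ _ _ := by simp only [rat, H2, two]; ring
  aff_Q _ _ _ _ _ _ := by simp only [rat, slope1, Q1]; ring
  aff_Qs _ _ _ _ _ _ := by simp only [rat, slope1, Q1]; ring
  aff_H₁ _ _ _ _ _ _ := by simp only [rat, slope1, H2, two]; ring
  aff_H₂ _ _ _ _ _ _ := by simp only [rat, slope1, H2, two]; ring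
  aff_C₂ _ _ _ _ _ _ _ _ := by simp only [rat, slope1, C2, pow01, cst, two]; ring
  aff_C₃ _ _ _ _ _ _ _ _ := by simp only [rat, slope1, C2, pow01, cst, two]; ring
  aff_C₄ _ _ _ _ _ _ _ _ := by simp only [rat, slope1, C2, pow01, cst, two]; ring
  aff_Cb₂ _ _ _ _ _ _ _ _ := by simp only [rat, slope1, C2, pow01, cst, two]; ring
  aff_Cb₃ _ _ _ _ _ _ _ _ := by simp only [rat, slope1, C2, pow01, cst, two]; ring
  aff_Cb₄ _ _ _ _ _ _ _ _ := by simp only [rat, slope1, C2, pow01, cst, two]; ring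
  cube_Q _ _ _ h₁₂ h₁₃ h₂₃ h hd hs := cube_Q1 1 h₁₂ h₁₃ h₂₃ h hd hs
  cube_Qs _ _ _ h₁₂ h₁₃ h₂₃ h hd hs := cube_Q1 1 h₁₂ h₁₃ h₂₃ h hd hs
  parallel _ hb _ hQs hQ h₁ h₂ hd hs _ := parallel_H2zero hb hQs hQ h₁ h₂ hd hs
  transport _ _ _ hH h₁ h₂ h₄ hd hs _ := transport_H2zero hH h₁ h₂ h₄ hd hs
  translate ha _ _ hH h₁ h₂ h₃ h₄ hd _ hs _ := translate_H2zero ha hH h₁ h₃ h₄ hd hs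
  C_of_Q {α β γ a b c d f n} _ hβ _ h h' := by
    replace hβ : β ≠ 0 := hβ
    linear_combination (norm := (simp only [rat, Fam.T, slope1, C2, H2, two, Q1, pow01, cst]; field_simp; ring))
      -β⁻¹ * (slope1 (fun n => Q1 1 b c n d α β) * h' - slope1 (fun n => H2 0 a n b f (γ - β) γ) * h)
  Cb_of_Qs {α β γ a b c e f n} hα _ _ h h' := by
    replace hα : α ≠ 0 := hα
    linear_combination (norm := (simp only [rat, Fam.T, slope1, C2, H2, two, Q1, pow01, cst]; field_simp; ring))
      α⁻¹ * (slope1 (fun n => Q1 1 a n f e α β) * h' - slope1 (fun n => H2 0 a c b n (γ - α) γ) * h)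
  C_of_T {α β γ a b c d e n} _ _ _ h h' := by
    linear_combination (norm := (simp only [rat, Fam.T, slope1, C2, H2, two, pow01, cst]; ring))
      -1 * (slope1 (fun n => H2 0 a c b n (γ - α) γ) * h' - slope1 (fun n => H2 0 n d c e (γ - β) γ) * h)
  Cb_of_T {α β γ a b d e f n} _ _ _ h h' := by
    linear_combination (norm := (simp only [rat, Fam.T, slope1, C2, H2, two, pow01, cst]; ring))
      1 * (slope1 (fun n => H2 0 a n b f (γ - β) γ) * h' - slope1 (fun n => H2 0 f d n e (γ - α) γ) * h)

theorem good_C1_1 : (rat (fun x xa xb xc xd _ b g => C1 1 x xa xb xc xd b g)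
    (C2 0 0 0) (H1 1) (Q1 1) (Q1 0) : Fam ℂ).Good where
  Q_swap _ _ _ _ _ _ := by simp only [rat, Q1]; ring
  Q_refl _ _ _ _ _ _ := by simp only [rat, Q1]; ring
  Qs_swap _ _ _ _ _ _ := by simp only [rat, Q1]; ring
  Qs_refl _ _ _ _ _ _ := by simp only [rat, Q1]; ring
  H_symm _ _ _ _ _ _ := by simp only [rat, H1, two]; ring
  aff_Q _ _ _ _ _ _ := by simp only [rat, slope1, Q1]; ring
  aff_Qs _ _ _ _ _ _ := by simp only [rat, slope1, Q1]; ring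
  aff_H₁ _ _ _ _ _ _ := by simp only [rat, slope1, H1, two]; ring
  aff_H₂ _ _ _ _ _ _ := by simp only [rat, slope1, H1, two]; ring
  aff_C₂ _ _ _ _ _ _ _ _ := by simp only [rat, slope1, C1, pow01, cst, two]; ring
  aff_C₃ _ _ _ _ _ _ _ _ := by simp only [rat, slope1, C1, pow01, cst, two]; ring
  aff_C₄ _ _ _ _ _ _ _ _ := by simp only [rat, slope1, C1, pow01, cst, two]; ring
  aff_Cb₂ _ _ _ _ _ _ _ _ := by simp only [rat, slope1, C2, C1, pow01, cst, two]; ring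
  aff_Cb₃ _ _ _ _ _ _ _ _ := by simp only [rat, slope1, C2, C1, pow01, cst, two]; ring
  aff_Cb₄ _ _ _ _ _ _ _ _ := by simp only [rat, slope1, C2, C1, pow01, cst, two]; ring
  cube_Q _ _ _ h₁₂ h₁₃ h₂₃ h hd hs := cube_Q1 1 h₁₂ h₁₃ h₂₃ h hd hs
  cube_Qs _ _ _ h₁₂ h₁₃ h₂₃ h hd hs := cube_Q1 0 h₁₂ h₁₃ h₂₃ h hd hs
  parallel _ hb _ hQs hQ h₁ h₂ hd hs _ := parallel_H1 1 hb hQs (by rwa [mul_one]) h₁ h₂ hd hs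
  transport _ _ _ hH h₁ h₂ h₄ hd hs _ := transport_H1 1 hH h₁ h₂ h₄ hd hs
  translate ha _ _ hH h₁ h₂ h₃ h₄ hd _ hs _ := translate_H1 1 ha hH h₁ h₃ h₄ hd hs
  C_of_Q {α β γ a b c d f n} _ hβ _ h h' := by
    replace hβ : β ≠ 0 := hβ
    linear_combination (norm := (simp only [rat, Fam.T, slope1, C1, H1, two, Q1, pow01, cst]; field_simp; ring))
      β⁻¹ * (slope1 (fun n => Q1 1 b c n d α β) * h' - slope1 (fun n => H1 1 a n b f (γ - β) γ) * h)
  Cb_of_Qs {α β γ a b c e f n} hα _ _ h h' := by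
    replace hα : α ≠ 0 := hα
    linear_combination (norm := (simp only [rat, Fam.T, slope1, C2, C1, H1, two, Q1, pow01, cst]; field_simp; ring))
      α⁻¹ * (slope1 (fun n => Q1 0 a n f e α β) * h' - slope1 (fun n => H1 1 a c b n (γ - α) γ) * h)
  C_of_T {α β γ a b c d e n} _ _ _ h h' := by
    linear_combination (norm := (simp only [rat, Fam.T, slope1, C1, H1, two, pow01, cst]; ring))
      1 * (slope1 (fun n => H1 1 a c b n (γ - α) γ) * h' - slope1 (fun n => H1 1 n d c e (γ - β) γ) * h)
  Cb_of_T {α β γ a b d e f n} _ _ _ h h' := by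
    linear_combination (norm := (simp only [rat, Fam.T, slope1, C2, C1, H1, two, pow01, cst]; ring))
      1 * (slope1 (fun n => H1 1 a n b f (γ - β) γ) * h' - slope1 (fun n => H1 1 f d n e (γ - α) γ) * h)

theorem good_C1_0 : (rat (fun x xa xb xc xd _ b g => C1 0 x xa xb xc xd b g)
    (fun x xa xb xc xd _ b g => C1 0 x xa xb xc xd b g) (H1 0) (Q1 0) (Q1 0) : Fam ℂ).Good where
  Q_swap _ _ _ _ _ _ := by simp only [rat, Q1]; ring
  Q_refl _ _ _ _ _ _ := by simp only [rat, Q1]; ring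
  Qs_swap _ _ _ _ _ _ := by simp only [rat, Q1]; ring
  Qs_refl _ _ _ _ _ _ := by simp only [rat, Q1]; ring
  H_symm _ _ _ _ _ _ := by simp only [rat, H1, two]; ring
  aff_Q _ _ _ _ _ _ := by simp only [rat, slope1, Q1]; ring
  aff_Qs _ _ _ _ _ _ := by simp only [rat, slope1, Q1]; ring
  aff_H₁ _ _ _ _ _ _ := by simp only [rat, slope1, H1, two]; ring
  aff_H₂ _ _ _ _ _ _ := by simp only [rat, slope1, H1, two]; ring
  aff_C₂ _ _ _ _ _ _ _ _ := by simp only [rat, slope1, C1, pow01, cst, two]; ring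
  aff_C₃ _ _ _ _ _ _ _ _ := by simp only [rat, slope1, C1, pow01, cst, two]; ring
  aff_C₄ _ _ _ _ _ _ _ _ := by simp only [rat, slope1, C1, pow01, cst, two]; ring
  aff_Cb₂ _ _ _ _ _ _ _ _ := by simp only [rat, slope1, C1, pow01, cst, two]; ring
  aff_Cb₃ _ _ _ _ _ _ _ _ := by simp only [rat, slope1, C1, pow01, cst, two]; ring
  aff_Cb₄ _ _ _ _ _ _ _ _ := by simp only [rat, slope1, C1, pow01, cst, two]; ring
  cube_Q _ _ _ h₁₂ h₁₃ h₂₃ h hd hs := cube_Q1 0 h₁₂ h₁₃ h₂₃ h hd hs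
  cube_Qs _ _ _ h₁₂ h₁₃ h₂₃ h hd hs := cube_Q1 0 h₁₂ h₁₃ h₂₃ h hd hs
  parallel _ hb _ hQs hQ h₁ h₂ hd hs _ := parallel_H1 0 hb hQs (by rwa [mul_zero]) h₁ h₂ hd hs
  transport _ _ _ hH h₁ h₂ h₄ hd hs _ := transport_H1 0 hH h₁ h₂ h₄ hd hs
  translate ha _ _ hH h₁ h₂ h₃ h₄ hd _ hs _ := translate_H1 0 ha hH h₁ h₃ h₄ hd hs
  C_of_Q {α β γ a b c d f n} _ hβ _ h h' := by
    replace hβ : β ≠ 0 := hβ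
    linear_combination (norm := (simp only [rat, Fam.T, slope1, C1, H1, two, Q1, pow01, cst]; field_simp; ring))
      β⁻¹ * (slope1 (fun n => Q1 0 b c n d α β) * h' - slope1 (fun n => H1 0 a n b f (γ - β) γ) * h)
  Cb_of_Qs {α β γ a b c e f n} hα _ _ h h' := by
    replace hα : α ≠ 0 := hα
    linear_combination (norm := (simp only [rat, Fam.T, slope1, C1, H1, two, Q1, pow01, cst]; field_simp; ring))
      -α⁻¹ * (slope1 (fun n => Q1 0 a n f e α β) * h' - slope1 (fun n => H1 0 a c b n (γ - α) γ) * h)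
  C_of_T {α β γ a b c d e n} _ _ _ h h' := by
    linear_combination (norm := (simp only [rat, Fam.T, slope1, C1, H1, two, pow01, cst]; ring))
      1 * (slope1 (fun n => H1 0 a c b n (γ - α) γ) * h' - slope1 (fun n => H1 0 n d c e (γ - β) γ) * h)
  Cb_of_T {α β γ a b d e f n} _ _ _ h h' := by
    linear_combination (norm := (simp only [rat, Fam.T, slope1, C1, H1, two, pow01, cst]; ring))
      -1 * (slope1 (fun n => H1 0 a n b f (γ - β) γ) * h' - slope1 (fun n => H1 0 f d n e (γ - α) γ) * h)

end Alg

open Alg in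
theorem Combination.good_fam (F : Combination) : (F.fam (K := ℂ)).Good := by
  cases F with
  | C3_half_half_0 => exact good_hyp_half
  | C3_half_0_half => exact good_hyp_half.swap
  | C3_1_0_0 =>
    have h := good_hyp_zero two
    rwa [show (two / 2 : ℂ) = 1 by norm_num [two]] at h
  | C3_0_0_0 =>
    have h := good_hyp_zero 0
    rwa [zero_div] at h
  | C2_1_1_0 => exact good_C2_110
  | C2_1_0_1 => exact good_C2_110.swap
  | C2_1_0_0 => exact good_C2_100
  | C1_1 => exact good_C1_1
  | C2_0_0_0 => exact good_C1_1.swap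
  | C1_0 => exact good_C1_0

end HexQuad

namespace HexQuad

/-! ### Consistency on larger pieces of the lattice -/

/-- The properties of a quad equation between vertices of the same type. -/
structure IsQuad (q : ℂ → ℂ → ℂ → ℂ → ℂ → ℂ → ℂ) (reg : ℂ → ℂ) : Prop where
  swap x x₁ x₂ x₁₂ a b : q x x₂ x₁ x₁₂ b a = -q x x₁ x₂ x₁₂ a b
  refl x x₁ x₂ x₁₂ a b : q x₁ x x₁₂ x₂ a b = q x x₁ x₂ x₁₂ a b
  aff x y z a b : IsAffine fun s => q x y z s a b
  cube {a b r x x₁ x₂ x₁₂ x₃ x₁₃ x₂₃ x₁₂₃} (ha : reg a ≠ 0) (hb : reg b ≠ 0)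
    (hr : reg r ≠ 0)
    (h₁₂ : q x x₁ x₂ x₁₂ a b = 0) (h₁₃ : q x x₁ x₃ x₁₃ a r = 0)
    (h₂₃ : q x x₂ x₃ x₂₃ b r = 0) (h : q x₂ x₁₂ x₂₃ x₁₂₃ a r = 0)
    (hd : det2 (fun s t => q x x₂ s t b a) ≠ 0)
    (hs : slope1 (fun s => q x x₁ x₃ s a r) ≠ 0) : q x₁ x₁₂ x₁₃ x₁₂₃ b r = 0

theorem Fam.Good.isQuad_Q {F : Fam ℂ} (hF : F.Good) : IsQuad F.Q F.reg :=
  ⟨hF.Q_swap, hF.Q_refl, hF.aff_Q, hF.cube_Q⟩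

theorem Fam.Good.isQuad_Qs {F : Fam ℂ} (hF : F.Good) : IsQuad F.Qs F.reg :=
  ⟨hF.Qs_swap, hF.Qs_refl, hF.aff_Qs, hF.cube_Qs⟩

namespace IsQuad

variable {q : ℂ → ℂ → ℂ → ℂ → ℂ → ℂ → ℂ} {reg : ℂ → ℂ} (hq : IsQuad q reg)

include hq

theorem refl₂ (x x₁ x₂ x₁₂ a b : ℂ) : q x₂ x₁₂ x x₁ a b = q x x₁ x₂ x₁₂ a b := by
  rw [hq.swap, hq.refl, hq.swap, neg_neg]

theorem swap_eq_zero {x x₁ x₂ x₁₂ a b : ℂ} (h : q x x₁ x₂ x₁₂ a b = 0) :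
    q x x₂ x₁ x₁₂ b a = 0 := by
  rw [hq.swap, h, neg_zero]

theorem slope1_swap {x x₁ x₂ a b : ℂ} (h : slope1 (fun s => q x x₁ x₂ s a b) ≠ 0) :
    slope1 (fun s => q x x₂ x₁ s b a) ≠ 0 := by
  simp only [hq.swap x x₁ x₂]
  rwa [slope1_neg, neg_ne_zero]

/-- Of the three faces at the vertex opposite to `x`, one is given and the other two result. The
second comes from the first by the symmetry of the cube that exchanges the directions `a` and `r`
and fixes the given face. -/
theorem cube₂ {a b r x x₁ x₂ x₁₂ x₃ x₁₃ x₂₃ x₁₂₃ : ℂ} (ha : reg a ≠ 0) (hb : reg b ≠ 0)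
    (hr : reg r ≠ 0)
    (h₁₂ : q x x₁ x₂ x₁₂ a b = 0) (h₁₃ : q x x₁ x₃ x₁₃ a r = 0)
    (h₂₃ : q x x₂ x₃ x₂₃ b r = 0) (h : q x₂ x₁₂ x₂₃ x₁₂₃ a r = 0)
    (hd : det2 (fun s t => q x x₂ s t b a) ≠ 0) (hd' : det2 (fun s t => q x x₂ s t b r) ≠ 0)
    (hs : slope1 (fun s => q x x₁ x₃ s a r) ≠ 0) :
    q x₁ x₁₂ x₁₃ x₁₂₃ b r = 0 ∧ q x₃ x₁₃ x₂₃ x₁₂₃ a b = 0 :=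
  ⟨hq.cube ha hb hr h₁₂ h₁₃ h₂₃ h hd hs,
    hq.swap_eq_zero (hq.cube hr hb ha (hq.swap_eq_zero h₂₃) (hq.swap_eq_zero h₁₃)
      (hq.swap_eq_zero h₁₂) (hq.swap_eq_zero h) hd' (hq.slope1_swap hs))⟩

end IsQuad

namespace Fam.Good

variable {F : Fam ℂ} (hF : F.Good)

include hF

/-- Both missing side faces at once: the second is the first with the directions `a` and `b`
exchanged. -/
theorem parallel₂ {a b g w w₁ w₂ w₁₂ y y₁ y₂ y₁₂ : ℂ} (ha : F.reg a ≠ 0) (hb : F.reg b ≠ 0)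
    (hg : F.reg g ≠ 0)
    (hQs : F.Qs w w₁ w₂ w₁₂ a b = 0) (hQ : F.Q y y₁ y₂ y₁₂ a b = 0)
    (hs : slope1 (fun s => F.Qs w w₁ w₂ s a b) ≠ 0)
    (hs' : slope1 (fun s => F.Q y y₁ y₂ s a b) ≠ 0)
    (h₁ : F.T w w₁ y y₁ a g = 0) (h₂ : F.T w w₂ y y₂ b g = 0)
    (hd : det2 (fun s t => F.T w s y t a g) ≠ 0) (hd' : det2 (fun s t => F.T w s y t b g) ≠ 0) :
    F.T w₂ w₁₂ y₂ y₁₂ a g = 0 ∧ F.T w₁ w₁₂ y₁ y₁₂ b g = 0 :=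
  ⟨hF.parallel ha hb hg hQs hQ h₁ h₂ hd hs hs',
    hF.parallel hb ha hg (hF.isQuad_Qs.swap_eq_zero hQs) (hF.isQuad_Q.swap_eq_zero hQ) h₂ h₁ hd'
      (hF.isQuad_Qs.slope1_swap hs) (hF.isQuad_Q.slope1_swap hs')⟩

theorem aff_T₂ (w y y' a g : ℂ) : IsAffine fun s => F.T w s y y' a g := by
  simp only [T, ← hF.H_symm w]
  exact hF.aff_H₁ _ _ _ _ _

theorem aff_T₄ (w w' y a g : ℂ) : IsAffine fun s => F.T w w' y s a g := hF.aff_H₂ _ _ _ _ _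

theorem aff_T₃ (w w' y' a g : ℂ) : IsAffine fun s => F.T w w' s y' a g := by
  simp only [← hF.T_symm w w']
  exact hF.aff_T₄ _ _ _ _ _

theorem aff_T₁ (w' y y' a g : ℂ) : IsAffine fun s => F.T s w' y y' a g := hF.aff_H₁ _ _ _ _ _

end Fam.Good

namespace Combination

variable (F : Combination)

/-- The hex equations are satisfied on a cube whose six quad equations are satisfied; `m` and `n`
are the values at the vertices of the cube which are not in the hexagon. -/
theorem hexHolds_of_faces {a b c d e f m n α β γ : ℂ}
    (hα : F.fam.reg (F.coord α) ≠ 0) (hβ : F.fam.reg (F.coord β) ≠ 0)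
    (hγ : F.fam.reg (F.coord γ) ≠ 0)
    (hQ : F.fam.Q b c n d (F.coord α) (F.coord β) = 0)
    (hQs : F.fam.Qs a m f e (F.coord α) (F.coord β) = 0)
    (h₁ : F.fam.T a m b c (F.coord α) (F.coord γ) = 0)
    (h₂ : F.fam.T a f b n (F.coord β) (F.coord γ) = 0)
    (h₃ : F.fam.T f e n d (F.coord α) (F.coord γ) = 0)
    (h₄ : F.fam.T m e c d (F.coord β) (F.coord γ) = 0) :
    F.HexHolds ![a, b, c, d, e, f] α β γ := by
  have hF := F.good_fam
  intro j
  fin_cases j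
  · exact (F.Cbar_eq ..).trans (hF.Cb_of_Qs hα hβ hγ hQs h₁)
  · exact (F.C_eq ..).trans (hF.C_of_Q hα hβ hγ hQ h₂)
  · refine (F.C_eq ..).trans ?_
    rw [coord_sub, coord_sub, coord_neg]
    exact hF.C_of_T hα hβ hγ h₁ h₄
  -- The reflection of the cube exchanging `a` with `e`, `b` with `d`, and α with β fixes `c`, `f`,
  -- `m`, `n`. It carries the equations centered at `b` and `a` to those centered at `d` and `e`.
  · refine (F.C_eq ..).trans (hF.C_of_Q hβ hα hγ (?_ : F.fam.Q d c n b _ _ = 0)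
      (?_ : F.fam.T e f d n _ _ = 0))
    · rw [hF.Q_refl, hF.Q_swap, hF.Q_refl, hQ, neg_zero]
    · rwa [hF.T_symm]
  · refine (F.Cbar_eq ..).trans (hF.Cb_of_Qs hβ hα hγ (?_ : F.fam.Qs e m f a _ _ = 0) ?_)
    · rw [hF.Qs_refl, hF.Qs_swap, hF.Qs_refl, hQs, neg_zero]
    · rwa [hF.T_symm]
  · refine (F.Cbar_eq ..).trans ?_
    rw [coord_sub, coord_sub, coord_neg]
    exact hF.Cb_of_T hα hβ hγ h₂ h₃

end Combination

end HexQuad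

/-! ### Solving a hex system for two neighbouring variables. -/

namespace HexQuad
namespace Combination

variable (F : Combination)

section

variable {F} {a b c d e f α β γ : ℂ} (h : F.HexHolds ![a, b, c, d, e, f] α β γ)

include h

/-- Each of the two equations that omit one of the unknowns is affine in the other. Once the system
is known to hold, unique solvability therefore amounts to two nonzero coefficients. The analogues
for the other five positions differ only in the places of the unknowns. -/
theorem hexDetermines_zero
    (h₀ : slope1 (fun s => F.fam.Cb e f s d c (F.coord γ) (F.coord α) (F.coord β)) ≠ 0)
    (h₁ : slope1 (fun s => F.fam.C d c s e f (F.coord γ) (F.coord β) (F.coord α)) ≠ 0) :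
    F.HexDetermines ![a, b, c, d, e, f] α β γ 0 := by
  simp only [← Cbar_eq, ← C_eq] at h₀ h₁
  refine ⟨fun s => ?_, fun s => ?_, h⟩
  · refine IsAffine.eq_zero_iff (q := fun s => F.Cbar e f s d c γ α β) ?_ h₀ (h 4) s
    simp only [Cbar_eq]
    exact F.good_fam.aff_Cb₂ _ _ _ _ _ _ _
  · refine IsAffine.eq_zero_iff (q := fun s => F.C d c s e f γ β α) ?_ h₁ (h 3) s
    simp only [C_eq]
    exact F.good_fam.aff_C₂ _ _ _ _ _ _ _

theorem hexDetermines_one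
    (h₀ : slope1 (fun s => F.fam.Cb f e a d s (F.fam.sub (F.coord γ) (F.coord α))
      (F.fam.neg (F.coord α)) (F.fam.sub (F.coord β) (F.coord α))) ≠ 0)
    (h₁ : slope1 (fun s => F.fam.Cb e f a d s (F.coord γ) (F.coord α) (F.coord β)) ≠ 0) :
    F.HexDetermines ![a, b, c, d, e, f] α β γ 1 := by
  simp only [← coord_sub, ← coord_neg, ← Cbar_eq] at h₀ h₁
  refine ⟨fun s => ?_, fun s => ?_, h⟩
  · refine IsAffine.eq_zero_iff (q := fun s => F.Cbar f e a d s (γ - α) (-α) (β - α)) ?_ h₀ (h 5) s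
    simp only [Cbar_eq]
    exact F.good_fam.aff_Cb₄ _ _ _ _ _ _ _
  · refine IsAffine.eq_zero_iff (q := fun s => F.Cbar e f a d s γ α β) ?_ h₁ (h 4) s
    simp only [Cbar_eq]
    exact F.good_fam.aff_Cb₄ _ _ _ _ _ _ _

theorem hexDetermines_two
    (h₀ : slope1 (fun s => F.fam.Cb a f e b s (F.coord γ) (F.coord β) (F.coord α)) ≠ 0)
    (h₁ : slope1 (fun s => F.fam.Cb f e a s b (F.fam.sub (F.coord γ) (F.coord α))
      (F.fam.neg (F.coord α)) (F.fam.sub (F.coord β) (F.coord α))) ≠ 0) :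
    F.HexDetermines ![a, b, c, d, e, f] α β γ 2 := by
  simp only [← coord_sub, ← coord_neg, ← Cbar_eq] at h₀ h₁
  refine ⟨fun s => ?_, fun s => ?_, h⟩
  · refine IsAffine.eq_zero_iff (q := fun s => F.Cbar a f e b s γ β α) ?_ h₀ (h 0) s
    simp only [Cbar_eq]
    exact F.good_fam.aff_Cb₄ _ _ _ _ _ _ _
  · refine IsAffine.eq_zero_iff (q := fun s => F.Cbar f e a s b (γ - α) (-α) (β - α)) ?_ h₁ (h 5) s
    simp only [Cbar_eq]
    exact F.good_fam.aff_Cb₃ _ _ _ _ _ _ _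

theorem hexDetermines_three
    (h₀ : slope1 (fun s => F.fam.C b c s a f (F.coord γ) (F.coord α) (F.coord β)) ≠ 0)
    (h₁ : slope1 (fun s => F.fam.Cb a f s b c (F.coord γ) (F.coord β) (F.coord α)) ≠ 0) :
    F.HexDetermines ![a, b, c, d, e, f] α β γ 3 := by
  simp only [← Cbar_eq, ← C_eq] at h₀ h₁
  refine ⟨fun s => ?_, fun s => ?_, h⟩
  · refine IsAffine.eq_zero_iff (q := fun s => F.C b c s a f γ α β) ?_ h₀ (h 1) s
    simp only [C_eq]
    exact F.good_fam.aff_C₂ _ _ _ _ _ _ _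
  · refine IsAffine.eq_zero_iff (q := fun s => F.Cbar a f s b c γ β α) ?_ h₁ (h 0) s
    simp only [Cbar_eq]
    exact F.good_fam.aff_Cb₂ _ _ _ _ _ _ _

theorem hexDetermines_four
    (h₀ : slope1 (fun s => F.fam.C c b d a s (F.fam.sub (F.coord γ) (F.coord α))
      (F.fam.neg (F.coord α)) (F.fam.sub (F.coord β) (F.coord α))) ≠ 0)
    (h₁ : slope1 (fun s => F.fam.C b c d a s (F.coord γ) (F.coord α) (F.coord β)) ≠ 0) :
    F.HexDetermines ![a, b, c, d, e, f] α β γ 4 := by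
  simp only [← coord_sub, ← coord_neg, ← C_eq] at h₀ h₁
  refine ⟨fun s => ?_, fun s => ?_, h⟩
  · refine IsAffine.eq_zero_iff (q := fun s => F.C c b d a s (γ - α) (-α) (β - α)) ?_ h₀ (h 2) s
    simp only [C_eq]
    exact F.good_fam.aff_C₄ _ _ _ _ _ _ _
  · refine IsAffine.eq_zero_iff (q := fun s => F.C b c d a s γ α β) ?_ h₁ (h 1) s
    simp only [C_eq]
    exact F.good_fam.aff_C₄ _ _ _ _ _ _ _

theorem hexDetermines_five
    (h₀ : slope1 (fun s => F.fam.C d c b e s (F.coord γ) (F.coord β) (F.coord α)) ≠ 0)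
    (h₁ : slope1 (fun s => F.fam.C c b d s e (F.fam.sub (F.coord γ) (F.coord α))
      (F.fam.neg (F.coord α)) (F.fam.sub (F.coord β) (F.coord α))) ≠ 0) :
    F.HexDetermines ![a, b, c, d, e, f] α β γ 5 := by
  simp only [← coord_sub, ← coord_neg, ← C_eq] at h₀ h₁
  refine ⟨fun s => ?_, fun s => ?_, h⟩
  · refine IsAffine.eq_zero_iff (q := fun s => F.C d c b e s γ β α) ?_ h₀ (h 3) s
    simp only [C_eq]
    exact F.good_fam.aff_C₄ _ _ _ _ _ _ _
  · refine IsAffine.eq_zero_iff (q := fun s => F.C c b d s e (γ - α) (-α) (β - α)) ?_ h₁ (h 2) s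
    simp only [C_eq]
    exact F.good_fam.aff_C₃ _ _ _ _ _ _ _

end

/-- The hex equation centered at the vertex `j` does not involve the vertex `j + 3`. -/
theorem hexC_congr {X Y : Fin 6 → ℂ} (α β γ : ℂ) (j : Fin 6) (h : ∀ k, k ≠ j + 3 → X k = Y k) :
    F.hexC X α β γ j = F.hexC Y α β γ j := by
  fin_cases j
  · simp [hexC, h 0 (by decide), h 1 (by decide), h 2 (by decide), h 4 (by decide), h 5 (by decide)]
  · simp [hexC, h 0 (by decide), h 1 (by decide), h 2 (by decide), h 3 (by decide), h 5 (by decide)]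
  · simp [hexC, h 0 (by decide), h 1 (by decide), h 2 (by decide), h 3 (by decide), h 4 (by decide)]
  · simp [hexC, h 1 (by decide), h 2 (by decide), h 3 (by decide), h 4 (by decide), h 5 (by decide)]
  · simp [hexC, h 0 (by decide), h 2 (by decide), h 3 (by decide), h 4 (by decide), h 5 (by decide)]
  · simp [hexC, h 0 (by decide), h 1 (by decide), h 3 (by decide), h 4 (by decide), h 5 (by decide)]

/-- The solution of a hex system is unique. -/
theorem HexDetermines.eq_of_hexHolds {F : Combination} {X Y : Fin 6 → ℂ} {α β γ : ℂ} {u : Fin 6}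
    (h : F.HexDetermines X α β γ u) (hY : F.HexHolds Y α β γ)
    (hXY : ∀ j, j ≠ u → j ≠ u + 1 → Y j = X j) : Y u = X u ∧ Y (u + 1) = X (u + 1) := by
  -- Modulo 6 the equation centered at u + 4 omits the vertex u + 1, and the one centered at u + 3
  -- omits u. Each can thus be compared for `X` and `Y` although the other unknown is not yet known
  -- to agree.
  refine ⟨(h.1 _).1 (Eq.trans (F.hexC_congr α β γ _ fun k hk => ?_) (hY (u + 4))),
    (h.2.1 _).1 (Eq.trans (F.hexC_congr α β γ _ fun k hk => ?_) (hY (u + 3)))⟩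
  · rw [Function.update_apply]
    split_ifs with hu
    · rw [hu]
    · refine (hXY k hu fun h1 => hk ?_).symm
      rw [h1, add_assoc]; rfl
  · rw [Function.update_apply]
    split_ifs with hu
    · rw [hu]
    · refine (hXY k (fun h1 => hk ?_) hu).symm
      rw [h1, add_assoc]; exact (add_zero u).symm

end Combination

end HexQuad

namespace HexQuad

/-! ### The first arrangement -/

/-- `v` is the only zero of the affine-linear function `q`. -/
def Solves (q : ℂ → ℂ) (v : ℂ) : Prop := slope1 q ≠ 0 ∧ q v = 0

theorem Solves.determines {q : ℂ → ℂ} {v : ℂ} (h : Solves q v) (hq : IsAffine q) :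
    Determines q v := hq.eq_zero_iff h.1 h.2

/-- On the dodecahedron the unknown stands in the second place; reflecting the square moves it to
the last, where it stands within a layer. -/
theorem Combination.determines_Q (F : Combination) {x y z v α β : ℂ}
    (h : Solves (fun t => F.fam.Q x y z t (F.coord α) (F.coord β)) v) :
    Determines (fun t => F.Q z t x y α β) v := by
  simp only [F.Q_eq, F.good_fam.isQuad_Q.refl₂]
  exact h.determines (F.good_fam.isQuad_Q.aff _ _ _ _ _)

theorem Combination.determines_Qstar (F : Combination) {x y z v α β : ℂ}
    (h : Solves (fun t => F.fam.Qs x y z t (F.coord α) (F.coord β)) v) :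
    Determines (fun t => F.Qstar z t x y α β) v := by
  simp only [F.Qstar_eq, F.good_fam.isQuad_Qs.refl₂]
  exact h.determines (F.good_fam.isQuad_Qs.aff _ _ _ _ _)

/-- Values at the vertices of a four-dimensional cube with edges in the directions `a`, `b`, `r`,
`s`, without the vertex `ar`. -/
structure Layer (K : Type*) where
  (o a b r s ab as bs br rs abr abs ars brs abrs : K)

namespace Layer

section

variable {K : Type*} [Zero K] [One K] [Add K] [Sub K] [Mul K] [Neg K] [Inv K]

/-- The values are obtained successively from those at `o`, `a`, `b`, `r`, `s` by means of a quad
equation; `S q v` says that `v` is the solution of `q = 0`. -/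
def Eqs (S : (K → K) → K → Prop) (q : K → K → K → K → K → K → K) (a b r s : K) (L : Layer K) :
    Prop :=
  S (fun t => q L.o L.a L.b t a b) L.ab ∧
  S (fun t => q L.o L.a L.s t a s) L.as ∧
  S (fun t => q L.o L.b L.s t b s) L.bs ∧
  S (fun t => q L.o L.b L.r t b r) L.br ∧
  S (fun t => q L.o L.r L.s t r s) L.rs ∧
  S (fun t => q L.b L.ab L.br t a r) L.abr ∧
  S (fun t => q L.a L.ab L.as t b s) L.abs ∧
  S (fun t => q L.s L.as L.rs t a r) L.ars ∧
  S (fun t => q L.s L.bs L.rs t b r) L.brs ∧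
  S (fun t => q L.as L.abs L.ars t b r) L.abrs

/-- The conditions which ensure the consistency of the quad equations; `N` means nonzero. -/
def Cond (N : K → Prop) (q : K → K → K → K → K → K → K) (a b r s : K) (L : Layer K) : Prop :=
  N (det2 fun u t => q L.o L.a u t a b) ∧
  N (det2 fun u t => q L.o L.a u t a s) ∧
  N (det2 fun u t => q L.o L.s u t s b) ∧
  N (det2 fun u t => q L.o L.s u t s r) ∧
  N (det2 fun u t => q L.s L.as u t a b) ∧
  N (det2 fun u t => q L.s L.as u t a r) ∧
  N (det2 fun u t => q L.b L.bs u t s a) ∧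
  N (det2 fun u t => q L.b L.bs u t s r) ∧
  N (slope1 fun t => q L.r L.br L.rs t b s) ∧
  N (slope1 fun t => q L.br L.abr L.brs t a s) ∧
  N (slope1 fun t => q L.ab L.abr L.abs t r s) ∧
  N (slope1 fun t => q L.rs L.ars L.brs t a b)

end

/-- The quad equation holds on certain faces, and determines the last one of the values there. -/
structure Faces (q : ℂ → ℂ → ℂ → ℂ → ℂ → ℂ → ℂ) (a b r s : ℂ) (L : Layer ℂ) : Prop where
  o_ab : Solves (fun t => q L.o L.a L.b t a b) L.ab
  o_as : Solves (fun t => q L.o L.a L.s t a s) L.as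
  o_br : Solves (fun t => q L.o L.b L.r t b r) L.br
  o_rs : Solves (fun t => q L.o L.r L.s t r s) L.rs
  b_ar : Solves (fun t => q L.b L.ab L.br t a r) L.abr
  a_bs : Solves (fun t => q L.a L.ab L.as t b s) L.abs
  s_ar : Solves (fun t => q L.s L.as L.rs t a r) L.ars
  as_br : Solves (fun t => q L.as L.abs L.ars t b r) L.abrs
  r_bs : Solves (fun t => q L.r L.br L.rs t b s) L.brs
  br_as : Solves (fun t => q L.br L.abr L.brs t a s) L.abrs
  ab_rs : Solves (fun t => q L.ab L.abr L.abs t r s) L.abrs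
  rs_ab : Solves (fun t => q L.rs L.ars L.brs t a b) L.abrs

/-- Four of the eight 3-cubes of the tesseract suffice, none of them containing the omitted vertex
`ar`. They show that the value `abrs`, defined by a single face, also fits the other faces on which
it is needed. -/
theorem Eqs.faces {q : ℂ → ℂ → ℂ → ℂ → ℂ → ℂ → ℂ} {reg : ℂ → ℂ} (hq : IsQuad q reg)
    {a b r s : ℂ} (ha : reg a ≠ 0) (hb : reg b ≠ 0) (hr : reg r ≠ 0) (hs : reg s ≠ 0)
    {L : Layer ℂ} (h : L.Eqs Solves q a b r s) (hc : L.Cond (· ≠ 0) q a b r s) :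
    L.Faces q a b r s := by
  obtain ⟨o_ab, o_as, o_bs, o_br, o_rs, b_ar, a_bs, s_ar, s_br, as_br⟩ := h
  obtain ⟨d₁, d₂, d₃, d₄, d₅, d₆, d₇, d₈, e₁, e₂, e₃, e₄⟩ := hc
  -- The cubes are, in turn, those at `o` with directions `a`, `b`, `s`, at `o` with `b`, `r`, `s`,
  -- at `s` with `a`, `b`, `r`, and at `b` with `a`, `r`, `s`. The last two use faces produced by
  -- the earlier ones. A name such as `b_as` means the face at `b` in the directions `a`, `s`.
  obtain ⟨b_as, s_ba⟩ := hq.cube₂ hb ha hs (hq.swap_eq_zero o_ab.2) o_bs.2 o_as.2 a_bs.2 d₁ d₂ o_bs.1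
  obtain ⟨b_sr, r_bs⟩ := hq.cube₂ hb hs hr o_bs.2 o_br.2 (hq.swap_eq_zero o_rs.2) s_br.2 d₃ d₄ o_br.1
  obtain ⟨bs_ar, rs_ba⟩ := hq.cube₂ hb ha hr s_ba s_br.2 s_ar.2 as_br.2 d₅ d₆ s_br.1
  obtain ⟨ab_sr, br_as⟩ := hq.cube₂ ha hs hr b_as b_ar.2 b_sr bs_ar d₇ d₈ b_ar.1
  exact ⟨o_ab, o_as, o_br, o_rs, b_ar, a_bs, s_ar, as_br, ⟨e₁, r_bs⟩, ⟨e₂, br_as⟩,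
    ⟨e₃, hq.swap_eq_zero ab_sr⟩, ⟨e₄, hq.swap_eq_zero rs_ba⟩⟩

end Layer

namespace Fig1

section

variable {K : Type*} [Zero K] [One K] [Add K] [Sub K] [Mul K] [Neg K] [Inv K]

/-- The equations for the values which are neither initial values nor obtained within a layer. -/
def Link (S : (K → K) → K → Prop) (F : Fam K) (a b g r s : K) (B W : Layer K) : Prop :=
  S (fun t => F.T W.o t B.o B.a a g) W.a ∧
  S (fun t => F.T W.o t B.o B.s s g) W.s ∧
  S (fun t => F.T W.o W.b B.o t b g) B.b ∧
  S (fun t => F.T W.o W.r B.o t r g) B.r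

/-- The determinants are the hypotheses of `parallel₂` on the cubes between the layers; the last
eight coefficients make the four hex systems uniquely solvable. -/
def Cond (N : K → Prop) (F : Fam K) (a b g r s : K) (B W : Layer K) : Prop :=
  N (det2 fun u t => F.T W.o u B.o t a g) ∧
  N (det2 fun u t => F.T W.o u B.o t b g) ∧
  N (det2 fun u t => F.T W.o u B.o t r g) ∧
  N (det2 fun u t => F.T W.o u B.o t s g) ∧
  N (det2 fun u t => F.T W.a u B.a t b g) ∧
  N (det2 fun u t => F.T W.a u B.a t s g) ∧
  N (det2 fun u t => F.T W.b u B.b t a g) ∧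
  N (det2 fun u t => F.T W.b u B.b t r g) ∧
  N (det2 fun u t => F.T W.r u B.r t b g) ∧
  N (det2 fun u t => F.T W.r u B.r t s g) ∧
  N (det2 fun u t => F.T W.s u B.s t a g) ∧
  N (det2 fun u t => F.T W.s u B.s t r g) ∧
  N (det2 fun u t => F.T W.as u B.as t b g) ∧
  N (det2 fun u t => F.T W.as u B.as t r g) ∧
  N (det2 fun u t => F.T W.rs u B.rs t a g) ∧
  N (det2 fun u t => F.T W.rs u B.rs t b g) ∧
  N (det2 fun u t => F.T W.ab u B.ab t r g) ∧
  N (det2 fun u t => F.T W.ab u B.ab t s g) ∧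
  N (slope1 fun t => F.C B.o B.a t W.o W.b g a b) ∧
  N (slope1 fun t => F.Cb W.o W.b t B.o B.a g b a) ∧
  N (slope1 fun t => F.Cb W.o W.r t B.o B.s g r s) ∧
  N (slope1 fun t => F.C B.o B.s t W.o W.r g s r) ∧
  N (slope1 fun t => F.C B.rs B.ars t W.rs W.brs g a b) ∧
  N (slope1 fun t => F.Cb W.rs W.brs t B.rs B.ars g b a) ∧
  N (slope1 fun t => F.Cb W.ab W.abr t B.ab B.abs g r s) ∧
  N (slope1 fun t => F.C B.ab B.abs t W.ab W.abr g s r)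

end

variable (F : Combination)

/-- The labelling by the values on two layers. -/
def labelling (B W : Layer ℂ) : Labelling where
  xa := W.o
  xb := B.o
  xc := B.a
  xd := B.ab
  xe := W.ab
  xf := W.b
  ya := W.rs
  yb := B.rs
  yc := B.ars
  yd := B.abrs
  ye := W.abrs
  yf := W.brs
  za := W.r
  zb := B.s
  zc := B.as
  zd := B.abs
  ze := W.abr
  zf := W.br

theorem equations_of_steps {t : Params} {v : Labelling} (h : Steps F t v) : Equations F t v := by
  obtain ⟨h₁, h₂, h₃, h₄, h₅, h₆, h₇, h₈, h₉, h₁₀, h₁₁, h₁₂⟩ := h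
  exact ⟨h₁.2.2, h₂.2.2, h₉.2.2, h₁₀.2.2, (h₃ _).2 rfl, (h₄ _).2 rfl, (h₅ _).2 rfl, (h₆ _).2 rfl,
    (h₇ _).2 rfl, (h₈ _).2 rfl, (h₁₁ _).2 rfl, (h₁₂ _).2 rfl⟩

/-- Uniqueness follows the order of the steps: once the earlier variables of `w` agree with those of
`v`, the next equation of `w` is one whose only solution is the value in `v`. For the last two
variables the quad equations alone suffice. -/
theorem eq_of_steps {t : Params} {v w : Labelling} (h : Steps F t v) (hw : Equations F t w)
    (hi : initial w = initial v) : w = v := by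
  obtain ⟨h₁, h₂, h₃, h₄, h₅, h₆, h₇, h₈, -, -, h₁₁, h₁₂⟩ := h
  obtain ⟨e₁, e₂, -, -, e₃, e₄, e₅, e₆, e₇, e₈, e₁₁, e₁₂⟩ := hw
  have xa : w.xa = v.xa := congr_fun hi 0
  have xb : w.xb = v.xb := congr_fun hi 1
  have xc : w.xc = v.xc := congr_fun hi 2
  have xf : w.xf = v.xf := congr_fun hi 3
  have za : w.za = v.za := congr_fun hi 4
  have zb : w.zb = v.zb := congr_fun hi 5
  obtain ⟨xd, xe⟩ : w.xd = v.xd ∧ w.xe = v.xe := h₁.eq_of_hexHolds e₁ fun j => by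
    fin_cases j <;> simp [*]
  obtain ⟨ya, yb⟩ : w.ya = v.ya ∧ w.yb = v.yb := h₂.eq_of_hexHolds e₂ fun j => by
    fin_cases j <;> simp [*]
  simp only [xa, xb, xc, xf, za, zb, xd, xe, ya, yb] at e₃ e₄ e₅ e₆ e₇ e₈ e₁₁ e₁₂
  have zc := (h₃ _).1 e₃
  have zf := (h₄ _).1 e₄
  rw [zc] at e₅ e₇ e₁₁
  rw [zf] at e₆ e₈ e₁₂
  have zd := (h₅ _).1 e₅
  have ze := (h₆ _).1 e₆
  have yc := (h₇ _).1 e₇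
  have yf := (h₈ _).1 e₈
  rw [zd, yc] at e₁₁
  rw [ze, yf] at e₁₂
  exact Labelling.ext xa xb xc xd xe xf ya yb yc ((h₁₁ _).1 e₁₁) ((h₁₂ _).1 e₁₂) yf za zb zc zd ze zf

/-- Two parallel layers, `B` with `Q` and `W` with `Qs`, are joined by edges carrying γ. The
trapezoidal equations start over the four edges at `o` and spread by `parallel₂` over the faces of
the layers. The four hexagons then lie in the cubes over the faces `o_ab`, `o_rs`, `rs_ab`, `ab_rs`.
-/
theorem consistent (t : Params) {B W : Layer ℂ} (hreg : ∀ i, F.fam.reg (F.coord (t i)) ≠ 0)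
    (hB : B.Faces F.fam.Q (F.coord (t 0)) (F.coord (t 1)) (F.coord (t 3)) (F.coord (t 4)))
    (hW : W.Faces F.fam.Qs (F.coord (t 0)) (F.coord (t 1)) (F.coord (t 3)) (F.coord (t 4)))
    (hL : Link Solves F.fam (F.coord (t 0)) (F.coord (t 1)) (F.coord (t 2)) (F.coord (t 3))
      (F.coord (t 4)) B W)
    (hc : Cond (· ≠ 0) F.fam (F.coord (t 0)) (F.coord (t 1)) (F.coord (t 2)) (F.coord (t 3))
      (F.coord (t 4)) B W) :
    Consistent initial (Equations F t) (Steps F t) ![W.o, B.o, B.a, W.b, W.r, B.s] := by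
  have hF := F.good_fam
  have hQ := hF.isQuad_Q
  have hQs := hF.isQuad_Qs
  have ha := hreg 0
  have hb := hreg 1
  have hg := hreg 2
  have hr := hreg 3
  have hs := hreg 4
  obtain ⟨o_a, o_s, o_b, o_r⟩ := hL
  replace o_a := o_a.2
  replace o_s := o_s.2
  replace o_b := o_b.2
  replace o_r := o_r.2
  obtain ⟨d₁, d₂, d₃, d₄, d₅, d₆, d₇, d₈, d₉, d₁₀, d₁₁, d₁₂, d₁₃, d₁₄, d₁₅, d₁₆, d₁₇, d₁₈,
    k₁, k₂, k₃, k₄, k₅, k₆, k₇, k₈⟩ := hc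
  -- Here `b_a` is the trapezoidal equation over the edge that starts at the vertex `b` in the
  -- direction `a`, and similarly for the other names.
  obtain ⟨b_a, a_b⟩ := hF.parallel₂ ha hb hg hW.o_ab.2 hB.o_ab.2 hW.o_ab.1 hB.o_ab.1 o_a o_b d₁ d₂
  obtain ⟨s_a, a_s⟩ := hF.parallel₂ ha hs hg hW.o_as.2 hB.o_as.2 hW.o_as.1 hB.o_as.1 o_a o_s d₁ d₄
  obtain ⟨r_b, b_r⟩ := hF.parallel₂ hb hr hg hW.o_br.2 hB.o_br.2 hW.o_br.1 hB.o_br.1 o_b o_r d₂ d₃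
  obtain ⟨s_r, r_s⟩ := hF.parallel₂ hr hs hg hW.o_rs.2 hB.o_rs.2 hW.o_rs.1 hB.o_rs.1 o_r o_s d₃ d₄
  obtain ⟨as_b, ab_s⟩ := hF.parallel₂ hb hs hg hW.a_bs.2 hB.a_bs.2 hW.a_bs.1 hB.a_bs.1 a_b a_s d₅ d₆
  obtain ⟨br_a, ab_r⟩ := hF.parallel₂ ha hr hg hW.b_ar.2 hB.b_ar.2 hW.b_ar.1 hB.b_ar.1 b_a b_r d₇ d₈
  obtain ⟨rs_b, br_s⟩ :=
    hF.parallel₂ hb hs hg hW.r_bs.2 hB.r_bs.2 hW.r_bs.1 hB.r_bs.1 r_b r_s d₉ d₁₀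
  obtain ⟨rs_a, as_r⟩ :=
    hF.parallel₂ ha hr hg hW.s_ar.2 hB.s_ar.2 hW.s_ar.1 hB.s_ar.1 s_a s_r d₁₁ d₁₂
  obtain ⟨ars_b, abs_r⟩ :=
    hF.parallel₂ hb hr hg hW.as_br.2 hB.as_br.2 hW.as_br.1 hB.as_br.1 as_b as_r d₁₃ d₁₄
  obtain ⟨brs_a, -⟩ :=
    hF.parallel₂ ha hb hg hW.rs_ab.2 hB.rs_ab.2 hW.rs_ab.1 hB.rs_ab.1 rs_a rs_b d₁₅ d₁₆
  obtain ⟨-, abr_s⟩ :=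
    hF.parallel₂ hr hs hg hW.ab_rs.2 hB.ab_rs.2 hW.ab_rs.1 hB.ab_rs.1 ab_r ab_s d₁₇ d₁₈
  have rev {w w' y y' a g : ℂ} (h : F.fam.T w w' y y' a g = 0) : F.fam.T w' w y' y a g = 0 := by
    rwa [hF.T_symm]
  have step : Steps F t (labelling B W) := by
    refine ⟨?_, ?_, ?_, ?_, ?_, ?_, ?_, ?_, ?_, ?_, ?_, ?_⟩
    · exact Combination.hexDetermines_three (F.hexHolds_of_faces ha hb hg hB.o_ab.2 hW.o_ab.2
        o_a o_b b_a a_b) k₁ k₂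
    -- This hexagon begins at the vertices `rs`, so the cube at `o` is viewed from its opposite
    -- corner: all its faces are reflected, and the vertices off the hexagon are `B.r` and `W.s`.
    · refine Combination.hexDetermines_zero (F.hexHolds_of_faces hr hs hg (n := B.r) (m := W.s)
        ?_ ?_ (rev s_r) (rev r_s) (rev o_r) (rev o_s)) k₃ k₄
      · rw [hQ.refl, hQ.refl₂]
        exact hB.o_rs.2
      · rw [hQs.refl, hQs.refl₂]
        exact hW.o_rs.2
    · exact F.determines_Q hB.o_as
    · exact F.determines_Qstar hW.o_br
    · exact F.determines_Q hB.a_bs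
    · exact F.determines_Qstar hW.b_ar
    · exact F.determines_Q hB.s_ar
    · exact F.determines_Qstar hW.r_bs
    · exact Combination.hexDetermines_three (F.hexHolds_of_faces ha hb hg hB.rs_ab.2 hW.rs_ab.2
        rs_a rs_b brs_a ars_b) k₅ k₆
    · refine Combination.hexDetermines_zero (F.hexHolds_of_faces hr hs hg (n := B.abr) (m := W.abs)
        ?_ ?_ (rev abs_r) (rev abr_s) (rev ab_r) (rev ab_s)) k₇ k₈
      · rw [hQ.refl, hQ.refl₂]
        exact hB.ab_rs.2
      · rw [hQs.refl, hQs.refl₂]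
        exact hW.ab_rs.2
    · exact F.determines_Q hB.as_br
    · exact F.determines_Qstar hW.br_as
  refine ⟨labelling B W, rfl, equations_of_steps F step, step, fun w hi hw => ?_⟩
  exact eq_of_steps F step hw hi

end Fig1

end HexQuad

namespace HexQuad

/-! ### The second arrangement -/

/-- Values at the vertices of a cube with edges in the directions `a`, `b`, `s`. -/
structure Cube (K : Type*) where
  (o a b s ab as bs abs : K)

/-- Values at six of the vertices of a cube with edges in the directions `a`, `b`, `s`. -/
structure Strip (K : Type*) where
  (o a s as bs abs : K)

namespace Cube

section

variable {K : Type*} [Zero K] [One K] [Add K] [Sub K] [Mul K] [Neg K] [Inv K]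

/-- The values are obtained successively from those at `o`, `a`, `ab`, `as` by means of a quad
equation; `S q v` says that `v` is the solution of `q = 0`. -/
def Eqs (S : (K → K) → K → Prop) (q : K → K → K → K → K → K → K) (a b s : K) (L : Cube K) :
    Prop :=
  S (fun t => q L.a L.o L.ab t a b) L.b ∧
  S (fun t => q L.a L.o L.as t a s) L.s ∧
  S (fun t => q L.a L.ab L.as t b s) L.abs ∧
  S (fun t => q L.as L.s L.abs t a b) L.bs

/-- The conditions which ensure the consistency of the quad equations; `N` means nonzero. -/
def Cond (N : K → Prop) (q : K → K → K → K → K → K → K) (a b s : K) (L : Cube K) : Prop :=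
  N (det2 fun u t => q L.a L.as u t s a) ∧
  N (det2 fun u t => q L.a L.as u t s b) ∧
  N (slope1 fun t => q L.ab L.b L.abs t a s) ∧
  N (slope1 fun t => q L.o L.b L.s t b s) ∧
  N (slope1 fun t => q L.o L.a L.s t a s)

end

/-- The quad equation holds on the faces, and determines the last one of the values there. -/
structure Faces (q : ℂ → ℂ → ℂ → ℂ → ℂ → ℂ → ℂ) (a b s : ℂ) (L : Cube ℂ) : Prop where
  a_ab : Solves (fun t => q L.a L.o L.ab t a b) L.b
  a_as : Solves (fun t => q L.a L.o L.as t a s) L.s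
  a_bs : Solves (fun t => q L.a L.ab L.as t b s) L.abs
  as_ab : Solves (fun t => q L.as L.s L.abs t a b) L.bs
  ab_as : Solves (fun t => q L.ab L.b L.abs t a s) L.bs
  o_bs : Solves (fun t => q L.o L.b L.s t b s) L.bs
  o_as : Solves (fun t => q L.o L.a L.s t a s) L.as

/-- One application of cube consistency with the corner `a` as base point, since the data are given
at `a` and its three neighbours `o`, `ab`, `as`. -/
theorem Eqs.faces {q : ℂ → ℂ → ℂ → ℂ → ℂ → ℂ → ℂ} {reg : ℂ → ℂ} (hq : IsQuad q reg)
    {a b s : ℂ} (ha : reg a ≠ 0) (hb : reg b ≠ 0) (hs : reg s ≠ 0)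
    {L : Cube ℂ} (h : L.Eqs Solves q a b s) (hc : L.Cond (· ≠ 0) q a b s) :
    L.Faces q a b s := by
  obtain ⟨a_ab, a_as, a_bs, as_ab⟩ := h
  obtain ⟨d₁, d₂, e₁, e₂, e₃⟩ := hc
  obtain ⟨o_sb, ab_as⟩ :=
    hq.cube₂ ha hs hb a_as.2 a_ab.2 (hq.swap_eq_zero a_bs.2) as_ab.2 d₁ d₂ a_ab.1
  exact ⟨a_ab, a_as, a_bs, as_ab, ⟨e₁, ab_as⟩, ⟨e₂, hq.swap_eq_zero o_sb⟩,
    ⟨e₃, (hq.refl ..).symm.trans a_as.2⟩⟩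

end Cube

namespace Fig2

section

variable {K : Type*} [Zero K] [One K] [Add K] [Sub K] [Mul K] [Neg K] [Inv K]

/-- The equations for the values which are neither initial values nor obtained within a cube. -/
def Link (S : (K → K) → K → Prop) (F : Fam K) (a b g r s : K) (B W U : Cube K) (V : Strip K) :
    Prop :=
  S (fun t => F.T W.o t B.o B.a a g) W.a ∧
  S (fun t => F.T W.a t B.a B.ab b g) W.ab ∧
  S (fun t => F.T W.a t B.a B.as s g) W.as ∧
  S (fun t => F.H V.o t B.o W.o g r) U.o ∧
  S (fun t => F.T W.o W.a U.o t a r) U.a ∧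
  S (fun t => F.T W.a W.ab U.a t b r) U.ab ∧
  S (fun t => F.T W.a W.as U.a t s r) U.as ∧
  S (fun t => F.T V.o t B.o B.a a r) V.a ∧
  S (fun t => F.T V.o t B.o B.s s r) V.s ∧
  S (fun t => F.Qs V.o V.a V.s t a s) V.as ∧
  S (fun t => F.T V.as t B.as B.abs b r) V.abs ∧
  S (fun t => F.Qs V.as V.s V.abs t a b) V.bs

/-- Conditions for the propagation of the trapezoidal equations. -/
def CondT (N : K → Prop) (F : Fam K) (a b g r s : K) (B W U : Cube K) (V : Strip K) : Prop :=
  N (det2 fun u t => F.T W.a u B.a t a g) ∧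
  N (det2 fun u t => F.T W.a u B.a t b g) ∧
  N (det2 fun u t => F.T W.a u B.a t s g) ∧
  N (det2 fun u t => F.T W.as u B.as t a g) ∧
  N (det2 fun u t => F.T W.as u B.as t b g) ∧
  N (det2 fun u t => F.T W.a u U.a t a r) ∧
  N (det2 fun u t => F.T W.a u U.a t b r) ∧
  N (det2 fun u t => F.T W.a u U.a t s r) ∧
  N (det2 fun u t => F.T W.as u U.as t a r) ∧
  N (det2 fun u t => F.T W.as u U.as t b r) ∧
  N (det2 fun u t => F.T W.ab u U.ab t a r) ∧
  N (det2 fun u t => F.T W.ab u U.ab t s r) ∧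
  N (det2 fun u t => F.T V.o u B.o t a r) ∧
  N (det2 fun u t => F.T V.o u B.o t s r) ∧
  N (det2 fun u t => F.T V.as u B.as t a r) ∧
  N (det2 fun u t => F.T V.as u B.as t b r)

/-- Conditions for the transport of a trapezoidal equation. -/
def Transport (N : K → Prop) (F : Fam K) (a g r w₁₀ w₁₀' w₀₁ y₀₀ y₀₀' y₁₁ : K) : Prop :=
  N (det2 fun s t => F.T w₁₀ s y₀₀ t a g) ∧
  N (slope1 fun s => F.T w₁₀ w₁₀' y₁₁ s a r) ∧
  N (slope1 fun s => F.T w₀₁ s y₀₀ y₀₀' a r)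

/-- Conditions for the translation of a rhombic equation. -/
def Translate (N : K → Prop) (F : Fam K) (a g r w₁₀ w₁₀' w₀₁ y₀₀ y₀₀' y₁₁ : K) : Prop :=
  N (det2 fun s t => F.H w₀₁ t y₀₀ s g r) ∧
  N (det2 fun s t => F.H t y₁₁ s w₁₀ g r) ∧
  N (slope1 fun s => F.T w₁₀ s y₀₀ y₀₀' a g) ∧
  N (slope1 fun s => F.T w₁₀ w₁₀' y₀₀ s a g)

/-- The rhombic equation is carried along the edges `o`–`s`–`as`–`abs` and along `s`–`bs`. Over each
edge the missing trapezoidal face is transported first, and then the rhombic face is translated.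
Over the final edge `bs`–`abs` only the transport is needed. -/
def CondH (N : K → Prop) (F : Fam K) (a b g r s : K) (B W U : Cube K) (V : Strip K) : Prop :=
  Transport N F s g r W.o W.s V.o B.o B.s U.o ∧
  Translate N F s g r W.o W.s V.o B.o B.s U.o ∧
  Transport N F a g r W.s W.as V.s B.s B.as U.s ∧
  Translate N F a g r W.s W.as V.s B.s B.as U.s ∧
  Transport N F b g r W.as W.abs V.as B.as B.abs U.as ∧
  Translate N F b g r W.as W.abs V.as B.as B.abs U.as ∧
  Transport N F b g r W.s W.bs V.s B.s B.bs U.s ∧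
  Translate N F b g r W.s W.bs V.s B.s B.bs U.s ∧
  Transport N F a g r W.bs W.abs V.bs B.bs B.abs U.bs

/-- Conditions for the steps of the evolution. -/
def CondS (N : K → Prop) (F : Fam K) (a b g r s : K) (B W U : Cube K) (V : Strip K) : Prop :=
  N (slope1 fun t => F.C B.a B.o B.ab W.o t (F.sub g a) (F.neg a) (F.sub b a)) ∧
  N (slope1 fun t => F.C B.o B.a B.ab W.o t g a b) ∧
  N (slope1 fun t => F.C B.o B.a B.as V.o t r a s) ∧
  N (slope1 fun t => F.C B.a B.as B.o t V.o (F.sub r s) (F.neg s) (F.sub a s)) ∧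
  N (slope1 fun t => F.Cb V.as V.s V.abs U.s t (F.sub g a) (F.neg a) (F.sub b a)) ∧
  N (slope1 fun t => F.Cb V.s V.as V.abs U.s t g a b) ∧
  N (slope1 fun t => F.Cb W.b W.ab W.abs U.b t r a s) ∧
  N (slope1 fun t => F.Cb W.ab W.abs W.b t U.b (F.sub r s) (F.neg s) (F.sub a s)) ∧
  N (slope1 fun t => F.T t W.ab B.abs B.ab s g) ∧
  N (slope1 fun t => F.T W.b W.o t U.o b r) ∧
  N (slope1 fun t => F.T V.o V.s U.o t s g) ∧
  N (slope1 fun t => F.H V.abs t B.abs W.abs g r)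

end

variable (F : Combination)

/-- The labelling by the values on the four parts. -/
def labelling (B W U : Cube ℂ) (V : Strip ℂ) : Labelling where
  xa := W.o
  xb := B.o
  xc := B.a
  xd := B.ab
  xe := W.ab
  xf := W.b
  ya := U.s
  yb := V.s
  yc := V.as
  yd := V.abs
  ye := U.abs
  yf := U.bs
  za := U.o
  zb := V.o
  zc := B.as
  zd := B.abs
  ze := W.abs
  zf := U.b

theorem equations_of_steps {t : Params} {v : Labelling} (h : Steps F t v) : Equations F t v := by
  obtain ⟨h₁, h₂, h₃, h₄, h₅, h₆, h₇, h₈, h₉, h₁₀, h₁₁, h₁₂⟩ := h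
  exact ⟨h₁.2.2, h₂.2.2, h₉.2.2, h₁₀.2.2, (h₃ _).2 rfl, (h₄ _).2 rfl, (h₅ _).2 rfl, (h₆ _).2 rfl,
    (h₇ _).2 rfl, (h₈ _).2 rfl, (h₁₁ _).2 rfl, (h₁₂ _).2 rfl⟩

theorem eq_of_steps {t : Params} {v w : Labelling} (h : Steps F t v) (hw : Equations F t w)
    (hi : initial w = initial v) : w = v := by
  obtain ⟨h₁, h₂, h₃, h₄, h₅, h₆, h₇, h₈, -, -, h₁₁, h₁₂⟩ := h
  obtain ⟨e₁, e₂, -, -, e₃, e₄, e₅, e₆, e₇, e₈, e₁₁, e₁₂⟩ := hw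
  have xa : w.xa = v.xa := congr_fun hi 0
  have xb : w.xb = v.xb := congr_fun hi 1
  have xc : w.xc = v.xc := congr_fun hi 2
  have xd : w.xd = v.xd := congr_fun hi 3
  have zb : w.zb = v.zb := congr_fun hi 4
  have zc : w.zc = v.zc := congr_fun hi 5
  obtain ⟨xe, xf⟩ : w.xe = v.xe ∧ w.xf = v.xf := h₁.eq_of_hexHolds e₁ fun j => by
    fin_cases j <;> simp [*]
  obtain ⟨yb, yc⟩ : w.yb = v.yb ∧ w.yc = v.yc := h₂.eq_of_hexHolds e₂ fun j => by
    fin_cases j <;> simp [*]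
  simp only [xa, xb, xc, xd, zb, zc, xe, xf, yb, yc] at e₃ e₄ e₅ e₆ e₇ e₈ e₁₁ e₁₂
  have zd := (h₃ _).1 e₃
  have za := (h₄ _).1 e₄
  rw [zd] at e₅ e₇ e₁₁
  rw [za] at e₆ e₈ e₁₂
  have ze := (h₅ _).1 e₅
  have zf := (h₆ _).1 e₆
  have yd := (h₇ _).1 e₇
  have ya := (h₈ _).1 e₈
  rw [ze, yd] at e₁₁
  rw [zf, ya] at e₁₂
  exact Labelling.ext xa xb xc xd xe xf ya yb yc yd ((h₁₁ _).1 e₁₁) ((h₁₂ _).1 e₁₂) za zb zc zd ze zf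

/-- The pieces lie over the corners of a square with directions γ, ρ: `W` is `B` shifted by γ, `V`
is `B` shifted by ρ, and `U` is shifted by both. Thus `B`, `U` are of one type and `W`, `V` of the
other. The trapezoidal faces from `B` to `W`, from `W` to `U` and from `B` to `V` come from
`parallel₂`. Those from `V` to `U` must be transported, starting from the single rhombic equation at
`o`. The rhombic equation arriving at `abs` is the one for `y_e` in step 3. -/
theorem consistent (t : Params) {B W U : Cube ℂ} {V : Strip ℂ}
    (hreg : ∀ i, F.fam.reg (F.coord (t i)) ≠ 0)
    (hB : B.Faces F.fam.Q (F.coord (t 0)) (F.coord (t 1)) (F.coord (t 4)))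
    (hW : W.Faces F.fam.Qs (F.coord (t 0)) (F.coord (t 1)) (F.coord (t 4)))
    (hU : U.Faces F.fam.Q (F.coord (t 0)) (F.coord (t 1)) (F.coord (t 4)))
    (hL : Link Solves F.fam (F.coord (t 0)) (F.coord (t 1)) (F.coord (t 2)) (F.coord (t 3))
      (F.coord (t 4)) B W U V)
    (hT : CondT (· ≠ 0) F.fam (F.coord (t 0)) (F.coord (t 1)) (F.coord (t 2)) (F.coord (t 3))
      (F.coord (t 4)) B W U V)
    (hH : CondH (· ≠ 0) F.fam (F.coord (t 0)) (F.coord (t 1)) (F.coord (t 2)) (F.coord (t 3))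
      (F.coord (t 4)) B W U V)
    (hS : CondS (· ≠ 0) F.fam (F.coord (t 0)) (F.coord (t 1)) (F.coord (t 2)) (F.coord (t 3))
      (F.coord (t 4)) B W U V) :
    Consistent initial (Equations F t) (Steps F t) ![W.o, B.o, B.a, B.ab, V.o, B.as] := by
  have hF := F.good_fam
  have hQ := hF.isQuad_Q
  have hQs := hF.isQuad_Qs
  have ha := hreg 0
  have hb := hreg 1
  have hg := hreg 2
  have hr := hreg 3
  have hs := hreg 4
  have rev {w w' y y' a g : ℂ} (h : F.fam.T w w' y y' a g = 0) : F.fam.T w' w y' y a g = 0 := by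
    rwa [hF.T_symm]
  obtain ⟨wo_a, wa_b, wa_s, ho, uo_a, ua_b, ua_s, vo_a, vo_s, vo_as, vas_b, vas_ab⟩ := hL
  obtain ⟨d₁, d₂, d₃, d₄, d₅, d₆, d₇, d₈, d₉, d₁₀, d₁₁, d₁₂, d₁₃, d₁₄, d₁₅, d₁₆⟩ := hT
  obtain ⟨p₁, q₁, p₂, q₂, p₃, q₃, p₄, q₄, p₅⟩ := hH
  obtain ⟨k₁, k₂, k₃, k₄, k₅, k₆, k₇, k₈, k₉, k₁₀, k₁₁, k₁₂⟩ := hS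
  -- the parameter `γ` between `W` and `B`
  obtain ⟨wab_a, wo_b⟩ := hF.parallel₂ ha hb hg hW.a_ab.2 hB.a_ab.2 hW.a_ab.1 hB.a_ab.1
    (rev wo_a.2) wa_b.2 d₁ d₂
  obtain ⟨was_a, wo_s⟩ := hF.parallel₂ ha hs hg hW.a_as.2 hB.a_as.2 hW.a_as.1 hB.a_as.1
    (rev wo_a.2) wa_s.2 d₁ d₃
  obtain ⟨was_b, wab_s⟩ := hF.parallel₂ hb hs hg hW.a_bs.2 hB.a_bs.2 hW.a_bs.1 hB.a_bs.1
    wa_b.2 wa_s.2 d₂ d₃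
  obtain ⟨wabs_a, ws_b⟩ := hF.parallel₂ ha hb hg hW.as_ab.2 hB.as_ab.2 hW.as_ab.1 hB.as_ab.1
    was_a was_b d₄ d₅
  -- the parameter `ρ` between `W` and `U`
  obtain ⟨uab_a, uo_b⟩ := hF.parallel₂ ha hb hr hW.a_ab.2 hU.a_ab.2 hW.a_ab.1 hU.a_ab.1
    (rev uo_a.2) ua_b.2 d₆ d₇
  obtain ⟨uas_a, uo_s⟩ := hF.parallel₂ ha hs hr hW.a_as.2 hU.a_as.2 hW.a_as.1 hU.a_as.1
    (rev uo_a.2) ua_s.2 d₆ d₈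
  obtain ⟨uas_b, uab_s⟩ := hF.parallel₂ hb hs hr hW.a_bs.2 hU.a_bs.2 hW.a_bs.1 hU.a_bs.1
    ua_b.2 ua_s.2 d₇ d₈
  obtain ⟨uabs_a, us_b⟩ := hF.parallel₂ ha hb hr hW.as_ab.2 hU.as_ab.2 hW.as_ab.1 hU.as_ab.1
    uas_a uas_b d₉ d₁₀
  obtain ⟨-, ub_s⟩ := hF.parallel₂ ha hs hr hW.ab_as.2 hU.ab_as.2 hW.ab_as.1 hU.ab_as.1
    uab_a uab_s d₁₁ d₁₂
  -- the parameter `ρ` between `V` and `B`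
  obtain ⟨vs_a, va_s⟩ := hF.parallel₂ ha hs hr vo_as.2 hB.o_as.2 vo_as.1 hB.o_as.1
    vo_a.2 vo_s.2 d₁₃ d₁₄
  obtain ⟨vabs_a, vs_b⟩ := hF.parallel₂ ha hb hr vas_ab.2 hB.as_ab.2 vas_ab.1 hB.as_ab.1
    (rev vs_a) vas_b.2 d₁₅ d₁₆
  -- the parameter `γ` between `V` and `U`
  have xo_s := hF.transport hs hg hr ho.2 wo_s uo_s vo_s.2 p₁.1 p₁.2.1 p₁.2.2
  have h_s := hF.translate hs hg hr ho.2 wo_s uo_s xo_s vo_s.2 q₁.1 q₁.2.1 q₁.2.2.1 q₁.2.2.2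
  have xs_a := hF.transport ha hg hr h_s (rev was_a) (rev uas_a) vs_a p₂.1 p₂.2.1 p₂.2.2
  have h_as := hF.translate ha hg hr h_s (rev was_a) (rev uas_a) xs_a vs_a
    q₂.1 q₂.2.1 q₂.2.2.1 q₂.2.2.2
  have xas_b := hF.transport hb hg hr h_as was_b uas_b vas_b.2 p₃.1 p₃.2.1 p₃.2.2
  have h_abs := hF.translate hb hg hr h_as was_b uas_b xas_b vas_b.2
    q₃.1 q₃.2.1 q₃.2.2.1 q₃.2.2.2
  have xs_b := hF.transport hb hg hr h_s ws_b us_b vs_b p₄.1 p₄.2.1 p₄.2.2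
  have h_bs := hF.translate hb hg hr h_s ws_b us_b xs_b vs_b q₄.1 q₄.2.1 q₄.2.2.1 q₄.2.2.2
  have xbs_a := hF.transport ha hg hr h_bs (rev wabs_a) (rev uabs_a) (rev vabs_a)
    p₅.1 p₅.2.1 p₅.2.2
  have step : Steps F t (labelling B W U V) := by
    refine ⟨?_, ?_, ?_, ?_, ?_, ?_, ?_, ?_, ?_, ?_, ?_, ?_⟩
    · refine Combination.hexDetermines_four (F.hexHolds_of_faces ha hb hg (n := B.b) (m := W.a)
        ?_ ?_ wo_a.2 wo_b (rev wab_a) wa_b.2) k₁ k₂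
      · rw [← hQ.refl]
        exact hB.a_ab.2
      · rw [← hQs.refl]
        exact hW.a_ab.2
    · refine Combination.hexDetermines_five (F.hexHolds_of_faces hs ha hr (n := B.s) (m := V.a)
        ?_ ?_ (rev va_s) (rev vs_a) (rev vo_s.2) (rev vo_a.2)) k₃ k₄
      · rw [hQ.refl, hQ.refl₂]
        exact hQ.swap_eq_zero hB.o_as.2
      · rw [hQs.refl, hQs.refl₂]
        exact hQs.swap_eq_zero vo_as.2
    · exact F.determines_Q hB.a_bs
    · refine Solves.determines ?_ ?_
      · simpa only [labelling, F.H_eq] using ho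
      · simp only [F.H_eq]
        exact hF.aff_H₂ _ _ _ _ _
    · refine Solves.determines ⟨?_, ?_⟩ ?_
      · simpa only [labelling, F.Hstar_eq] using k₉
      · simpa only [labelling, F.Hstar_eq] using rev wab_s
      · simp only [F.Hstar_eq]
        exact hF.aff_T₁ _ _ _ _ _
    · refine Solves.determines ⟨?_, ?_⟩ ?_
      · simpa only [labelling, F.Hstar_eq] using k₁₀
      · simpa only [labelling, F.Hstar_eq] using rev uo_b
      · simp only [F.Hstar_eq]
        exact hF.aff_T₃ _ _ _ _ _
    · refine Solves.determines ?_ ?_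
      · simpa only [labelling, F.Hstar_eq] using vas_b
      · simp only [F.Hstar_eq]
        exact hF.aff_T₂ _ _ _ _ _
    · refine Solves.determines ⟨?_, ?_⟩ ?_
      · simpa only [labelling, F.Hstar_eq] using k₁₁
      · simpa only [labelling, F.Hstar_eq] using xo_s
      · simp only [F.Hstar_eq]
        exact hF.aff_T₄ _ _ _ _ _
    -- The third hexagon lies in the cube with directions `a`, `b`, γ between `V` and `U`; its
    -- vertices off the hexagon are `U.as` and `V.bs`, and the side faces are the transported ones.
    · refine Combination.hexDetermines_one (F.hexHolds_of_faces ha hb hg (n := U.as) (m := V.bs)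
        ?_ ?_ (rev xbs_a) (rev xas_b) (rev xs_a) (rev xs_b)) k₅ k₆
      · rw [hQ.refl₂]
        exact hU.as_ab.2
      · rw [hQs.refl₂]
        exact vas_ab.2
    · refine Combination.hexDetermines_two (F.hexHolds_of_faces hs ha hr (n := U.ab) (m := W.bs)
        ?_ ?_ ub_s (rev uab_a) uab_s (rev uabs_a)) k₇ k₈
      · exact hQ.swap_eq_zero ((hQ.refl ..).trans hU.ab_as.2)
      · exact hQs.swap_eq_zero ((hQs.refl ..).trans hW.ab_as.2)
    · refine Solves.determines ⟨?_, ?_⟩ ?_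
      · simpa only [labelling, F.H_eq] using k₁₂
      · simpa only [labelling, F.H_eq] using h_abs
      · simp only [F.H_eq]
        exact hF.aff_H₂ _ _ _ _ _
    · exact F.determines_Q hU.o_bs
  refine ⟨labelling B W U V, rfl, equations_of_steps F step, step, fun w hi hw => ?_⟩
  exact eq_of_steps F step hw hi

end Fig2

end HexQuad

namespace HexQuad

/-! ### Genericity of the conditions -/

/-- `v` is the only zero of the affine-linear function `q` over the finite field. -/
def Fp.Solves (q : Fp → Fp) (v : Fp) : Prop := (slope1 q).Unit ∧ v * slope1 q + q 0 = 0

instance (q : Fp → Fp) (v : Fp) : Decidable (Fp.Solves q v) :=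
  inferInstanceAs (Decidable (_ ∧ _))

section

variable {σ : Type*} {p : σ → ZMod 1009}

/-- Solving an affine equation with regular coefficients gives a regular function again. Lattice
values can therefore be constructed one after another, their reductions being the entries of the
finite-field solution. -/
theorem RegAt.exists_solves {q : (σ → ℂ) → ℂ → ℂ} {q' : Fp → Fp} {w : Fp}
    (hq : ∀ {f v}, RegAt p f v → RegAt p (fun z => q z (f z)) (q' v))
    (ha : ∀ z, IsAffine (q z)) (h : Fp.Solves q' w) :
    ∃ f, RegAt p f w ∧ Near p fun z => Solves (q z) (f z) :=
  ⟨_, root1 hq h.1 h.2, ((slope1 hq).near_ne_zero h.1).mono fun z hz => ⟨hz, (ha z).root1 hz⟩⟩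

theorem RegAt.near_slope1 {q : (σ → ℂ) → ℂ → ℂ} {q' : Fp → Fp}
    (hq : ∀ {f v}, RegAt p f v → RegAt p (fun z => q z (f z)) (q' v))
    (h : (HexQuad.slope1 q').Unit) : Near p fun z => HexQuad.slope1 (q z) ≠ 0 :=
  (slope1 hq).near_ne_zero h

theorem RegAt.near_det2 {q : (σ → ℂ) → ℂ → ℂ → ℂ} {q' : Fp → Fp → Fp}
    (hq : ∀ {f v g w}, RegAt p f v → RegAt p g w → RegAt p (fun z => q z (f z) (g z)) (q' v w))
    (h : (HexQuad.det2 q').Unit) : Near p fun z => HexQuad.det2 (q z) ≠ 0 :=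
  (det2 hq).near_ne_zero h

/-- The function `f` is regular with the value `v` at a point of the finite field, which is not
zero. -/
def RegAt₀ (p : σ → ZMod 1009) (f : (σ → ℂ) → ℂ) (v : Fp) : Prop := RegAt p f v ∧ v.val ≠ 0

/-- The function `Q` of four variables is regular, with the reduction `Q'`. -/
def Reg₄ (p : σ → ZMod 1009) (Q : (σ → ℂ) → ℂ → ℂ → ℂ → ℂ → ℂ) (Q' : Fp → Fp → Fp → Fp → Fp) :
    Prop :=
  ∀ ⦃f₁ f₂ f₃ f₄ v₁ v₂ v₃ v₄⦄, RegAt p f₁ v₁ → RegAt p f₂ v₂ → RegAt p f₃ v₃ → RegAt p f₄ v₄ →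
    RegAt p (fun z => Q z (f₁ z) (f₂ z) (f₃ z) (f₄ z)) (Q' v₁ v₂ v₃ v₄)

namespace Reg₄

variable {Q : (σ → ℂ) → ℂ → ℂ → ℂ → ℂ → ℂ} {Q' : Fp → Fp → Fp → Fp → Fp} (h : Reg₄ p Q Q')
  {f₁ f₂ f₃ f₄ : (σ → ℂ) → ℂ} {v₁ v₂ v₃ v₄ w : Fp}

include h

theorem slope₁ (h₂ : RegAt p f₂ v₂) (h₃ : RegAt p f₃ v₃) (h₄ : RegAt p f₄ v₄) (hv : (slope1 fun t => Q' t v₂ v₃ v₄).Unit) :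
    Near p fun z => (slope1 fun t => Q z t (f₂ z) (f₃ z) (f₄ z)) ≠ 0 :=
  RegAt.near_slope1 (fun ht => h ht h₂ h₃ h₄) hv

theorem slope₂ (h₁ : RegAt p f₁ v₁) (h₃ : RegAt p f₃ v₃) (h₄ : RegAt p f₄ v₄) (hv : (slope1 fun t => Q' v₁ t v₃ v₄).Unit) :
    Near p fun z => (slope1 fun t => Q z (f₁ z) t (f₃ z) (f₄ z)) ≠ 0 :=
  RegAt.near_slope1 (fun ht => h h₁ ht h₃ h₄) hv

theorem slope₃ (h₁ : RegAt p f₁ v₁) (h₂ : RegAt p f₂ v₂) (h₄ : RegAt p f₄ v₄) (hv : (slope1 fun t => Q' v₁ v₂ t v₄).Unit) :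
    Near p fun z => (slope1 fun t => Q z (f₁ z) (f₂ z) t (f₄ z)) ≠ 0 :=
  RegAt.near_slope1 (fun ht => h h₁ h₂ ht h₄) hv

theorem slope₄ (h₁ : RegAt p f₁ v₁) (h₂ : RegAt p f₂ v₂) (h₃ : RegAt p f₃ v₃) (hv : (slope1 fun t => Q' v₁ v₂ v₃ t).Unit) :
    Near p fun z => (slope1 fun t => Q z (f₁ z) (f₂ z) (f₃ z) t) ≠ 0 :=
  RegAt.near_slope1 (fun ht => h h₁ h₂ h₃ ht) hv

theorem det₃₄ (h₁ : RegAt p f₁ v₁) (h₂ : RegAt p f₂ v₂) (hv : (det2 fun s t => Q' v₁ v₂ s t).Unit) :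
    Near p fun z => (det2 fun s t => Q z (f₁ z) (f₂ z) s t) ≠ 0 :=
  RegAt.near_det2 (fun hs ht => h h₁ h₂ hs ht) hv

theorem det₂₄ (h₁ : RegAt p f₁ v₁) (h₃ : RegAt p f₃ v₃) (hv : (det2 fun s t => Q' v₁ s v₃ t).Unit) :
    Near p fun z => (det2 fun s t => Q z (f₁ z) s (f₃ z) t) ≠ 0 :=
  RegAt.near_det2 (fun hs ht => h h₁ hs h₃ ht) hv

theorem det₄₂ (h₁ : RegAt p f₁ v₁) (h₃ : RegAt p f₃ v₃) (hv : (det2 fun s t => Q' v₁ t v₃ s).Unit) :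
    Near p fun z => (det2 fun s t => Q z (f₁ z) t (f₃ z) s) ≠ 0 :=
  RegAt.near_det2 (fun hs ht => h h₁ ht h₃ hs) hv

theorem det₃₁ (h₂ : RegAt p f₂ v₂) (h₄ : RegAt p f₄ v₄) (hv : (det2 fun s t => Q' t v₂ s v₄).Unit) :
    Near p fun z => (det2 fun s t => Q z t (f₂ z) s (f₄ z)) ≠ 0 :=
  RegAt.near_det2 (fun hs ht => h ht h₂ hs h₄) hv

theorem exists_solves₂ (h₁ : RegAt p f₁ v₁) (h₃ : RegAt p f₃ v₃) (h₄ : RegAt p f₄ v₄) (ha : ∀ z, IsAffine fun t => Q z (f₁ z) t (f₃ z) (f₄ z))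
    (hv : Fp.Solves (fun t => Q' v₁ t v₃ v₄) w) :
    ∃ f, RegAt p f w ∧ Near p fun z => Solves (fun t => Q z (f₁ z) t (f₃ z) (f₄ z)) (f z) :=
  RegAt.exists_solves (fun ht => h h₁ ht h₃ h₄) ha hv

theorem exists_solves₄ (h₁ : RegAt p f₁ v₁) (h₂ : RegAt p f₂ v₂) (h₃ : RegAt p f₃ v₃) (ha : ∀ z, IsAffine fun t => Q z (f₁ z) (f₂ z) (f₃ z) t)
    (hv : Fp.Solves (fun t => Q' v₁ v₂ v₃ t) w) :
    ∃ f, RegAt p f w ∧ Near p fun z => Solves (fun t => Q z (f₁ z) (f₂ z) (f₃ z) t) (f z) :=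
  RegAt.exists_solves (fun ht => h h₁ h₂ h₃ ht) ha hv

end Reg₄

/-- The function `C` of five variables is regular, with the reduction `C'`. -/
def Reg₅ (p : σ → ZMod 1009) (C : (σ → ℂ) → ℂ → ℂ → ℂ → ℂ → ℂ → ℂ)
    (C' : Fp → Fp → Fp → Fp → Fp → Fp) : Prop :=
  ∀ ⦃f₁ f₂ f₃ f₄ f₅ v₁ v₂ v₃ v₄ v₅⦄, RegAt p f₁ v₁ → RegAt p f₂ v₂ → RegAt p f₃ v₃ →
    RegAt p f₄ v₄ → RegAt p f₅ v₅ →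
    RegAt p (fun z => C z (f₁ z) (f₂ z) (f₃ z) (f₄ z) (f₅ z)) (C' v₁ v₂ v₃ v₄ v₅)

namespace Reg₅

variable {C : (σ → ℂ) → ℂ → ℂ → ℂ → ℂ → ℂ → ℂ} {C' : Fp → Fp → Fp → Fp → Fp → Fp}
  (h : Reg₅ p C C') {f₁ f₂ f₃ f₄ f₅ : (σ → ℂ) → ℂ} {v₁ v₂ v₃ v₄ v₅ : Fp}

include h

theorem slope₃ (h₁ : RegAt p f₁ v₁) (h₂ : RegAt p f₂ v₂) (h₄ : RegAt p f₄ v₄) (h₅ : RegAt p f₅ v₅)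
    (hv : (slope1 fun t => C' v₁ v₂ t v₄ v₅).Unit) : Near p fun z => (slope1 fun t => C z (f₁ z) (f₂ z) t (f₄ z) (f₅ z)) ≠ 0 :=
  RegAt.near_slope1 (fun ht => h h₁ h₂ ht h₄ h₅) hv

theorem slope₄ (h₁ : RegAt p f₁ v₁) (h₂ : RegAt p f₂ v₂) (h₃ : RegAt p f₃ v₃) (h₅ : RegAt p f₅ v₅)
    (hv : (slope1 fun t => C' v₁ v₂ v₃ t v₅).Unit) : Near p fun z => (slope1 fun t => C z (f₁ z) (f₂ z) (f₃ z) t (f₅ z)) ≠ 0 :=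
  RegAt.near_slope1 (fun ht => h h₁ h₂ h₃ ht h₅) hv

theorem slope₅ (h₁ : RegAt p f₁ v₁) (h₂ : RegAt p f₂ v₂) (h₃ : RegAt p f₃ v₃) (h₄ : RegAt p f₄ v₄)
    (hv : (slope1 fun t => C' v₁ v₂ v₃ v₄ t).Unit) : Near p fun z => (slope1 fun t => C z (f₁ z) (f₂ z) (f₃ z) (f₄ z) t) ≠ 0 :=
  RegAt.near_slope1 (fun ht => h h₁ h₂ h₃ h₄ ht) hv

end Reg₅

/-- The quad equation `q` is regular, with the reduction `q'`. -/
def RegQuad (p : σ → ZMod 1009) (q : ℂ → ℂ → ℂ → ℂ → ℂ → ℂ → ℂ)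
    (q' : Fp → Fp → Fp → Fp → Fp → Fp → Fp) : Prop :=
  ∀ {a b v w}, RegAt₀ p a v → RegAt₀ p b w →
    Reg₄ p (fun z x y u t => q x y u t (a z) (b z)) fun x y u t => q' x y u t v w

/-- The values in a layer are regular. -/
structure Layer.Reg (p : σ → ZMod 1009) (L : (σ → ℂ) → Layer ℂ) (L' : Layer Fp) : Prop where
  o : RegAt p (fun z => (L z).o) L'.o
  a : RegAt p (fun z => (L z).a) L'.a
  b : RegAt p (fun z => (L z).b) L'.b
  r : RegAt p (fun z => (L z).r) L'.r
  s : RegAt p (fun z => (L z).s) L'.s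
  ab : RegAt p (fun z => (L z).ab) L'.ab
  as : RegAt p (fun z => (L z).as) L'.as
  bs : RegAt p (fun z => (L z).bs) L'.bs
  br : RegAt p (fun z => (L z).br) L'.br
  rs : RegAt p (fun z => (L z).rs) L'.rs
  abr : RegAt p (fun z => (L z).abr) L'.abr
  abs : RegAt p (fun z => (L z).abs) L'.abs
  ars : RegAt p (fun z => (L z).ars) L'.ars
  brs : RegAt p (fun z => (L z).brs) L'.brs
  abrs : RegAt p (fun z => (L z).abrs) L'.abrs

variable {q : ℂ → ℂ → ℂ → ℂ → ℂ → ℂ → ℂ} {q' : Fp → Fp → Fp → Fp → Fp → Fp → Fp}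
  {reg : ℂ → ℂ} {fa fb fr fs : (σ → ℂ) → ℂ} {va vb vr vs : Fp}

/-- A solution over the finite field guides the construction of a layer of rational functions: each
of the ten solved values is lifted as the root of its face equation. -/
theorem Layer.exists_near (hq : IsQuad q reg) (hr : RegQuad p q q')
    (ha : RegAt₀ p fa va) (hb : RegAt₀ p fb vb) (hr' : RegAt₀ p fr vr) (hs : RegAt₀ p fs vs)
    (L' : Layer Fp) (h : L'.Eqs Fp.Solves q' va vb vr vs) {o a b r s : (σ → ℂ) → ℂ}
    (ho : RegAt p o L'.o) (h_a : RegAt p a L'.a) (h_b : RegAt p b L'.b)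
    (h_r : RegAt p r L'.r) (h_s : RegAt p s L'.s) :
    ∃ L : (σ → ℂ) → Layer ℂ, Layer.Reg p L L' ∧ (∀ z, (L z).o = o z ∧ (L z).a = a z ∧
      (L z).b = b z ∧ (L z).r = r z ∧ (L z).s = s z) ∧
      Near p fun z => (L z).Eqs Solves q (fa z) (fb z) (fr z) (fs z) := by
  obtain ⟨h₁, h₂, h₃, h₄, h₅, h₆, h₇, h₈, h₉, h₁₀⟩ := h
  obtain ⟨ab, hab, e₁⟩ := (hr ha hb).exists_solves₄ ho h_a h_b (fun z => hq.aff _ _ _ _ _) h₁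
  obtain ⟨as, has, e₂⟩ := (hr ha hs).exists_solves₄ ho h_a h_s (fun z => hq.aff _ _ _ _ _) h₂
  obtain ⟨bs, hbs, e₃⟩ := (hr hb hs).exists_solves₄ ho h_b h_s (fun z => hq.aff _ _ _ _ _) h₃
  obtain ⟨br, hbr, e₄⟩ := (hr hb hr').exists_solves₄ ho h_b h_r (fun z => hq.aff _ _ _ _ _) h₄
  obtain ⟨rs, hrs, e₅⟩ := (hr hr' hs).exists_solves₄ ho h_r h_s (fun z => hq.aff _ _ _ _ _) h₅
  obtain ⟨abr, habr, e₆⟩ := (hr ha hr').exists_solves₄ h_b hab hbr (fun z => hq.aff _ _ _ _ _) h₆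
  obtain ⟨abs, habs, e₇⟩ := (hr hb hs).exists_solves₄ h_a hab has (fun z => hq.aff _ _ _ _ _) h₇
  obtain ⟨ars, hars, e₈⟩ := (hr ha hr').exists_solves₄ h_s has hrs (fun z => hq.aff _ _ _ _ _) h₈
  obtain ⟨brs, hbrs, e₉⟩ := (hr hb hr').exists_solves₄ h_s hbs hrs (fun z => hq.aff _ _ _ _ _) h₉
  obtain ⟨abrs, habrs, e₁₀⟩ := (hr hb hr').exists_solves₄ has habs hars (fun z => hq.aff _ _ _ _ _) h₁₀
  exact ⟨fun z => ⟨o z, a z, b z, r z, s z, ab z, as z, bs z, br z, rs z, abr z, abs z, ars z, brs z,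
    abrs z⟩, ⟨ho, h_a, h_b, h_r, h_s, hab, has, hbs, hbr, hrs, habr, habs, hars, hbrs, habrs⟩,
    fun z => ⟨rfl, rfl, rfl, rfl, rfl⟩,
    e₁.and (e₂.and (e₃.and (e₄.and (e₅.and (e₆.and (e₇.and (e₈.and (e₉.and e₁₀))))))))⟩

theorem Layer.Reg.near_cond (hr : RegQuad p q q')
    (ha : RegAt₀ p fa va) (hb : RegAt₀ p fb vb) (hr' : RegAt₀ p fr vr) (hs : RegAt₀ p fs vs)
    {L : (σ → ℂ) → Layer ℂ} {L' : Layer Fp} (hL : Layer.Reg p L L')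
    (h : L'.Cond Fp.Unit q' va vb vr vs) :
    Near p fun z => (L z).Cond (· ≠ 0) q (fa z) (fb z) (fr z) (fs z) := by
  obtain ⟨h₁, h₂, h₃, h₄, h₅, h₆, h₇, h₈, h₉, h₁₀, h₁₁, h₁₂⟩ := h
  exact ((hr ha hb).det₃₄ hL.o hL.a h₁).and (((hr ha hs).det₃₄ hL.o hL.a h₂).and (((hr hs hb).det₃₄ hL.o hL.s h₃).and
    (((hr hs hr').det₃₄ hL.o hL.s h₄).and (((hr ha hb).det₃₄ hL.s hL.as h₅).and (((hr ha hr').det₃₄ hL.s hL.as h₆).and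
    (((hr hs ha).det₃₄ hL.b hL.bs h₇).and (((hr hs hr').det₃₄ hL.b hL.bs h₈).and
    (((hr hb hs).slope₄ hL.r hL.br hL.rs h₉).and (((hr ha hs).slope₄ hL.br hL.abr hL.brs h₁₀).and
    (((hr hr' hs).slope₄ hL.ab hL.abr hL.abs h₁₁).and ((hr ha hb).slope₄ hL.rs hL.ars hL.brs h₁₂)))))))))))

namespace Fam.Regular

variable {F : Fam ℂ} {F' : Fam Fp} (hR : F.Regular F' p)

include hR

theorem regQuad_Q : RegQuad p F.Q F'.Q := fun ha hb _ _ _ _ _ _ _ _ h₁ h₂ h₃ h₄ =>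
  hR.Q h₁ h₂ h₃ h₄ ha.1 ha.2 hb.1 hb.2

theorem regQuad_Qs : RegQuad p F.Qs F'.Qs := fun ha hb _ _ _ _ _ _ _ _ h₁ h₂ h₃ h₄ =>
  hR.Qs h₁ h₂ h₃ h₄ ha.1 ha.2 hb.1 hb.2

theorem regQuad_H : RegQuad p F.H F'.H := fun ha hb _ _ _ _ _ _ _ _ h₁ h₂ h₃ h₄ =>
  hR.H h₁ h₂ h₃ h₄ ha.1 ha.2 hb.1 hb.2

variable {fa fb fg : (σ → ℂ) → ℂ} {va vb vg : Fp}

/-- The trapezoidal equation is `H` at the difference of two parameters, so the coordinate of that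
difference also has to be nonzero modulo 1009. -/
theorem reg_T (ha : RegAt₀ p fa va) (hg : RegAt₀ p fg vg) (h : (F'.sub vg va).Unit) :
    Reg₄ p (fun z w w' y y' => F.T w w' y y' (fa z) (fg z)) fun w w' y y' => F'.T w w' y y' va vg :=
  fun _ _ _ _ _ _ _ _ h₁ h₂ h₃ h₄ =>
    hR.H h₁ h₄ h₃ h₂ (hR.sub hg.1 hg.2 ha.1 ha.2) h.val_ne hg.1 hg.2

theorem reg_C (ha : RegAt₀ p fa va) (hb : RegAt₀ p fb vb) (hg : RegAt₀ p fg vg) :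
    Reg₅ p (fun z x y u v w => F.C x y u v w (fa z) (fb z) (fg z)) fun x y u v w =>
      F'.C x y u v w va vb vg :=
  fun _ _ _ _ _ _ _ _ _ _ h₁ h₂ h₃ h₄ h₅ =>
    hR.C h₁ h₂ h₃ h₄ h₅ ha.1 ha.2 hb.1 hb.2 hg.1 hg.2

theorem reg_Cb (ha : RegAt₀ p fa va) (hb : RegAt₀ p fb vb) (hg : RegAt₀ p fg vg) :
    Reg₅ p (fun z x y u v w => F.Cb x y u v w (fa z) (fb z) (fg z)) fun x y u v w =>
      F'.Cb x y u v w va vb vg :=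
  fun _ _ _ _ _ _ _ _ _ _ h₁ h₂ h₃ h₄ h₅ =>
    hR.Cb h₁ h₂ h₃ h₄ h₅ ha.1 ha.2 hb.1 hb.2 hg.1 hg.2

end Fam.Regular

end

end HexQuad

/-! ### From a nondegenerate solution over the finite field to generic consistency. -/

namespace HexQuad

/-- The conditions on the coordinates of the parameters, and on the differences which occur. -/
def Fp.ParamsUnit (F : Fam Fp) (a b g r s : Fp) : Prop :=
  (a.Unit ∧ b.Unit ∧ g.Unit ∧ r.Unit ∧ s.Unit) ∧
  ((F.reg a).Unit ∧ (F.reg b).Unit ∧ (F.reg g).Unit ∧ (F.reg r).Unit ∧ (F.reg s).Unit) ∧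
  (F.sub g a).Unit ∧ (F.sub g b).Unit ∧ (F.sub g r).Unit ∧ (F.sub g s).Unit ∧
  (F.sub r a).Unit ∧ (F.sub r b).Unit ∧ (F.sub r s).Unit ∧
  (F.sub b a).Unit ∧ (F.sub a s).Unit ∧ (F.neg a).Unit ∧ (F.neg s).Unit

/-- The point of the finite field with given initial values and parameter coordinates. -/
def Fp.point (x : Fin 6 → Fp) (t : Fin 5 → Fp) (i : Fin 6 ⊕ Fin 5) : ZMod 1009 :=
  (Sum.elim x t i).val

theorem Fp.ParamsUnit.near_reg {x : Fin 6 → Fp} {a b g r s : Fp} {F : Combination}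
    (h : ParamsUnit F.fam a b g r s) :
    Near (point x ![a, b, g, r, s]) fun z => ∀ i, F.fam.reg (z (.inr i)) ≠ 0 := by
  obtain ⟨-, ⟨ha, hb, hg, hr, hs⟩, -⟩ := h
  have hR := F.regular_fam (point x ![a, b, g, r, s])
  have near (i v) (hi : val v = point x ![a, b, g, r, s] (.inr i)) (hv : (F.fam.reg v).Unit) :=
    (hR.reg (.var (.inr i) hi)).near_ne_zero hv
  have := (near 0 a rfl ha).and <| (near 1 b rfl hb).and <| (near 2 g rfl hg).and <|
    (near 3 r rfl hr).and <| near 4 s rfl hs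
  refine this.mono fun z hz i => ?_
  fin_cases i
  exacts [hz.1, hz.2.1, hz.2.2.1, hz.2.2.2.1, hz.2.2.2.2]

namespace Fig1

/-- A nondegenerate solution over the finite field. -/
def Witness (F : Fam Fp) (a b g r s : Fp) (B W : Layer Fp) : Prop :=
  Fp.ParamsUnit F a b g r s ∧ Link Fp.Solves F a b g r s B W ∧
  B.Eqs Fp.Solves F.Q a b r s ∧ W.Eqs Fp.Solves F.Qs a b r s ∧
  B.Cond Fp.Unit F.Q a b r s ∧ W.Cond Fp.Unit F.Qs a b r s ∧ Cond Fp.Unit F a b g r s B W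

/-- The lattice values are lifted to rational functions of the eleven coordinates in the order in
which the finite-field solution was built: first the four auxiliary values next to `o`, then the two
layers. All conditions of `consistent` become nonvanishing statements at the chosen point. -/
theorem Witness.caed {F : Combination} {a b g r s : Fp} {B' W' : Layer Fp}
    (h : Witness F.fam a b g r s B' W') : CAED1 F := by
  obtain ⟨hP, ⟨l₁, l₂, l₃, l₄⟩, hB, hW, cB, cW, hC⟩ := h
  set p := Fp.point ![W'.o, B'.o, B'.a, W'.b, W'.r, B'.s] ![a, b, g, r, s]
  have hF := F.good_fam
  have hR := F.regular_fam p
  have hreg := hP.near_reg (x := ![W'.o, B'.o, B'.a, W'.b, W'.r, B'.s])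
  obtain ⟨⟨ha, hb, hg, hr, hs⟩, -, ua, ub, ur, us, -⟩ := hP
  have ra : RegAt₀ p (fun z => z (.inr 0)) a := ⟨.var _ rfl, ha.val_ne⟩
  have rb : RegAt₀ p (fun z => z (.inr 1)) b := ⟨.var _ rfl, hb.val_ne⟩
  have rg : RegAt₀ p (fun z => z (.inr 2)) g := ⟨.var _ rfl, hg.val_ne⟩
  have rr : RegAt₀ p (fun z => z (.inr 3)) r := ⟨.var _ rfl, hr.val_ne⟩
  have rs : RegAt₀ p (fun z => z (.inr 4)) s := ⟨.var _ rfl, hs.val_ne⟩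
  have Wo : RegAt p (fun z => z (.inl 0)) W'.o := .var _ rfl
  have Bo : RegAt p (fun z => z (.inl 1)) B'.o := .var _ rfl
  have Ba : RegAt p (fun z => z (.inl 2)) B'.a := .var _ rfl
  have Wb : RegAt p (fun z => z (.inl 3)) W'.b := .var _ rfl
  have Wr : RegAt p (fun z => z (.inl 4)) W'.r := .var _ rfl
  have Bs : RegAt p (fun z => z (.inl 5)) B'.s := .var _ rfl
  have Ta := hR.reg_T ra rg ua
  have Tb := hR.reg_T rb rg ub
  have Tr := hR.reg_T rr rg ur
  have Ts := hR.reg_T rs rg us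
  obtain ⟨wa, hwa, e₁⟩ := Ta.exists_solves₂ Wo Bo Ba (fun z => hF.aff_T₂ _ _ _ _ _) l₁
  obtain ⟨ws, hws, e₂⟩ := Ts.exists_solves₂ Wo Bo Bs (fun z => hF.aff_T₂ _ _ _ _ _) l₂
  obtain ⟨bb, hbb, e₃⟩ := Tb.exists_solves₄ Wo Wb Bo (fun z => hF.aff_T₄ _ _ _ _ _) l₃
  obtain ⟨br, hbr, e₄⟩ := Tr.exists_solves₄ Wo Wr Bo (fun z => hF.aff_T₄ _ _ _ _ _) l₄
  obtain ⟨B, rB, iB, eB⟩ := Layer.exists_near hF.isQuad_Q hR.regQuad_Q ra rb rr rs B' hB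
    Bo Ba hbb hbr Bs
  obtain ⟨W, rW, iW, eW⟩ := Layer.exists_near hF.isQuad_Qs hR.regQuad_Qs ra rb rr rs W' hW
    Wo hwa Wb Wr hws
  have near_B := rB.near_cond hR.regQuad_Q ra rb rr rs cB
  have near_W := rW.near_cond hR.regQuad_Qs ra rb rr rs cW
  obtain ⟨d₁, d₂, d₃, d₄, d₅, d₆, d₇, d₈, d₉, d₁₀, d₁₁, d₁₂, d₁₃, d₁₄, d₁₅, d₁₆, d₁₇, d₁₈,
    k₁, k₂, k₃, k₄, k₅, k₆, k₇, k₈⟩ := hC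
  have near_C : Near p fun z => Cond (· ≠ 0) F.fam (z (.inr 0)) (z (.inr 1)) (z (.inr 2))
      (z (.inr 3)) (z (.inr 4)) (B z) (W z) :=
    (Ta.det₂₄ rW.o rB.o d₁).and <| (Tb.det₂₄ rW.o rB.o d₂).and <|
    (Tr.det₂₄ rW.o rB.o d₃).and <| (Ts.det₂₄ rW.o rB.o d₄).and <|
    (Tb.det₂₄ rW.a rB.a d₅).and <| (Ts.det₂₄ rW.a rB.a d₆).and <|
    (Ta.det₂₄ rW.b rB.b d₇).and <| (Tr.det₂₄ rW.b rB.b d₈).and <|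
    (Tb.det₂₄ rW.r rB.r d₉).and <| (Ts.det₂₄ rW.r rB.r d₁₀).and <|
    (Ta.det₂₄ rW.s rB.s d₁₁).and <| (Tr.det₂₄ rW.s rB.s d₁₂).and <|
    (Tb.det₂₄ rW.as rB.as d₁₃).and <| (Tr.det₂₄ rW.as rB.as d₁₄).and <|
    (Ta.det₂₄ rW.rs rB.rs d₁₅).and <| (Tb.det₂₄ rW.rs rB.rs d₁₆).and <|
    (Tr.det₂₄ rW.ab rB.ab d₁₇).and <| (Ts.det₂₄ rW.ab rB.ab d₁₈).and <|
    ((hR.reg_C rg ra rb).slope₃ rB.o rB.a rW.o rW.b k₁).and <|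
    ((hR.reg_Cb rg rb ra).slope₃ rW.o rW.b rB.o rB.a k₂).and <|
    ((hR.reg_Cb rg rr rs).slope₃ rW.o rW.r rB.o rB.s k₃).and <|
    ((hR.reg_C rg rs rr).slope₃ rB.o rB.s rW.o rW.r k₄).and <|
    ((hR.reg_C rg ra rb).slope₃ rB.rs rB.ars rW.rs rW.brs k₅).and <|
    ((hR.reg_Cb rg rb ra).slope₃ rW.rs rW.brs rB.rs rB.ars k₆).and <|
    ((hR.reg_Cb rg rr rs).slope₃ rW.ab rW.abr rB.ab rB.abs k₇).and <|
    ((hR.reg_C rg rs rr).slope₃ rB.ab rB.abs rW.ab rW.abr k₈)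
  -- The finitely many open conditions are collected into one polynomial, a product; it is nonzero
  -- because no factor vanishes at `p`.
  obtain ⟨P, hP, hz⟩ := (hreg.and ((eB.and near_B).and ((eW.and near_W).and
    ((e₁.and (e₂.and (e₃.and e₄))).and near_C)))).exists_polynomial
  refine ⟨P, hP, fun x₀ t h => ?_⟩
  obtain ⟨hreg, ⟨eB, cB⟩, ⟨eW, cW⟩, ⟨e₁, e₂, e₃, e₄⟩, hC⟩ := hz _ h
  set z : Fin 6 ⊕ Fin 5 → ℂ := Sum.elim x₀ fun k => F.coord (t k)
  obtain ⟨Bo, Ba, Bb, Br, Bs⟩ := iB z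
  obtain ⟨Wo, Wa, Wb, Wr, Ws⟩ := iW z
  have h := consistent F t hreg (eB.faces hF.isQuad_Q (hreg 0) (hreg 1) (hreg 3) (hreg 4) cB)
    (eW.faces hF.isQuad_Qs (hreg 0) (hreg 1) (hreg 3) (hreg 4) cW)
    (by rw [Link, Bo, Ba, Bb, Br, Bs, Wo, Wa, Wb, Wr, Ws]; exact ⟨e₁, e₂, e₃, e₄⟩) hC
  rw [Bo, Ba, Bs, Wo, Wb, Wr] at h
  convert h
  ext i
  fin_cases i <;> rfl

end Fig1

section

variable {σ : Type*} {p : σ → ZMod 1009}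

/-- The values are regular. -/
structure Cube.Reg (p : σ → ZMod 1009) (L : (σ → ℂ) → Cube ℂ) (L' : Cube Fp) : Prop where
  o : RegAt p (fun z => (L z).o) L'.o
  a : RegAt p (fun z => (L z).a) L'.a
  b : RegAt p (fun z => (L z).b) L'.b
  s : RegAt p (fun z => (L z).s) L'.s
  ab : RegAt p (fun z => (L z).ab) L'.ab
  as : RegAt p (fun z => (L z).as) L'.as
  bs : RegAt p (fun z => (L z).bs) L'.bs
  abs : RegAt p (fun z => (L z).abs) L'.abs

/-- The values are regular. -/
structure Strip.Reg (p : σ → ZMod 1009) (L : (σ → ℂ) → Strip ℂ) (L' : Strip Fp) : Prop where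
  o : RegAt p (fun z => (L z).o) L'.o
  a : RegAt p (fun z => (L z).a) L'.a
  s : RegAt p (fun z => (L z).s) L'.s
  as : RegAt p (fun z => (L z).as) L'.as
  bs : RegAt p (fun z => (L z).bs) L'.bs
  abs : RegAt p (fun z => (L z).abs) L'.abs

variable {q : ℂ → ℂ → ℂ → ℂ → ℂ → ℂ → ℂ} {q' : Fp → Fp → Fp → Fp → Fp → Fp → Fp}
  {reg : ℂ → ℂ} {fa fb fs : (σ → ℂ) → ℂ} {va vb vs : Fp}

theorem Cube.exists_near (hq : IsQuad q reg) (hr : RegQuad p q q')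
    (ha : RegAt₀ p fa va) (hb : RegAt₀ p fb vb) (hs : RegAt₀ p fs vs)
    (L' : Cube Fp) (h : L'.Eqs Fp.Solves q' va vb vs) {o a ab as : (σ → ℂ) → ℂ}
    (ho : RegAt p o L'.o) (h_a : RegAt p a L'.a) (hab : RegAt p ab L'.ab)
    (has : RegAt p as L'.as) :
    ∃ L : (σ → ℂ) → Cube ℂ, Cube.Reg p L L' ∧ (∀ z, (L z).o = o z ∧ (L z).a = a z ∧
      (L z).ab = ab z ∧ (L z).as = as z) ∧
      Near p fun z => (L z).Eqs Solves q (fa z) (fb z) (fs z) := by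
  obtain ⟨h₁, h₂, h₃, h₄⟩ := h
  obtain ⟨b, h_b, e₁⟩ := (hr ha hb).exists_solves₄ h_a ho hab (fun z => hq.aff _ _ _ _ _) h₁
  obtain ⟨s, h_s, e₂⟩ := (hr ha hs).exists_solves₄ h_a ho has (fun z => hq.aff _ _ _ _ _) h₂
  obtain ⟨abs, habs, e₃⟩ := (hr hb hs).exists_solves₄ h_a hab has (fun z => hq.aff _ _ _ _ _) h₃
  obtain ⟨bs, hbs, e₄⟩ := (hr ha hb).exists_solves₄ has h_s habs (fun z => hq.aff _ _ _ _ _) h₄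
  exact ⟨fun z => ⟨o z, a z, b z, s z, ab z, as z, bs z, abs z⟩,
    ⟨ho, h_a, h_b, h_s, hab, has, hbs, habs⟩, fun z => ⟨rfl, rfl, rfl, rfl⟩,
    e₁.and (e₂.and (e₃.and e₄))⟩

theorem Cube.Reg.near_cond (hr : RegQuad p q q')
    (ha : RegAt₀ p fa va) (hb : RegAt₀ p fb vb) (hs : RegAt₀ p fs vs)
    {L : (σ → ℂ) → Cube ℂ} {L' : Cube Fp} (hL : Cube.Reg p L L')
    (h : L'.Cond Fp.Unit q' va vb vs) :
    Near p fun z => (L z).Cond (· ≠ 0) q (fa z) (fb z) (fs z) := by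
  obtain ⟨h₁, h₂, h₃, h₄, h₅⟩ := h
  exact ((hr hs ha).det₃₄ hL.a hL.as h₁).and <| ((hr hs hb).det₃₄ hL.a hL.as h₂).and <|
    ((hr ha hs).slope₄ hL.ab hL.b hL.abs h₃).and <| ((hr hb hs).slope₄ hL.o hL.b hL.s h₄).and <|
    (hr ha hs).slope₄ hL.o hL.a hL.s h₅

end

namespace Fig2

section

variable {σ : Type*} {p : σ → ZMod 1009} {F : Fam ℂ} {F' : Fam Fp} (hR : F.Regular F' p)
  {fa fg fr : (σ → ℂ) → ℂ} {va vg vr : Fp}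
  {f₁ f₂ f₃ f₄ f₅ f₆ : (σ → ℂ) → ℂ} {v₁ v₂ v₃ v₄ v₅ v₆ : Fp}

include hR

theorem near_transport (ha : RegAt₀ p fa va) (hg : RegAt₀ p fg vg) (hr : RegAt₀ p fr vr)
    (hga : (F'.sub vg va).Unit) (hra : (F'.sub vr va).Unit)
    (h₁ : RegAt p f₁ v₁) (h₂ : RegAt p f₂ v₂) (h₃ : RegAt p f₃ v₃) (h₄ : RegAt p f₄ v₄)
    (h₅ : RegAt p f₅ v₅) (h₆ : RegAt p f₆ v₆)
    (h : Transport Fp.Unit F' va vg vr v₁ v₂ v₃ v₄ v₅ v₆) :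
    Near p fun z => Transport (· ≠ 0) F (fa z) (fg z) (fr z) (f₁ z) (f₂ z) (f₃ z) (f₄ z) (f₅ z)
      (f₆ z) :=
  ((hR.reg_T ha hg hga).det₂₄ h₁ h₄ h.1).and <|
    ((hR.reg_T ha hr hra).slope₄ h₁ h₂ h₆ h.2.1).and <|
    (hR.reg_T ha hr hra).slope₂ h₃ h₄ h₅ h.2.2

theorem near_translate (ha : RegAt₀ p fa va) (hg : RegAt₀ p fg vg) (hr : RegAt₀ p fr vr)
    (hga : (F'.sub vg va).Unit)
    (h₁ : RegAt p f₁ v₁) (h₂ : RegAt p f₂ v₂) (h₃ : RegAt p f₃ v₃) (h₄ : RegAt p f₄ v₄)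
    (h₅ : RegAt p f₅ v₅) (h₆ : RegAt p f₆ v₆)
    (h : Translate Fp.Unit F' va vg vr v₁ v₂ v₃ v₄ v₅ v₆) :
    Near p fun z => Translate (· ≠ 0) F (fa z) (fg z) (fr z) (f₁ z) (f₂ z) (f₃ z) (f₄ z) (f₅ z)
      (f₆ z) :=
  ((hR.regQuad_H hg hr).det₄₂ h₃ h₄ h.1).and <| ((hR.regQuad_H hg hr).det₃₁ h₆ h₁ h.2.1).and <|
    ((hR.reg_T ha hg hga).slope₂ h₁ h₄ h₅ h.2.2.1).and <|
    (hR.reg_T ha hg hga).slope₄ h₁ h₂ h₄ h.2.2.2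

end

/-- A nondegenerate solution over the finite field. -/
def Witness (F : Fam Fp) (a b g r s : Fp) (B W U : Cube Fp) (V : Strip Fp) : Prop :=
  Fp.ParamsUnit F a b g r s ∧ Link Fp.Solves F a b g r s B W U V ∧
  B.Eqs Fp.Solves F.Q a b s ∧ W.Eqs Fp.Solves F.Qs a b s ∧ U.Eqs Fp.Solves F.Q a b s ∧
  B.Cond Fp.Unit F.Q a b s ∧ W.Cond Fp.Unit F.Qs a b s ∧ U.Cond Fp.Unit F.Q a b s ∧
  CondT Fp.Unit F a b g r s B W U V ∧ CondH Fp.Unit F a b g r s B W U V ∧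
  CondS Fp.Unit F a b g r s B W U V

/-- The same lifting for the second arrangement. Besides parameters and their differences from γ and
ρ, the hex equations centered at the third and sixth vertices involve β - α, α - ρ̄ and the
negatives of α and ρ̄, whose coordinates must be nonzero as well. -/
theorem Witness.caed {F : Combination} {a b g r s : Fp} {B' W' U' : Cube Fp} {V' : Strip Fp}
    (h : Witness F.fam a b g r s B' W' U' V') : CAED2 F := by
  obtain ⟨hP, ⟨l₁, l₂, l₃, l₄, l₅, l₆, l₇, l₈, l₉, l₁₀, l₁₁, l₁₂⟩, hB, hW, hU, cB, cW, cU,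
    hT, hH, hS⟩ := h
  set p := Fp.point ![W'.o, B'.o, B'.a, B'.ab, V'.o, B'.as] ![a, b, g, r, s]
  have hF := F.good_fam
  have hR := F.regular_fam p
  have hreg := hP.near_reg (x := ![W'.o, B'.o, B'.a, B'.ab, V'.o, B'.as])
  obtain ⟨⟨ha, hb, hg, hr, hs⟩, -, ga, gb, gr, gs, ra', rb', rs', ba, as', na, ns⟩ := hP
  have ra : RegAt₀ p (fun z => z (.inr 0)) a := ⟨.var _ rfl, ha.val_ne⟩
  have rb : RegAt₀ p (fun z => z (.inr 1)) b := ⟨.var _ rfl, hb.val_ne⟩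
  have rg : RegAt₀ p (fun z => z (.inr 2)) g := ⟨.var _ rfl, hg.val_ne⟩
  have rr : RegAt₀ p (fun z => z (.inr 3)) r := ⟨.var _ rfl, hr.val_ne⟩
  have rs : RegAt₀ p (fun z => z (.inr 4)) s := ⟨.var _ rfl, hs.val_ne⟩
  have Wo : RegAt p (fun z => z (.inl 0)) W'.o := .var _ rfl
  have Bo : RegAt p (fun z => z (.inl 1)) B'.o := .var _ rfl
  have Ba : RegAt p (fun z => z (.inl 2)) B'.a := .var _ rfl
  have Bab : RegAt p (fun z => z (.inl 3)) B'.ab := .var _ rfl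
  have Vo : RegAt p (fun z => z (.inl 4)) V'.o := .var _ rfl
  have Bas : RegAt p (fun z => z (.inl 5)) B'.as := .var _ rfl
  have Tag := hR.reg_T ra rg ga
  have Tbg := hR.reg_T rb rg gb
  have Tsg := hR.reg_T rs rg gs
  have Tar := hR.reg_T ra rr ra'
  have Tbr := hR.reg_T rb rr rb'
  have Tsr := hR.reg_T rs rr rs'
  have rga : RegAt₀ p (fun z => F.fam.sub (z (.inr 2)) (z (.inr 0))) _ :=
    ⟨hR.sub rg.1 rg.2 ra.1 ra.2, ga.val_ne⟩
  have rba : RegAt₀ p (fun z => F.fam.sub (z (.inr 1)) (z (.inr 0))) _ :=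
    ⟨hR.sub rb.1 rb.2 ra.1 ra.2, ba.val_ne⟩
  have rrs : RegAt₀ p (fun z => F.fam.sub (z (.inr 3)) (z (.inr 4))) _ :=
    ⟨hR.sub rr.1 rr.2 rs.1 rs.2, rs'.val_ne⟩
  have ras : RegAt₀ p (fun z => F.fam.sub (z (.inr 0)) (z (.inr 4))) _ :=
    ⟨hR.sub ra.1 ra.2 rs.1 rs.2, as'.val_ne⟩
  have rna : RegAt₀ p (fun z => F.fam.neg (z (.inr 0))) _ := ⟨hR.neg ra.1 ra.2, na.val_ne⟩
  have rns : RegAt₀ p (fun z => F.fam.neg (z (.inr 4))) _ := ⟨hR.neg rs.1 rs.2, ns.val_ne⟩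
  obtain ⟨wa, hwa, e₁⟩ := Tag.exists_solves₂ Wo Bo Ba (fun z => hF.aff_T₂ _ _ _ _ _) l₁
  obtain ⟨wab, hwab, e₂⟩ := Tbg.exists_solves₂ hwa Ba Bab (fun z => hF.aff_T₂ _ _ _ _ _) l₂
  obtain ⟨was, hwas, e₃⟩ := Tsg.exists_solves₂ hwa Ba Bas (fun z => hF.aff_T₂ _ _ _ _ _) l₃
  obtain ⟨uo, huo, e₄⟩ := (hR.regQuad_H rg rr).exists_solves₂ Vo Bo Wo
    (fun z => hF.aff_H₂ _ _ _ _ _) l₄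
  obtain ⟨ua, hua, e₅⟩ := Tar.exists_solves₄ Wo hwa huo (fun z => hF.aff_T₄ _ _ _ _ _) l₅
  obtain ⟨uab, huab, e₆⟩ := Tbr.exists_solves₄ hwa hwab hua (fun z => hF.aff_T₄ _ _ _ _ _) l₆
  obtain ⟨uas, huas, e₇⟩ := Tsr.exists_solves₄ hwa hwas hua (fun z => hF.aff_T₄ _ _ _ _ _) l₇
  obtain ⟨B, rB, iB, eB⟩ := Cube.exists_near hF.isQuad_Q hR.regQuad_Q ra rb rs B' hB Bo Ba Bab Bas
  obtain ⟨W, rW, iW, eW⟩ := Cube.exists_near hF.isQuad_Qs hR.regQuad_Qs ra rb rs W' hW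
    Wo hwa hwab hwas
  obtain ⟨U, rU, iU, eU⟩ := Cube.exists_near hF.isQuad_Q hR.regQuad_Q ra rb rs U' hU
    huo hua huab huas
  -- The strip `V` comes last: it needs `B.s` and `B.abs`, which are not initial values but were
  -- solved for within the cube `B`.
  obtain ⟨va, hva, e₈⟩ := Tar.exists_solves₂ Vo rB.o rB.a (fun z => hF.aff_T₂ _ _ _ _ _) l₈
  obtain ⟨vs, hvs, e₉⟩ := Tsr.exists_solves₂ Vo rB.o rB.s (fun z => hF.aff_T₂ _ _ _ _ _) l₉
  obtain ⟨vas, hvas, e₁₀⟩ := (hR.regQuad_Qs ra rs).exists_solves₄ Vo hva hvs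
    (fun z => hF.aff_Qs _ _ _ _ _) l₁₀
  obtain ⟨vabs, hvabs, e₁₁⟩ := Tbr.exists_solves₂ hvas rB.as rB.abs
    (fun z => hF.aff_T₂ _ _ _ _ _) l₁₁
  obtain ⟨vbs, hvbs, e₁₂⟩ := (hR.regQuad_Qs ra rb).exists_solves₄ hvas hvs hvabs
    (fun z => hF.aff_Qs _ _ _ _ _) l₁₂
  obtain ⟨V, hV⟩ : ∃ V : (Fin 6 ⊕ Fin 5 → ℂ) → Strip ℂ,
      V = fun z => ⟨z (.inl 4), va z, vs z, vas z, vbs z, vabs z⟩ := ⟨_, rfl⟩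
  have rV : Strip.Reg p V V' := by
    rw [hV]
    exact ⟨Vo, hva, hvs, hvas, hvbs, hvabs⟩
  have near_B := rB.near_cond hR.regQuad_Q ra rb rs cB
  have near_W := rW.near_cond hR.regQuad_Qs ra rb rs cW
  have near_U := rU.near_cond hR.regQuad_Q ra rb rs cU
  obtain ⟨d₁, d₂, d₃, d₄, d₅, d₆, d₇, d₈, d₉, d₁₀, d₁₁, d₁₂, d₁₃, d₁₄, d₁₅, d₁₆⟩ := hT
  obtain ⟨p₁, q₁, p₂, q₂, p₃, q₃, p₄, q₄, p₅⟩ := hH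
  obtain ⟨k₁, k₂, k₃, k₄, k₅, k₆, k₇, k₈, k₉, k₁₀, k₁₁, k₁₂⟩ := hS
  have near_T : Near p fun z => CondT (· ≠ 0) F.fam (z (.inr 0)) (z (.inr 1)) (z (.inr 2))
      (z (.inr 3)) (z (.inr 4)) (B z) (W z) (U z) (V z) :=
    (Tag.det₂₄ rW.a rB.a d₁).and <| (Tbg.det₂₄ rW.a rB.a d₂).and <|
    (Tsg.det₂₄ rW.a rB.a d₃).and <| (Tag.det₂₄ rW.as rB.as d₄).and <|
    (Tbg.det₂₄ rW.as rB.as d₅).and <| (Tar.det₂₄ rW.a rU.a d₆).and <|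
    (Tbr.det₂₄ rW.a rU.a d₇).and <| (Tsr.det₂₄ rW.a rU.a d₈).and <|
    (Tar.det₂₄ rW.as rU.as d₉).and <| (Tbr.det₂₄ rW.as rU.as d₁₀).and <|
    (Tar.det₂₄ rW.ab rU.ab d₁₁).and <| (Tsr.det₂₄ rW.ab rU.ab d₁₂).and <|
    (Tar.det₂₄ rV.o rB.o d₁₃).and <| (Tsr.det₂₄ rV.o rB.o d₁₄).and <|
    (Tar.det₂₄ rV.as rB.as d₁₅).and <| Tbr.det₂₄ rV.as rB.as d₁₆
  have near_H : Near p fun z => CondH (· ≠ 0) F.fam (z (.inr 0)) (z (.inr 1)) (z (.inr 2))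
      (z (.inr 3)) (z (.inr 4)) (B z) (W z) (U z) (V z) :=
    (near_transport hR rs rg rr gs rs' rW.o rW.s rV.o rB.o rB.s rU.o p₁).and <|
    (near_translate hR rs rg rr gs rW.o rW.s rV.o rB.o rB.s rU.o q₁).and <|
    (near_transport hR ra rg rr ga ra' rW.s rW.as rV.s rB.s rB.as rU.s p₂).and <|
    (near_translate hR ra rg rr ga rW.s rW.as rV.s rB.s rB.as rU.s q₂).and <|
    (near_transport hR rb rg rr gb rb' rW.as rW.abs rV.as rB.as rB.abs rU.as p₃).and <|
    (near_translate hR rb rg rr gb rW.as rW.abs rV.as rB.as rB.abs rU.as q₃).and <|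
    (near_transport hR rb rg rr gb rb' rW.s rW.bs rV.s rB.s rB.bs rU.s p₄).and <|
    (near_translate hR rb rg rr gb rW.s rW.bs rV.s rB.s rB.bs rU.s q₄).and <|
    near_transport hR ra rg rr ga ra' rW.bs rW.abs rV.bs rB.bs rB.abs rU.bs p₅
  have near_S : Near p fun z => CondS (· ≠ 0) F.fam (z (.inr 0)) (z (.inr 1)) (z (.inr 2))
      (z (.inr 3)) (z (.inr 4)) (B z) (W z) (U z) (V z) :=
    ((hR.reg_C rga rna rba).slope₅ rB.a rB.o rB.ab rW.o k₁).and <|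
    ((hR.reg_C rg ra rb).slope₅ rB.o rB.a rB.ab rW.o k₂).and <|
    ((hR.reg_C rr ra rs).slope₅ rB.o rB.a rB.as rV.o k₃).and <|
    ((hR.reg_C rrs rns ras).slope₄ rB.a rB.as rB.o rV.o k₄).and <|
    ((hR.reg_Cb rga rna rba).slope₅ rV.as rV.s rV.abs rU.s k₅).and <|
    ((hR.reg_Cb rg ra rb).slope₅ rV.s rV.as rV.abs rU.s k₆).and <|
    ((hR.reg_Cb rr ra rs).slope₅ rW.b rW.ab rW.abs rU.b k₇).and <|
    ((hR.reg_Cb rrs rns ras).slope₄ rW.ab rW.abs rW.b rU.b k₈).and <|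
    (Tsg.slope₁ rW.ab rB.abs rB.ab k₉).and <| (Tbr.slope₃ rW.b rW.o rU.o k₁₀).and <|
    (Tsg.slope₄ rV.o rV.s rU.o k₁₁).and <| (hR.regQuad_H rg rr).slope₂ rV.abs rB.abs rW.abs k₁₂
  obtain ⟨P, hP, hz⟩ := (hreg.and <| (eB.and near_B).and <| (eW.and near_W).and <|
    (eU.and near_U).and <| (near_T.and <| near_H.and near_S).and <| e₁.and <| e₂.and <| e₃.and <|
    e₄.and <| e₅.and <| e₆.and <| e₇.and <| e₈.and <| e₉.and <| e₁₀.and <|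
    e₁₁.and e₁₂).exists_polynomial
  refine ⟨P, hP, fun x₀ t h => ?_⟩
  obtain ⟨hreg, ⟨eB, cB⟩, ⟨eW, cW⟩, ⟨eU, cU⟩, ⟨hT, hH, hS⟩, e⟩ := hz _ h
  set z : Fin 6 ⊕ Fin 5 → ℂ := Sum.elim x₀ fun k => F.coord (t k)
  obtain ⟨Bo, Ba, Bab, Bas⟩ := iB z
  obtain ⟨Wo, Wa, Wab, Was⟩ := iW z
  obtain ⟨Uo, Ua, Uab, Uas⟩ := iU z
  have h := consistent F t (V := V z) hreg
    (eB.faces hF.isQuad_Q (hreg 0) (hreg 1) (hreg 4) cB)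
    (eW.faces hF.isQuad_Qs (hreg 0) (hreg 1) (hreg 4) cW)
    (eU.faces hF.isQuad_Q (hreg 0) (hreg 1) (hreg 4) cU)
    (by
      rw [hV, Link, Wo, Wa, Wab, Was, Uo, Ua, Uab, Uas]
      rw [Bo, Ba] at e ⊢
      rw [Bab, Bas]
      rw [Bas] at e
      exact e) hT hH hS
  rw [Bo, Ba, Bab, Bas, Wo, hV] at h
  convert h
  ext i
  fin_cases i <;> rfl

end Fig2

end HexQuad

namespace HexQuad

/-! ### Nondegenerate solutions over the finite field -/

instance (F : Fam Fp) (a b g r s : Fp) (B W : Layer Fp) :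
    Decidable (Fig1.Witness F a b g r s B W) := by
  unfold Fig1.Witness Fp.ParamsUnit Fig1.Link Layer.Eqs Layer.Cond Fig1.Cond
  repeat' refine @instDecidableAnd _ _ ?_ ?_
  all_goals infer_instance

instance (F : Fam Fp) (a b g r s : Fp) (B W U : Cube Fp) (V : Strip Fp) :
    Decidable (Fig2.Witness F a b g r s B W U V) := by
  unfold Fig2.Witness Fp.ParamsUnit Fig2.Link Cube.Eqs Cube.Cond Fig2.CondT Fig2.CondH Fig2.CondS
    Fig2.Transport Fig2.Translate
  repeat' refine @instDecidableAnd _ _ ?_ ?_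
  all_goals infer_instance

/-- Each entry lists the five parameter coordinates and then the values in the two layers. The
parameters and the six initial values are free choices; the equations `Link` and `Eqs` force all
other values modulo 1009. Any point at which no checked quantity vanishes would serve. -/
theorem Fig1.exists_witness (F : Combination) :
    ∃ (a b g r s : Fp) (B W : Layer Fp), Witness F.fam a b g r s B W := by
  cases F with
  | C3_half_half_0 => exact ⟨484, 668, 389, 808, 215,
    ⟨500, 30, 995, 684, 400, 544, 812, 908, 60, 25, 939, 949, 151, 366, 604⟩,
    ⟨97, 539, 915, 856, 531, 409, 88, 89, 331, 302, 247, 895, 52, 811, 944⟩, by decide +kernel⟩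
  | C3_half_0_half => exact ⟨444, 623, 781, 786, 3,
    ⟨457, 273, 827, 34, 235, 680, 70, 840, 938, 482, 661, 516, 759, 958, 826⟩,
    ⟨713, 86, 739, 822, 358, 58, 726, 682, 819, 947, 495, 308, 229, 344, 924⟩, by decide +kernel⟩
  | C3_1_0_0 => exact ⟨606, 968, 105, 924, 326,
    ⟨23, 27, 837, 521, 10, 127, 737, 661, 740, 16, 568, 597, 42, 591, 779⟩,
    ⟨32, 76, 666, 555, 943, 250, 165, 380, 53, 658, 28, 20, 374, 813, 292⟩, by decide +kernel⟩
  | C3_0_0_0 => exact ⟨962, 903, 391, 703, 222,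
    ⟨433, 744, 958, 475, 228, 286, 296, 125, 981, 93, 508, 245, 77, 984, 803⟩,
    ⟨993, 565, 30, 541, 675, 837, 213, 570, 507, 419, 868, 281, 594, 621, 143⟩, by decide +kernel⟩
  | C2_1_1_0 => exact ⟨783, 449, 962, 508, 567,
    ⟨354, 237, 692, 257, 780, 781, 159, 571, 46, 718, 345, 649, 221, 953, 693⟩,
    ⟨239, 436, 694, 225, 252, 733, 942, 784, 340, 140, 596, 557, 909, 225, 527⟩, by decide +kernel⟩
  | C2_1_0_1 => exact ⟨471, 976, 297, 949, 23,
    ⟨858, 939, 250, 912, 658, 176, 949, 391, 662, 234, 761, 134, 555, 419, 555⟩,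
    ⟨427, 342, 570, 945, 119, 324, 876, 710, 747, 364, 151, 982, 906, 488, 777⟩, by decide +kernel⟩
  | C2_1_0_0 => exact ⟨103, 191, 645, 742, 881,
    ⟨124, 761, 1008, 124, 739, 945, 925, 65, 974, 625, 69, 284, 86, 491, 945⟩,
    ⟨304, 700, 341, 918, 10, 413, 716, 900, 640, 259, 948, 522, 170, 646, 553⟩, by decide +kernel⟩
  | C1_1 => exact ⟨997, 729, 513, 959, 991,
    ⟨520, 850, 199, 808, 195, 224, 500, 930, 605, 899, 632, 597, 168, 470, 594⟩,
    ⟨433, 261, 933, 687, 773, 246, 654, 938, 277, 997, 417, 84, 156, 207, 764⟩, by decide +kernel⟩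
  | C2_0_0_0 => exact ⟨311, 291, 602, 997, 904,
    ⟨867, 964, 764, 499, 604, 802, 349, 358, 466, 714, 719, 164, 20, 306, 342⟩,
    ⟨512, 703, 518, 403, 355, 483, 1001, 669, 791, 890, 788, 914, 122, 667, 211⟩, by decide +kernel⟩
  | C1_0 => exact ⟨874, 36, 492, 249, 762,
    ⟨414, 425, 830, 609, 376, 327, 66, 919, 130, 854, 738, 170, 452, 42, 492⟩,
    ⟨817, 16, 681, 178, 804, 861, 380, 29, 650, 423, 521, 845, 844, 438, 35⟩, by decide +kernel⟩

/-- As in the first arrangement: parameters, then the cubes `B`, `W`, `U` and the strip `V`. The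
free choices are the parameters and the values `W.o`, `B.o`, `B.a`, `B.ab`, `V.o`, `B.as`. -/
theorem Fig2.exists_witness (F : Combination) :
    ∃ (a b g r s : Fp) (B W U : Cube Fp) (V : Strip Fp),
      Witness F.fam a b g r s B W U V := by
  cases F with
  | C3_half_half_0 => exact ⟨562, 904, 720, 795, 691,
    ⟨384, 89, 599, 648, 450, 521, 645, 342⟩,
    ⟨756, 311, 701, 641, 332, 217, 872, 385⟩,
    ⟨599, 994, 688, 253, 782, 876, 921, 459⟩,
    ⟨680, 819, 662, 467, 60, 379⟩, by decide +kernel⟩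
  | C3_half_0_half => exact ⟨111, 798, 168, 534, 861,
    ⟨380, 502, 68, 504, 751, 481, 676, 274⟩,
    ⟨403, 658, 129, 291, 708, 590, 866, 172⟩,
    ⟨664, 37, 881, 685, 266, 500, 562, 817⟩,
    ⟨31, 498, 754, 586, 330, 721⟩, by decide +kernel⟩
  | C3_1_0_0 => exact ⟨45, 316, 721, 869, 1007,
    ⟨608, 593, 121, 770, 404, 175, 121, 11⟩,
    ⟨630, 816, 658, 589, 961, 206, 647, 304⟩,
    ⟨434, 863, 21, 760, 475, 179, 188, 285⟩,
    ⟨663, 510, 159, 756, 356, 229⟩, by decide +kernel⟩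
  | C3_0_0_0 => exact ⟨173, 515, 233, 1006, 13,
    ⟨205, 553, 797, 214, 943, 562, 134, 85⟩,
    ⟨790, 563, 962, 581, 7, 169, 744, 258⟩,
    ⟨754, 518, 1002, 226, 845, 999, 547, 731⟩,
    ⟨881, 670, 100, 366, 656, 911⟩, by decide +kernel⟩
  | C2_1_1_0 => exact ⟨238, 415, 527, 353, 976,
    ⟨592, 362, 887, 554, 471, 276, 648, 485⟩,
    ⟨868, 491, 412, 33, 178, 809, 438, 565⟩,
    ⟨338, 284, 34, 0, 211, 223, 532, 910⟩,
    ⟨932, 709, 711, 508, 714, 866⟩, by decide +kernel⟩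
  | C2_1_0_1 => exact ⟨676, 562, 624, 981, 747,
    ⟨393, 803, 764, 872, 878, 978, 931, 796⟩,
    ⟨6, 369, 775, 939, 644, 785, 703, 184⟩,
    ⟨475, 749, 375, 250, 631, 686, 834, 88⟩,
    ⟨841, 1005, 986, 386, 770, 867⟩, by decide +kernel⟩
  | C2_1_0_0 => exact ⟨908, 961, 759, 525, 829,
    ⟨532, 797, 957, 211, 575, 437, 47, 238⟩,
    ⟨133, 426, 581, 390, 45, 174, 41, 135⟩,
    ⟨530, 706, 545, 632, 763, 739, 1007, 151⟩,
    ⟨211, 954, 542, 281, 821, 482⟩, by decide +kernel⟩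
  | C1_1 => exact ⟨973, 58, 493, 891, 374,
    ⟨568, 205, 614, 918, 964, 424, 865, 940⟩,
    ⟨584, 259, 320, 881, 987, 949, 433, 643⟩,
    ⟨482, 119, 528, 832, 878, 338, 779, 854⟩,
    ⟨517, 853, 716, 714, 195, 723⟩, by decide +kernel⟩
  | C2_0_0_0 => exact ⟨497, 833, 366, 425, 355,
    ⟨552, 554, 301, 477, 639, 628, 328, 510⟩,
    ⟨2, 395, 576, 580, 382, 475, 251, 599⟩,
    ⟨155, 905, 876, 282, 492, 403, 911, 549⟩,
    ⟨806, 190, 375, 270, 46, 394⟩, by decide +kernel⟩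
  | C1_0 => exact ⟨340, 470, 615, 29, 824,
    ⟨651, 182, 404, 796, 564, 186, 1006, 430⟩,
    ⟨236, 160, 105, 1004, 353, 757, 471, 290⟩,
    ⟨153, 693, 915, 298, 66, 697, 508, 941⟩,
    ⟨599, 523, 358, 111, 834, 653⟩, by decide +kernel⟩

end HexQuad

theorem mainTheorem3 (F : HexQuad.Combination) : HexQuad.CAED1 F ∧ HexQuad.CAED2 F := by
  obtain ⟨_, _, _, _, _, _, _, h₁⟩ := HexQuad.Fig1.exists_witness F
  obtain ⟨_, _, _, _, _, _, _, _, _, h₂⟩ := HexQuad.Fig2.exists_witness F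
  exact ⟨h₁.caed, h₂.caed⟩
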